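/- **Lemma (gradual exchange process).** For orthonormal vectors $v_1,\dots,v_n$, write $T=\operatorname{ws}(w_1,\dots,w_{n-1})$ if $Tv_i=w_iv_{i+1}$ for $i<n$ and $Tv_n=0$ (a weighted shift), and $T=\operatorname{b-ws}(w_1,\dots,w_n)$ if $Tv_i=w_iv_{i+1}$ for all $i$ with $v_{n+1}=v_1$ (a bilateral weighted shift). $\|\cdot\|$ is the operator norm and $[T^*,T]=T^*T-TT^*$. Let $[\underline i_r,\overline i_r]$, $r=1,\dots,m$, be non-empty intervals of integers with $[\underline i_r,\overline i_r]\subset[\underline i_{r+1},\overline i_{r+1}]$, let $\alpha_i$ be real and strictly increasing, and let $c^r_i\in\mathbb C$ for $\underline i_r\le i<\overline i_r$. With respect to some orthonormal basis $(e^r_i)_{\underline i_r\le i\le\overline i_r}$ of a Hilbert space of dimension $\overline i_r-\underline i_r+1$ let $A_r=\operatorname{diag}(\alpha_i)$ and $S_r=\operatorname{ws}(c^r_i)$, and put $A=\bigoplus_rA_r$, $S=\bigoplus_rS_r$. Let $n_0\ge2$, let $a_1<\dots<a_{n_0}$ be real, $I_k=[a_k,a_{k+1})$ for $k+1<n_0$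 and $I_{n_0-1}=[a_{n_0-1},a_{n_0}]$, with $\sigma(A)\subset\bigcup_kI_k$. For an interval $I$ let $\mathscr R_I=\{r:\sigma(A)\cap I\subset\sigma(A_r)\}$ and $r_0(I)=\min\mathscr R_I$. Let $m_k=m+1-r_0(I_k)$ and let $N_{I_k}=N_k\ge1$ be integers with $$\#(\sigma(A)\cap I_k)\ \ge\ \max\bigl(3,\ (2m_k-3)(N_k+1)+4\bigr)\qquad\text{for all }k.$$ For $I=I_k$ put $$G_I=\max_{r\in\mathscr R_I,\ r<m}\ \max_{\alpha_i\in I}\Bigl(\bigl||c_i^{r+1}|-|c_i^r|\bigr|+\frac{\pi}{2N_I}\max(|c_i^r|,|c_i^{r+1}|)\Bigr),$$ $$D_I=\max_{\alpha_i\in I}|c_i^{r_0(I)}|,\qquad T_I=\frac1{N_I}\max_{r\in\mathscr R_I,\ r<m}\ \max_{\alpha_i\in I}\bigl||c_i^{r+1}|^2-|c_i^r|^2\bigr|,$$ where the maxima run over those $i$ for which the weights involved are defined, and $G_I=T_I=0$ if there is no $r\in\mathscr R_I$ with $r<m$. Then there are a self-adjoint $A'$ and an $S'$ commuting with $A'$,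 where $S'$ is a direct sum of weighted shifts in an orthonormal eigenbasis of $A'$, such that $$\|A'-A\|\le\max_k\operatorname{diam}I_k,\qquad\|S'-S\|\le\max_k\max(G_{I_k},D_{I_k}),$$ $$\|[S'^*,S']\|\le\max_k\max\bigl(\|[S^*,S]\|+T_{I_k},\ D_{I_k}^2\bigr),$$ and such that the following hold. 1. Let $\alpha,C_\alpha>0$ be constants such that for every $n$ and every bilateral weighted shift $T\in M_n(\mathbb C)$ there is a normal $X\in M_n(\mathbb C)$ with $\|X-T\|\le C_\alpha\|T\|^{1-2\alpha}\|[T^*,T]\|^\alpha$. Then there is a normal $S''$ commuting with $A'$ that is a direct sum of bilateral weighted shifts in an orthonormal eigenbasis of $A'$, with $$\|S''-S'\|\le C_\alpha\|S\|^{1-2\alpha}\,\|[S'^*,S']\|^\alpha .$$ 2. There is such an $S''$ satisfying the last inequality with $\alpha=1/3$ and $C_{1/3}=5.3308$. 3. If all $c_i^r$ are real, then $S'$ is a direct sum of weighted shifts with real weights in an orthonormal eigenbasis of $A'$ consisting of real linear combinations of the $e_i^r$. Moreover, an $S''$ as in 2 exists that has a real matrix in the basis $(e_i^r)$ and is a direct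 sum of bilateral weighted shifts with real weights in an orthonormal eigenbasis of $A'$ consisting of real linear combinations of the $e^r_i$. -/

import Mathlib

noncomputable section

namespace GradualExchange

/-- The direct sum `⨁ r, T r` on the orthogonal (Hilbert) direct sum of the spaces `E r`. -/
def directSum {m : ℕ} {E : Fin m → Type*} [∀ r, NormedAddCommGroup (E r)]
    [∀ r, InnerProductSpace ℂ (E r)] (T : ∀ r, E r →L[ℂ] E r) :
    PiLp 2 E →L[ℂ] PiLp 2 E :=
  ((PiLp.continuousLinearEquiv 2 ℂ E).symm : (∀ r, E r) →L[ℂ] PiLp 2 E) ∘L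
    ContinuousLinearMap.piMap T ∘L
      ((PiLp.continuousLinearEquiv 2 ℂ E) : PiLp 2 E →L[ℂ] ∀ r, E r)

section Blocks

variable {E : Type*} [NormedAddCommGroup E] [InnerProductSpace ℂ E]

/-- `T = diag(eig i)`, `l ≤ i ≤ u`, with respect to the orthonormal basis `e`. -/
def IsDiag {l u : ℤ} (e : OrthonormalBasis (Set.Icc l u) ℂ E) (eig : ℤ → ℝ)
    (T : E →L[ℂ] E) : Prop :=
  ∀ i : Set.Icc l u, T (e i) = (eig i : ℂ) • e i

/-- `T = ws(c i)` with respect to the orthonormal basis `e` indexed by `l ≤ i ≤ u`: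
`T e_i = c_i e_{i+1}` for `l ≤ i < u` and `T e_u = 0`. -/
def IsWeightedShift {l u : ℤ} (e : OrthonormalBasis (Set.Icc l u) ℂ E) (c : ℤ → ℂ)
    (T : E →L[ℂ] E) : Prop :=
  ∀ i : Set.Icc l u, T (e i) =
    if h : (i : ℤ) + 1 ≤ u then
      c i • e ⟨(i : ℤ) + 1, le_trans i.2.1 (le_of_lt (lt_add_one _)), h⟩
    else 0

/-- `T = b-ws(w)` with respect to the orthonormal basis `b`: `T b_i = w_i b_{i+1}` with the
indices taken cyclically. -/
def IsBilateralShift {n : ℕ} (b : OrthonormalBasis (Fin n) ℂ E) (w : Fin n → ℂ)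
    (T : E →L[ℂ] E) : Prop :=
  ∀ i, T (b i) = w i • b (finRotate n i)

/-- `T` is, in the orthonormal basis `b` split into `p` chains of lengths `n j`, the direct sum
of the (unilateral) weighted shifts with weights `w`. -/
def IsShiftSum {p : ℕ} {n : Fin p → ℕ} (b : OrthonormalBasis (Σ j, Fin (n j)) ℂ E)
    (w : (Σ j, Fin (n j)) → ℂ) (T : E →L[ℂ] E) : Prop :=
  ∀ (j : Fin p) (i : Fin (n j)), T (b ⟨j, i⟩) =
    if h : (i : ℕ) + 1 < n j then w ⟨j, i⟩ • b ⟨j, ⟨(i : ℕ) + 1, h⟩⟩ else 0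

/-- `T` is, in the orthonormal basis `b` split into `p` chains of lengths `n j`, the direct sum
of the bilateral weighted shifts with weights `w`. -/
def IsBilateralShiftSum {p : ℕ} {n : Fin p → ℕ} (b : OrthonormalBasis (Σ j, Fin (n j)) ℂ E)
    (w : (Σ j, Fin (n j)) → ℂ) (T : E →L[ℂ] E) : Prop :=
  ∀ (j : Fin p) (i : Fin (n j)), T (b ⟨j, i⟩) = w ⟨j, i⟩ • b ⟨j, finRotate (n j) i⟩

/-- `b` is an eigenbasis of `A`. -/
def IsEigenbasis {ι : Type*} [Fintype ι] (b : OrthonormalBasis ι ℂ E) (A : E →L[ℂ] E) : Prop :=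
  ∀ x, ∃ μ : ℂ, A (b x) = μ • b x

/-- The vectors of `b` are real linear combinations of the vectors of `B`. -/
def IsRealBasis {ι κ : Type*} [Fintype ι] [Fintype κ] (B : OrthonormalBasis κ ℂ E)
    (b : OrthonormalBasis ι ℂ E) : Prop :=
  ∀ x q, (B.repr (b x) q).im = 0

/-- The matrix of `T` in the basis `B` has real entries. -/
def IsRealOperator {κ : Type*} [Fintype κ] (B : OrthonormalBasis κ ℂ E)
    (T : E →L[ℂ] E) : Prop :=
  ∀ q q', (B.repr (T (B q')) q).im = 0

/-- `T` is a direct sum of weighted shifts in an orthonormal eigenbasis of `A`. -/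
def ShiftSumInEigenbasis (A T : E →L[ℂ] E) : Prop :=
  ∃ (p : ℕ) (n : Fin p → ℕ) (b : OrthonormalBasis (Σ j, Fin (n j)) ℂ E)
    (w : (Σ j, Fin (n j)) → ℂ), IsEigenbasis b A ∧ IsShiftSum b w T

/-- `T` is a direct sum of bilateral weighted shifts in an orthonormal eigenbasis of `A`. -/
def BilateralShiftSumInEigenbasis (A T : E →L[ℂ] E) : Prop :=
  ∃ (p : ℕ) (n : Fin p → ℕ) (b : OrthonormalBasis (Σ j, Fin (n j)) ℂ E)
    (w : (Σ j, Fin (n j)) → ℂ), IsEigenbasis b A ∧ IsBilateralShiftSum b w T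

/-- `T` is a direct sum of weighted shifts with real weights in an orthonormal eigenbasis of `A`
that is obtained from `B` by a real change of basis. -/
def RealShiftSumInEigenbasis {κ : Type*} [Fintype κ] (B : OrthonormalBasis κ ℂ E)
    (A T : E →L[ℂ] E) : Prop :=
  ∃ (p : ℕ) (n : Fin p → ℕ) (b : OrthonormalBasis (Σ j, Fin (n j)) ℂ E)
    (w : (Σ j, Fin (n j)) → ℝ),
    IsRealBasis B b ∧ IsEigenbasis b A ∧ IsShiftSum b (fun x => (w x : ℂ)) T

/-- `T` is a direct sum of bilateral weighted shifts with real weights in an orthonormal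
eigenbasis of `A` that is obtained from `B` by a real change of basis. -/
def RealBilateralShiftSumInEigenbasis {κ : Type*} [Fintype κ] (B : OrthonormalBasis κ ℂ E)
    (A T : E →L[ℂ] E) : Prop :=
  ∃ (p : ℕ) (n : Fin p → ℕ) (b : OrthonormalBasis (Σ j, Fin (n j)) ℂ E)
    (w : (Σ j, Fin (n j)) → ℝ),
    IsRealBasis B b ∧ IsEigenbasis b A ∧ IsBilateralShiftSum b (fun x => (w x : ℂ)) T

/-- The real points of the spectrum (for a self-adjoint operator, the whole spectrum). -/
def realSpectrum (T : E →L[ℂ] E) : Set ℝ := {x : ℝ | (x : ℂ) ∈ spectrum ℂ T}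

/-- The self-commutator `[T*, T] = T* T - T T*`. -/
def selfCommutator [CompleteSpace E] (T : E →L[ℂ] E) : E →L[ℂ] E := star T * T - T * star T

end Blocks

/-- `(γ, C)` is a pair of an exponent and a constant for which every bilateral weighted shift
matrix `T` has a normal matrix within distance `C ‖T‖^(1-2γ) ‖[T*,T]‖^γ`. -/
def NormalApproximationConstants (γ C : ℝ) : Prop :=
  ∀ (n : ℕ) (b : OrthonormalBasis (Fin n) ℂ (EuclideanSpace ℂ (Fin n))) (w : Fin n → ℂ)
    (T : EuclideanSpace ℂ (Fin n) →L[ℂ] EuclideanSpace ℂ (Fin n)),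
    IsBilateralShift b w T →
      ∃ X : EuclideanSpace ℂ (Fin n) →L[ℂ] EuclideanSpace ℂ (Fin n),
        IsStarNormal X ∧ ‖X - T‖ ≤ C * ‖T‖ ^ (1 - 2 * γ) * ‖selfCommutator T‖ ^ γ

/-- The windows cut out by `a 0 < a 1 < ⋯ < a K`: the interval `[a k, a (k+1))`, closed on the
right for the last `k`. -/
def window {K : ℕ} (a : Fin (K + 1) → ℝ) (k : Fin K) : Set ℝ :=
  if (k : ℕ) + 1 = K then Set.Icc (a k.castSucc) (a k.succ)
  else Set.Ico (a k.castSucc) (a k.succ)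

section Constants

variable {m : ℕ} (lo hi : Fin m → ℤ) (eig : ℤ → ℝ) (c : Fin m → ℤ → ℂ)

/-- `G_I`, where `R` is the set of rows `r` that contain the spectrum in `I`. The `r`-th row has
weights `c r i` for `lo r ≤ i < hi r`. The supremum of the empty set is `0`. -/
def constG (R : Set (Fin m)) (I : Set ℝ) (N : ℕ) : ℝ :=
  sSup {x : ℝ | ∃ r s : Fin m, r ∈ R ∧ (s : ℕ) = (r : ℕ) + 1 ∧
    ∃ i : ℤ, lo r ≤ i ∧ i < hi r ∧ eig i ∈ I ∧
      x = |‖c s i‖ - ‖c r i‖| + Real.pi / (2 * N) * max ‖c r i‖ ‖c s i‖}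

/-- `D_I`, where `r₀` is the first row that contains the spectrum in `I`. -/
def constD (r₀ : Fin m) (I : Set ℝ) : ℝ :=
  sSup {x : ℝ | ∃ i : ℤ, lo r₀ ≤ i ∧ i < hi r₀ ∧ eig i ∈ I ∧ x = ‖c r₀ i‖}

/-- `T_I`, with the same conventions as `constG`. -/
def constT (R : Set (Fin m)) (I : Set ℝ) (N : ℕ) : ℝ :=
  1 / N * sSup {x : ℝ | ∃ r s : Fin m, r ∈ R ∧ (s : ℕ) = (r : ℕ) + 1 ∧
    ∃ i : ℤ, lo r ≤ i ∧ i < hi r ∧ eig i ∈ I ∧ x = |‖c s i‖ ^ 2 - ‖c r i‖ ^ 2|}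

end Constants

/-- `R_I`: the set of `r` such that the spectrum of `A` in `I` lies in the spectrum of `A_r`. -/
def rows {m : ℕ} {E : Fin m → Type*} [∀ r, NormedAddCommGroup (E r)]
    [∀ r, InnerProductSpace ℂ (E r)] (A : ∀ r, E r →L[ℂ] E r) (I : Set ℝ) : Set (Fin m) :=
  {r | realSpectrum (directSum A) ∩ I ⊆ realSpectrum (A r)}

end GradualExchange

end

/-! Regard the vectors e^r_i as places of a table with rows r and indices i, and `S` as a family of
paths running along the rows. For an operator that permutes an orthonormal basis up to weights, the
norm is the largest modulus of a weight, and the norm of the self-commutator is the largest change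
of the squared moduli from one place to the next. To make `S` commute with an operator close to `A`
that is constant on every path, no path may enter a window on the left and leave it on the right.
Cutting a path costs the weight that is set to zero. It is cheap only in the first row that contains
the window, where the weights are at most D, so the paths of the later rows must be led to that row
first.

This is done by gradual exchange. Two neighbouring rows with nonnegative weights c, c' are rotated
into each other in N steps of angle π/(2N), after which the paths have changed places. One step
costs |c' - c| + π/(2N) max(c, c') in norm (`rotation_diag_sub_diag_le`, `Exchange.norm_sub_le`).
Interpolating the squares of the weights linearly adds at most |c'^2 - c^2|/N to the commutator.

Number the rows that contain the window by 0, ..., M - 1 and let blocks of N + 1 consecutive indices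
be numbered by t. The exchanges form a checkerboard: for j ≥ 1 the path that enters in row j waits
until block j, then moves to the row before it in every block, so that t + row = 2j from then on,
and is cut in row 0 at the start of block 2j. The path of row 0 is cut at once. The paths that begin
behind the cuts move in the opposite direction. This needs 2M - 3 blocks and four further indices,
which is the cardinality hypothesis. Places connected to the left end of window k get the eigenvalue
a_k and the others a_(k+1). These values fit together where two windows meet, so `A'` is constant on
the paths (`WeightBounds.left_perm`).

For the normal operator, S' is split into chains on which `A'` is scalar, and given constants are
applied to each chain (`exists_normal_of_constants`). The exponent is at most 1/2, so the power of
the norm is monotone. A normal operator commuting with `A'` is jointly diagonalizable with it, hence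
a sum of one-dimensional bilateral shifts.

The exponent 1/3 comes from the same exchange mechanism inside a single chain. The squared weights
are rounded, with hysteresis, to multiples of (N + 1)ε, where ε is the norm of the self-commutator.
The level starts and ends at 0, so its up-jumps and down-jumps match like parentheses. Exchanging
the path at matched jumps closes it up into cycles of constant modulus, that is, into a normal
operator (`IsWalk.exists_exchange`). All rotations are real, which gives the real case. -/

noncomputable section

namespace GradualExchange

/-! ### Weighted permutations of an orthonormal basis -/

section WeightedPerm

variable {E : Type*} [NormedAddCommGroup E] [InnerProductSpace ℂ E]
variable {ι : Type*} [Fintype ι]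

/-- `T` sends every vector of the orthonormal basis `b` to a multiple of another one, as
prescribed by the permutation `π` and the weights `w`. -/
def IsWeightedPerm (b : OrthonormalBasis ι ℂ E) (π : Equiv.Perm ι) (w : ι → ℂ)
    (T : E →L[ℂ] E) : Prop :=
  ∀ q, T (b q) = w q • b (π q)

/-- The operator with `b q ↦ w q • b (π q)`. -/
def weightedPerm (b : OrthonormalBasis ι ℂ E) (π : Equiv.Perm ι) (w : ι → ℂ) : E →L[ℂ] E :=
  ∑ q, w q • (innerSL ℂ (b q)).smulRight (b (π q))

theorem isWeightedPerm_weightedPerm (b : OrthonormalBasis ι ℂ E) (π : Equiv.Perm ι) (w : ι → ℂ) :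
    IsWeightedPerm b π w (weightedPerm b π w) := by
  classical
  intro q
  simp [weightedPerm, orthonormal_iff_ite.mp b.orthonormal]

theorem ext_orthonormalBasis (b : OrthonormalBasis ι ℂ E) {T T' : E →L[ℂ] E}
    (h : ∀ q, T (b q) = T' (b q)) : T = T' := by
  ext x
  rw [← b.sum_repr x]
  simp [map_sum, h]

namespace IsWeightedPerm

variable {b : OrthonormalBasis ι ℂ E} {π : Equiv.Perm ι} {w : ι → ℂ} {T : E →L[ℂ] E}

theorem repr_apply (h : IsWeightedPerm b π w T) (x : E) (q : ι) :
    b.repr (T x) (π q) = w q * b.repr x q := by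
  classical
  conv_lhs => rw [← b.sum_repr x]
  simp [map_sum, h _, OrthonormalBasis.repr_self, Pi.single_apply, mul_comm]

theorem norm_sq_apply (h : IsWeightedPerm b π w T) (x : E) :
    ‖T x‖ ^ 2 = ∑ q, ‖w q‖ ^ 2 * ‖b.repr x q‖ ^ 2 := by
  rw [← b.repr.norm_map, EuclideanSpace.norm_sq_eq, ← Equiv.sum_comp π]
  simp [h.repr_apply, mul_pow]

theorem norm_weight_le (h : IsWeightedPerm b π w T) (q : ι) : ‖w q‖ ≤ ‖T‖ := by
  have := T.le_opNorm (b q)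
  simpa [h q, norm_smul] using this

theorem norm_le (h : IsWeightedPerm b π w T) {M : ℝ} (hM : 0 ≤ M) (hw : ∀ q, ‖w q‖ ≤ M) :
    ‖T‖ ≤ M := by
  refine T.opNorm_le_bound hM fun x => ?_
  refine le_of_sq_le_sq ?_ (by positivity)
  rw [h.norm_sq_apply, mul_pow, ← b.repr.norm_map x, EuclideanSpace.norm_sq_eq, Finset.mul_sum]
  gcongr with q
  exact hw q

theorem star [CompleteSpace E] (h : IsWeightedPerm b π w T) :
    IsWeightedPerm b π.symm (fun q => (starRingEnd ℂ) (w (π.symm q))) (star T) := by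
  classical
  intro q
  refine b.repr.injective (PiLp.ext fun q' => ?_)
  rw [ContinuousLinearMap.star_eq_adjoint, b.repr_apply_apply, b.repr_apply_apply]
  simp only [ContinuousLinearMap.adjoint_inner_right, h q',
    inner_smul_left, inner_smul_right, orthonormal_iff_ite.mp b.orthonormal]
  by_cases hq : π q' = q
  · subst hq; simp
  · have : q' ≠ π.symm q := fun h' => hq (by simp [h'])
    simp [hq, this]

/-- Turns every commutator estimate into slow variation of the squared moduli along `π`; normality
becomes constancy of the moduli on cycles. -/
theorem selfCommutator [CompleteSpace E] (h : IsWeightedPerm b π w T) :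
    IsWeightedPerm b (Equiv.refl ι) (fun q => ((‖w q‖ ^ 2 - ‖w (π.symm q)‖ ^ 2 : ℝ) : ℂ))
      (GradualExchange.selfCommutator T) := by
  intro q
  have h1 : (Star.star T) (b (π q)) = (starRingEnd ℂ) (w q) • b q := by
    simpa using h.star (π q)
  have h2 := h.star q
  have h3 := h (π.symm q)
  simp only [Equiv.apply_symm_apply] at h3
  simp only [GradualExchange.selfCommutator, sub_apply,
    mul_apply_eq_comp, h q, map_smul, h1, h2, h3, smul_smul, Equiv.refl_apply]
  rw [← sub_smul, Complex.mul_conj, mul_comm, Complex.mul_conj]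
  simp [Complex.normSq_eq_norm_sq]

theorem isStarNormal [CompleteSpace E] (h : IsWeightedPerm b π w T)
    (hw : ∀ q, ‖w (π q)‖ = ‖w q‖) : IsStarNormal T := by
  have : GradualExchange.selfCommutator T = 0 := by
    refine ext_orthonormalBasis b fun q => ?_
    have := hw (π.symm q)
    simp only [Equiv.apply_symm_apply] at this
    rw [h.selfCommutator q]; simp [this]
  exact ⟨sub_eq_zero.mp this⟩

theorem norm_selfCommutator_le [CompleteSpace E] (h : IsWeightedPerm b π w T) {M : ℝ}
    (hM : 0 ≤ M) (hw : ∀ q, |‖w (π q)‖ ^ 2 - ‖w q‖ ^ 2| ≤ M) :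
    ‖GradualExchange.selfCommutator T‖ ≤ M := by
  refine h.selfCommutator.norm_le hM fun q => ?_
  have := hw (π.symm q)
  simp only [Equiv.apply_symm_apply] at this
  rwa [Complex.norm_real]

theorem abs_sub_le_norm_selfCommutator [CompleteSpace E] (h : IsWeightedPerm b π w T) (q : ι) :
    |‖w (π q)‖ ^ 2 - ‖w q‖ ^ 2| ≤ ‖GradualExchange.selfCommutator T‖ := by
  have := h.selfCommutator.norm_weight_le (π q)
  rwa [Complex.norm_real, Equiv.symm_apply_apply] at this

theorem sub {w' : ι → ℂ} {T' : E →L[ℂ] E} (h : IsWeightedPerm b π w T)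
    (h' : IsWeightedPerm b π w' T') : IsWeightedPerm b π (w - w') (T - T') := by
  intro q
  simp [h q, h' q, sub_smul]

/-- The eigenvalue may change exactly where the weight vanishes; this is the purpose of the cuts. -/
theorem commute {A : E →L[ℂ] E} {μ : ι → ℂ} (h : IsWeightedPerm b π w T)
    (hA : IsWeightedPerm b (Equiv.refl ι) μ A) (hμ : ∀ q, w q ≠ 0 → μ (π q) = μ q) : Commute A T := by
  refine ext_orthonormalBasis b fun q => ?_
  have h1 := hA q
  have h2 := hA (π q)
  simp only [Equiv.refl_apply] at h1 h2
  simp only [mul_apply_eq_comp, h q, map_smul, h1, h2, smul_smul]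
  by_cases hw : w q = 0
  · simp [hw]
  · rw [hμ q hw, mul_comm]

theorem isSelfAdjoint [CompleteSpace E] {A : E →L[ℂ] E} {μ : ι → ℝ}
    (hA : IsWeightedPerm b (Equiv.refl ι) (fun q => (μ q : ℂ)) A) : IsSelfAdjoint A := by
  refine ext_orthonormalBasis b fun q => ?_
  rw [hA.star q, hA q]; simp

/-- Reindexing the basis. -/
theorem reindex {κ : Type*} [Fintype κ] (h : IsWeightedPerm b π w T) (φ : κ ≃ ι)
    {ρ : Equiv.Perm κ} (hφ : ∀ x, φ (ρ x) = π (φ x)) :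
    IsWeightedPerm (b.reindex φ.symm) ρ (w ∘ φ) T := by
  intro x
  simp [h (φ x), hφ]

theorem spectrum_eq {A : E →L[ℂ] E} {μ : ι → ℂ} (hA : IsWeightedPerm b (Equiv.refl ι) μ A) :
    spectrum ℂ A = Set.range μ := by
  ext z
  rw [spectrum.mem_iff]
  constructor
  · intro hz
    by_contra hmem
    apply hz
    have h1 : IsWeightedPerm b (Equiv.refl ι) (fun q => z - μ q) (algebraMap ℂ (E →L[ℂ] E) z - A) := by
      intro q
      simp [hA q, sub_smul, Algebra.algebraMap_eq_smul_one]
    have hne : ∀ q, z - μ q ≠ 0 := fun q h0 => hmem ⟨q, (sub_eq_zero.mp h0).symm⟩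
    have h2 := isWeightedPerm_weightedPerm b (Equiv.refl ι) (fun q => (z - μ q)⁻¹)
    refine ⟨⟨_, weightedPerm b (Equiv.refl ι) (fun q => (z - μ q)⁻¹), ?_, ?_⟩, rfl⟩
    · refine ext_orthonormalBasis b fun q => ?_
      have h1' := h1 q; have h2' := h2 q
      simp only [Equiv.refl_apply] at h1' h2'
      simp only [mul_apply_eq_comp, h1', h2', map_smul, smul_smul,
        one_apply_eq_self]
      rw [inv_mul_cancel₀ (hne q), one_smul]
    · refine ext_orthonormalBasis b fun q => ?_
      have h1' := h1 q; have h2' := h2 q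
      simp only [Equiv.refl_apply] at h1' h2'
      simp only [mul_apply_eq_comp, h1', h2', map_smul, smul_smul,
        one_apply_eq_self]
      rw [mul_inv_cancel₀ (hne q), one_smul]
  · rintro ⟨q, rfl⟩ ⟨u, hu⟩
    have h0 : (u : E →L[ℂ] E) (b q) = 0 := by
      rw [hu]; simp [hA q, Algebra.algebraMap_eq_smul_one]
    have h1 : ((u⁻¹ : (E →L[ℂ] E)ˣ) : E →L[ℂ] E) ((u : E →L[ℂ] E) (b q)) = b q := by
      have := DFunLike.congr_fun (Units.inv_mul u) (b q)
      rwa [mul_apply_eq_comp] at this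
    rw [h0, map_zero] at h1
    have := b.orthonormal.ne_zero q
    exact this h1.symm

end IsWeightedPerm

end WeightedPerm

/-! ### Real changes of basis -/

section RealBasis

variable {E : Type*} [NormedAddCommGroup E] [InnerProductSpace ℂ E]
variable {ι κ η : Type*} [Fintype ι] [Fintype κ] [Fintype η]

theorem im_sum_eq_zero {α : Type*} (s : Finset α) (f : α → ℂ) (h : ∀ a ∈ s, (f a).im = 0) :
    (∑ a ∈ s, f a).im = 0 := by
  rw [Complex.im_sum]; exact Finset.sum_eq_zero h

theorem im_mul_eq_zero {x y : ℂ} (hx : x.im = 0) (hy : y.im = 0) : (x * y).im = 0 := by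
  simp [Complex.mul_im, hx, hy]

theorem IsRealBasis.trans {B : OrthonormalBasis κ ℂ E} {b : OrthonormalBasis ι ℂ E}
    {b' : OrthonormalBasis η ℂ E} (h : IsRealBasis B b) (h' : IsRealBasis b b') :
    IsRealBasis B b' := by
  intro x q
  rw [← b.sum_repr (b' x)]
  simp only [map_sum, map_smul, WithLp.ofLp_sum, Finset.sum_apply, WithLp.ofLp_smul,
    Pi.smul_apply, smul_eq_mul]
  exact im_sum_eq_zero _ _ fun y _ => im_mul_eq_zero (h' x y) (h y q)

theorem IsRealBasis.reindex {B : OrthonormalBasis κ ℂ E} {b : OrthonormalBasis ι ℂ E}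
    (h : IsRealBasis B b) (φ : ι ≃ η) : IsRealBasis B (b.reindex φ) := by
  intro x q
  simpa using h (φ.symm x) q

theorem IsWeightedPerm.isRealOperator {B : OrthonormalBasis κ ℂ E} {b : OrthonormalBasis ι ℂ E}
    {π : Equiv.Perm ι} {w : ι → ℂ} {T : E →L[ℂ] E} (hT : IsWeightedPerm b π w T)
    (h : IsRealBasis B b) (hw : ∀ x, (w x).im = 0) : IsRealOperator B T := by
  intro q q'
  rw [← b.sum_repr (B q')]
  simp only [map_sum, map_smul, hT _, WithLp.ofLp_sum, Finset.sum_apply, WithLp.ofLp_smul,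
    Pi.smul_apply, smul_eq_mul]
  refine im_sum_eq_zero _ _ fun y _ => im_mul_eq_zero ?_ (im_mul_eq_zero (hw y) (h _ q))
  have := h y q'
  rw [B.repr_apply_apply] at this
  rw [b.repr_apply_apply, ← inner_conj_symm, Complex.conj_im, this, neg_zero]

end RealBasis

end GradualExchange

end

noncomputable section

namespace GradualExchange

/-! ### Cycles of a permutation, and phases along them -/

section Cycles

theorem coe_finRotate_eq {n : ℕ} (i : Fin n) : (finRotate n i : ℕ) = ((i : ℕ) + 1) % n := by
  cases n with
  | zero => exact i.elim0
  | succ n =>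
    rw [finRotate_apply, Fin.val_add, Fin.val_one']
    simp

theorem finRotate_of_lt {n : ℕ} {i : Fin n} (h : (i : ℕ) + 1 < n) :
    finRotate n i = ⟨(i : ℕ) + 1, h⟩ :=
  Fin.ext (by rw [coe_finRotate_eq, Nat.mod_eq_of_lt h])

variable {ι : Type*} [Finite ι]

/-- A permutation of a finite type is a disjoint union of cycles; the last element of every cycle
can be chosen to satisfy a predicate that holds somewhere on the cycle. -/
theorem exists_cycle_decomposition (π : Equiv.Perm ι) (P : ι → Prop)
    (hP : ∀ q, ∃ k : ℕ, P (π^[k] q)) :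
    ∃ (p : ℕ) (n : Fin p → ℕ) (φ : (Σ j, Fin (n j)) ≃ ι),
      (∀ x : Σ j, Fin (n j), φ ⟨x.1, finRotate (n x.1) x.2⟩ = π (φ x)) ∧
      ∀ x : Σ j, Fin (n j), (x.2 : ℕ) + 1 = n x.1 → P (φ x) := by
  classical
  let s := Equiv.Perm.SameCycle.setoid π
  obtain ⟨p, ⟨e⟩⟩ := Finite.exists_equiv_fin (Quotient s)
  have hsame : ∀ (k : ℕ) (q : ι), (Quotient.mk s (π^[k] q)) = Quotient.mk s q := fun k q =>
    Quotient.sound (show π.SameCycle (π^[k] q) q from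
      (Equiv.Perm.SameCycle.symm ⟨k, by rw [zpow_natCast, Equiv.Perm.coe_pow]⟩))
  have hrep : ∀ c : Quotient s, ∃ r, Quotient.mk s r = c ∧ P r := by
    intro c
    obtain ⟨q, rfl⟩ := Quotient.exists_rep c
    obtain ⟨k, hk⟩ := hP q
    exact ⟨_, hsame k q, hk⟩
  choose rep hrep1 hrep2 using hrep
  have hpos : ∀ r, 0 < Function.minimalPeriod π r := fun r =>
    Function.minimalPeriod_pos_of_mem_periodicPts
      (Function.Injective.mem_periodicPts π.injective r)
  let n : Fin p → ℕ := fun j => Function.minimalPeriod π (rep (e.symm j))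
  -- The exponent starts at 1 rather than 0, so that the representative, which satisfies `P`, comes
  -- last in its cycle.
  let f : (Σ j, Fin (n j)) → ι := fun x => π^[(x.2 : ℕ) + 1] (rep (e.symm x.1))
  have hclass : ∀ x, Quotient.mk s (f x) = e.symm x.1 := fun x => by
    rw [hsame, hrep1]
  have hf : Function.Bijective f := by
    constructor
    · rintro ⟨j, i⟩ ⟨j', i'⟩ h
      have hj : j = j' := e.symm.injective (by rw [← hclass ⟨j, i⟩, ← hclass ⟨j', i'⟩, h])
      subst hj
      simp only [f, Function.iterate_succ_apply'] at h
      have h2 := (Function.iterate_eq_iterate_iff_of_lt_minimalPeriod i.2 i'.2).mp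
        (π.injective h)
      rw [Fin.ext h2]
    · intro x
      obtain ⟨y, rfl⟩ := π.surjective x
      have hsc : π.SameCycle (rep (Quotient.mk s y)) y := Quotient.exact (hrep1 _)
      obtain ⟨k, hk⟩ := hsc.exists_nat_pow_eq
      refine ⟨⟨e (Quotient.mk s y), ⟨k % n _, Nat.mod_lt _ (hpos _)⟩⟩, ?_⟩
      simp only [f, n, Function.iterate_succ_apply']
      rw [Function.iterate_mod_minimalPeriod_eq, e.symm_apply_apply, ← Equiv.Perm.coe_pow, hk]
  refine ⟨p, n, Equiv.ofBijective f hf, ?_, ?_⟩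
  · rintro ⟨j, i⟩
    simp only [Equiv.ofBijective_apply, f, coe_finRotate_eq]
    rw [Function.iterate_succ_apply', Function.iterate_mod_minimalPeriod_eq]
  · rintro ⟨j, i⟩ hi
    simp only at hi
    simp only [Equiv.ofBijective_apply, f, hi, n, Function.iterate_minimalPeriod]
    exact hrep2 _

/-- The unimodular number with `z = ‖z‖ * phase z` (`1` for `z = 0`). -/
def phase (z : ℂ) : ℂ := if z = 0 then 1 else z / ‖z‖

theorem norm_phase (z : ℂ) : ‖phase z‖ = 1 := by
  unfold phase
  split_ifs with h
  · simp
  · simp [h]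

theorem norm_mul_phase (z : ℂ) : ‖z‖ * phase z = z := by
  unfold phase
  split_ifs with h
  · simp [h]
  · have : (‖z‖ : ℂ) ≠ 0 := by simpa using h
    field_simp

theorem im_phase {z : ℂ} (h : z.im = 0) : (phase z).im = 0 := by
  unfold phase
  split_ifs
  · simp
  · rw [Complex.div_ofReal_im, h, zero_div]

/-- Multiply the phases of the weights along each cycle, starting behind a zero weight. The
recursion closes up because it is vacuous at that zero weight. -/
theorem exists_phases (π : Equiv.Perm ι) (c : ι → ℂ) (h0 : ∀ q, ∃ k : ℕ, c (π^[k] q) = 0) :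
    ∃ u : ι → ℂ, (∀ q, ‖u q‖ = 1) ∧ (∀ q, u q * c q = ‖c q‖ * u (π q)) ∧
      ((∀ q, (c q).im = 0) → ∀ q, (u q).im = 0) := by
  classical
  obtain ⟨p, n, φ, hφ, hlast⟩ := exists_cycle_decomposition π (fun q => c q = 0) h0
  let g : Fin p → ℕ → ℂ := fun j k => if h : k < n j then phase (c (φ ⟨j, ⟨k, h⟩⟩)) else 1
  let U : (Σ j, Fin (n j)) → ℂ := fun x => ∏ k ∈ Finset.range x.2, g x.1 k
  have hg : ∀ j k, ‖g j k‖ = 1 := by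
    intro j k
    simp only [g]
    split_ifs
    · exact norm_phase _
    · simp
  refine ⟨fun q => U (φ.symm q), fun q => ?_, fun q => ?_, fun hc q => ?_⟩
  · simp only [U]
    rw [norm_prod, Finset.prod_congr rfl fun k _ => hg _ k, Finset.prod_const_one]
  · obtain ⟨x, rfl⟩ := φ.surjective q
    rw [← hφ x]
    simp only [Equiv.symm_apply_apply]
    rcases lt_or_eq_of_le (Nat.succ_le_of_lt x.2.2) with h | h
    · rw [finRotate_of_lt h]
      simp only [U, Finset.prod_range_succ]
      have : g x.1 x.2 = phase (c (φ x)) := by simp [g]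
      rw [this]
      conv_lhs => rw [← norm_mul_phase (c (φ x))]
      ring
    · rw [hlast x h]; simp
  · simp only [U]
    refine Finset.prod_induction _ (fun z : ℂ => z.im = 0) (fun a b => im_mul_eq_zero) (by simp)
      fun k _ => ?_
    simp only [g]
    split_ifs
    · exact im_phase (hc _)
    · simp

end Cycles

/-! ### Rescaling and reindexing bases -/

section Bases

variable {E : Type*} [NormedAddCommGroup E] [InnerProductSpace ℂ E]
variable {ι κ : Type*} [Fintype ι] [Fintype κ]

theorem exists_orthonormalBasis (b : OrthonormalBasis ι ℂ E) {v : ι → E} (hv : Orthonormal ℂ v) :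
    ∃ b' : OrthonormalBasis ι ℂ E, ∀ q, b' q = v q := by
  have := b.toBasis.finiteDimensional_of_finite
  have hspan : ⊤ ≤ Submodule.span ℂ (Set.range v) := by
    rw [hv.linearIndependent.span_eq_top_of_card_eq_finrank'
      (Module.finrank_eq_card_basis b.toBasis).symm]
  exact ⟨OrthonormalBasis.mk hv hspan, fun q => by rw [OrthonormalBasis.coe_mk]⟩

/-- If every cycle of the permutation has a zero weight, the weights can be made nonnegative by
rescaling the basis vectors. -/
theorem IsWeightedPerm.exists_nonneg {b : OrthonormalBasis ι ℂ E} {π : Equiv.Perm ι} {c : ι → ℂ}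
    {T : E →L[ℂ] E} (h : IsWeightedPerm b π c T) (h0 : ∀ q, ∃ k : ℕ, c (π^[k] q) = 0) :
    ∃ b' : OrthonormalBasis ι ℂ E, IsWeightedPerm b' π (fun q => (‖c q‖ : ℂ)) T ∧
      (∀ q, ∃ u : ℂ, b' q = u • b q) ∧ ((∀ q, (c q).im = 0) → IsRealBasis b b') := by
  classical
  obtain ⟨u, hu1, hu2, hu3⟩ := exists_phases π c h0
  have hon : Orthonormal ℂ (fun q => u q • b q) := by
    rw [orthonormal_iff_ite]
    intro q q'
    rw [inner_smul_left, inner_smul_right, b.inner_eq_ite]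
    split_ifs with hq
    · subst hq
      rw [mul_one, Complex.conj_mul', hu1]; simp
    · simp
  obtain ⟨b', hb'⟩ := exists_orthonormalBasis b hon
  refine ⟨b', fun q => ?_, fun q => ⟨u q, hb' q⟩, fun hc x q => ?_⟩
  · rw [hb', hb', map_smul, h q, smul_smul, smul_smul, hu2]
  · rw [hb', map_smul, b.repr_self]
    simp only [WithLp.ofLp_smul, Pi.smul_apply, smul_eq_mul, PiLp.single_apply]
    refine im_mul_eq_zero (hu3 hc x) ?_
    split_ifs <;> simp

theorem IsWeightedPerm.isBilateralShiftSum {p : ℕ} {n : Fin p → ℕ}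
    {b : OrthonormalBasis (Σ j, Fin (n j)) ℂ E} {w : (Σ j, Fin (n j)) → ℂ} {T : E →L[ℂ] E}
    (h : IsWeightedPerm b (Equiv.sigmaCongrRight fun j => finRotate (n j)) w T) :
    IsBilateralShiftSum b w T := fun j i => h ⟨j, i⟩

theorem IsWeightedPerm.isShiftSum {p : ℕ} {n : Fin p → ℕ}
    {b : OrthonormalBasis (Σ j, Fin (n j)) ℂ E} {w : (Σ j, Fin (n j)) → ℂ} {T : E →L[ℂ] E}
    (h : IsWeightedPerm b (Equiv.sigmaCongrRight fun j => finRotate (n j)) w T)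
    (h0 : ∀ x : Σ j, Fin (n j), (x.2 : ℕ) + 1 = n x.1 → w x = 0) :
    IsShiftSum b w T := by
  intro j i
  rw [h ⟨j, i⟩]
  split_ifs with hi
  · simp [finRotate_of_lt hi]
  · rw [h0 ⟨j, i⟩ (by have := i.2; simp only; omega), zero_smul]

/-- A weighted permutation is, after reindexing, a direct sum of bilateral weighted shifts, and
the last weight of each of them can be chosen among the weights with a given property. -/
theorem IsWeightedPerm.exists_reindex {b : OrthonormalBasis ι ℂ E} {π : Equiv.Perm ι} {w : ι → ℂ}
    {T : E →L[ℂ] E} (h : IsWeightedPerm b π w T) (P : ι → Prop)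
    (hP : ∀ q, ∃ k : ℕ, P (π^[k] q)) :
    ∃ (p : ℕ) (n : Fin p → ℕ) (φ : (Σ j, Fin (n j)) ≃ ι),
      IsWeightedPerm (b.reindex φ.symm) (Equiv.sigmaCongrRight fun j => finRotate (n j))
        (w ∘ φ) T ∧
      (∀ x : Σ j, Fin (n j), φ ⟨x.1, finRotate (n x.1) x.2⟩ = π (φ x)) ∧
      ∀ x : Σ j, Fin (n j), (x.2 : ℕ) + 1 = n x.1 → P (φ x) := by
  obtain ⟨p, n, φ, hφ, hlast⟩ := exists_cycle_decomposition π P hP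
  exact ⟨p, n, φ, h.reindex φ hφ, hφ, hlast⟩

end Bases

end GradualExchange

end

noncomputable section

namespace GradualExchange

/-! ### Norm estimate for one rotation step -/

section TwoByTwo

theorem norm_cos_sin_sub_le (φ ψ : ℝ) :
    ‖(⟨Real.cos ψ, Real.sin ψ⟩ : ℂ) - ⟨Real.cos φ, Real.sin φ⟩‖ ≤ |ψ - φ| := by
  have h : ∀ x : ℝ, (⟨Real.cos x, Real.sin x⟩ : ℂ) = Complex.exp (Complex.I * x) := fun x => by
    rw [mul_comm, Complex.exp_mul_I]
    apply Complex.ext <;> simp [← Complex.ofReal_cos, ← Complex.ofReal_sin]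
  have h2 : Complex.exp (Complex.I * ψ) - Complex.exp (Complex.I * φ) =
      Complex.exp (Complex.I * φ) * (Complex.exp (Complex.I * ((ψ - φ : ℝ) : ℂ)) - 1) := by
    rw [mul_sub, ← Complex.exp_add, mul_one]
    congr 2
    push_cast; ring
  rw [h, h, h2, norm_mul, mul_comm Complex.I (φ : ℂ), Complex.norm_exp_ofReal_mul_I, one_mul]
  exact Real.norm_exp_I_mul_ofReal_sub_one_le

/-- The matrix `R_ψ diag(w₁, w₂) R_{-φ} - diag(c₁, c₂)` is small if the angles are close and the
weights are close. -/
theorem rotation_diag_sub_diag_le {w₁ w₂ c₁ c₂ l h φ ψ M : ℝ} (hl : 0 ≤ l)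
    (hw₁ : w₁ ∈ Set.Icc l h) (hw₂ : w₂ ∈ Set.Icc l h) (hc₁ : c₁ ∈ Set.Icc l h)
    (hc₂ : c₂ ∈ Set.Icc l h) (hM : h - l + |ψ - φ| * h ≤ M) (X Y : ℝ) :
    ((Real.cos φ * w₁ * Real.cos ψ + Real.sin φ * w₂ * Real.sin ψ - c₁) * X +
      (Real.sin φ * w₁ * Real.cos ψ - Real.cos φ * w₂ * Real.sin ψ) * Y) ^ 2 +
    ((Real.cos φ * w₂ * Real.cos ψ + Real.sin φ * w₁ * Real.sin ψ - c₂) * Y +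
      (Real.cos φ * w₁ * Real.sin ψ - Real.sin φ * w₂ * Real.cos ψ) * X) ^ 2 ≤
    M ^ 2 * (X ^ 2 + Y ^ 2) := by
  obtain ⟨hw₁l, hw₁h⟩ := hw₁
  obtain ⟨hw₂l, hw₂h⟩ := hw₂
  obtain ⟨hc₁l, hc₁h⟩ := hc₁
  obtain ⟨hc₂l, hc₂h⟩ := hc₂
  have hh : 0 ≤ h := hl.trans (hw₁l.trans hw₁h)
  -- Identify the plane with ℂ: a rotation is multiplication by a unimodular number, and a diagonal
  -- matrix acts as z ↦ m z + d z̄, with m half the sum and d half the difference of its entries.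
  set z : ℂ := ⟨X, Y⟩ with hz
  set u : ℂ := ⟨Real.cos φ, Real.sin φ⟩ with hu
  set v : ℂ := ⟨Real.cos ψ, Real.sin ψ⟩ with hv
  have hunorm : ‖u‖ = 1 := by
    rw [← sq_eq_sq₀ (norm_nonneg _) zero_le_one, Complex.sq_norm, Complex.normSq_apply]
    simp only [hu]
    nlinarith [Real.sin_sq_add_cos_sq φ]
  have huu : u * (starRingEnd ℂ) u = 1 := by rw [Complex.mul_conj', hunorm]; simp
  set m : ℝ := (w₁ + w₂) / 2 with hm
  set d : ℝ := (w₁ - w₂) / 2 with hd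
  set m' : ℝ := (c₁ + c₂) / 2 with hm'
  set d' : ℝ := (c₁ - c₂) / 2 with hd'
  set Z : ℂ := v * (m * (starRingEnd ℂ) u * z + d * u * (starRingEnd ℂ) z) -
    (m' * z + d' * (starRingEnd ℂ) z) with hZ
  have e1 : (Real.cos φ * w₁ * Real.cos ψ + Real.sin φ * w₂ * Real.sin ψ - c₁) * X +
      (Real.sin φ * w₁ * Real.cos ψ - Real.cos φ * w₂ * Real.sin ψ) * Y = Z.re := by
    simp [hZ, hu, hv, hz, hm, hd, hm', hd', Complex.mul_re, Complex.mul_im]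
    ring
  have e2 : (Real.cos φ * w₂ * Real.cos ψ + Real.sin φ * w₁ * Real.sin ψ - c₂) * Y +
      (Real.cos φ * w₁ * Real.sin ψ - Real.sin φ * w₂ * Real.cos ψ) * X = Z.im := by
    simp [hZ, hu, hv, hz, hm, hd, hm', hd', Complex.mul_re, Complex.mul_im]
    ring
  have e3 : X ^ 2 + Y ^ 2 = ‖z‖ ^ 2 := by
    rw [Complex.sq_norm, Complex.normSq_apply]; simp only [hz]; ring
  have e4 : Z.re ^ 2 + Z.im ^ 2 = ‖Z‖ ^ 2 := by
    rw [Complex.sq_norm, Complex.normSq_apply]; ring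
  rw [e1, e2, e3, e4, ← mul_pow]
  -- The first summand is the effect of changing the angle, at most |ψ - φ| h; the second compares
  -- the two diagonal matrices with the angle frozen, at most h - l.
  have hdec : Z = (v - u) * (m * (starRingEnd ℂ) u * z + d * u * (starRingEnd ℂ) z) +
      ((m - m' : ℝ) * z + (d * (u * u) - d') * (starRingEnd ℂ) z) := by
    rw [hZ]; push_cast
    linear_combination (m : ℂ) * z * huu
  have hzc : ‖(starRingEnd ℂ) z‖ = ‖z‖ := Complex.norm_conj z
  have b1 : ‖(m : ℂ) * (starRingEnd ℂ) u * z + d * u * (starRingEnd ℂ) z‖ ≤ h * ‖z‖ := by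
    refine (norm_add_le _ _).trans ?_
    simp only [norm_mul, Complex.norm_conj, hunorm, Complex.norm_real, Real.norm_eq_abs, mul_one]
    rw [← add_mul]
    gcongr
    rcases abs_cases m with ⟨h1, _⟩ | ⟨h1, _⟩ <;> rcases abs_cases d with ⟨h2, _⟩ | ⟨h2, _⟩ <;>
      rw [h1, h2] <;> simp only [hm, hd] <;> linarith
  -- |m - m'| + |d| + |d'| is the larger of max w - min c and max c - min w.
  have b2 : ‖((m - m' : ℝ) : ℂ) * z + (d * (u * u) - d') * (starRingEnd ℂ) z‖ ≤
      (h - l) * ‖z‖ := by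
    have : ‖(d : ℂ) * (u * u) - d'‖ ≤ |d| + |d'| := by
      refine (norm_sub_le _ _).trans ?_
      simp [hunorm]
    refine (norm_add_le _ _).trans ?_
    rw [norm_mul, norm_mul, Complex.norm_real, Real.norm_eq_abs, Complex.norm_conj, ← add_mul]
    gcongr
    refine (add_le_add_right this _).trans ?_
    rcases abs_cases (m - m') with ⟨h1, _⟩ | ⟨h1, _⟩ <;>
      rcases abs_cases d with ⟨h2, _⟩ | ⟨h2, _⟩ <;>
      rcases abs_cases d' with ⟨h3, _⟩ | ⟨h3, _⟩ <;>
      rw [h1, h2, h3] <;> simp only [hm, hd, hm', hd'] <;> linarith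
  have : ‖Z‖ ≤ M * ‖z‖ := by
    rw [hdec]
    refine (norm_add_le _ _).trans ?_
    rw [norm_mul]
    calc ‖v - u‖ * ‖(m : ℂ) * (starRingEnd ℂ) u * z + d * u * (starRingEnd ℂ) z‖ +
        ‖((m - m' : ℝ) : ℂ) * z + (d * (u * u) - d') * (starRingEnd ℂ) z‖
        ≤ |ψ - φ| * (h * ‖z‖) + (h - l) * ‖z‖ := by
          gcongr
          exact norm_cos_sin_sub_le φ ψ
      _ = (h - l + |ψ - φ| * h) * ‖z‖ := by ring
      _ ≤ M * ‖z‖ := by gcongr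
  gcongr

/-- A real matrix acts separately on real and imaginary parts, so a bound on ℝ² carries over to ℂ².
-/
theorem norm_sq_add_norm_sq_le_of_real {α β α' β' M : ℝ}
    (h : ∀ X Y : ℝ, (α * X + β' * Y) ^ 2 + (α' * Y + β * X) ^ 2 ≤ M ^ 2 * (X ^ 2 + Y ^ 2))
    (x y : ℂ) :
    ‖α * x + β' * y‖ ^ 2 + ‖α' * y + β * x‖ ^ 2 ≤ M ^ 2 * (‖x‖ ^ 2 + ‖y‖ ^ 2) := by
  have h1 := h x.re y.re
  have h2 := h x.im y.im
  simp only [Complex.sq_norm, Complex.normSq_apply, Complex.add_re, Complex.add_im,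
    Complex.re_ofReal_mul, Complex.im_ofReal_mul]
  nlinarith

end TwoByTwo

/-! ### Exchange data and the distance between the two operators -/

section Exchange

variable {ι : Type*}

/-- Data for gradual exchanges in a weighted permutation `e q ↦ c q • e (π q)` with nonnegative
weights. The vectors `e q` and `e (τ q)` are rotated by the angle `θ q`; at the elements of `last`
the rotation has reached a right angle, and the two paths are exchanged. The new weights are
`W`, up to sign. The new operator is within `M` of the old one. -/
structure Exchange (π : Equiv.Perm ι) (c : ι → ℝ) (M : ℝ) where
  /-- the partner -/
  τ : ι → ι
  /-- the angle of rotation -/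
  θ : ι → ℝ
  /-- the places where paths are exchanged -/
  last : Set ι
  /-- the new weights -/
  W : ι → ℝ
  involutive : Function.Involutive τ
  θ_τ : ∀ q, θ (τ q) = -θ q
  τ_mem_last : ∀ q ∈ last, τ q ∈ last
  W_nonneg : ∀ q, 0 ≤ W q
  -- The three alternatives are an idle place, a rotation in progress, and a completed rotation. In
  -- the second one the cost is the bound of `rotation_diag_sub_diag_le`.
  step : ∀ q, (τ q = q ∧ q ∉ last ∧ θ (π q) = 0 ∧ |W q - c q| ≤ M) ∨
    (q ∉ last ∧ τ (π q) = π (τ q) ∧ ∃ l h : ℝ, 0 ≤ l ∧ W q ∈ Set.Icc l h ∧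
      W (τ q) ∈ Set.Icc l h ∧ c q ∈ Set.Icc l h ∧ c (τ q) ∈ Set.Icc l h ∧
      h - l + |θ (π q) - θ q| * h ≤ M) ∨
    (q ∈ last ∧ (θ q = Real.pi / 2 ∨ θ q = -(Real.pi / 2)) ∧ θ (π q) = 0 ∧
      |W q - c (τ q)| ≤ M)

namespace Exchange

variable {π : Equiv.Perm ι} {c : ι → ℝ} {M : ℝ} (X : Exchange π c M)

open Classical in
/-- The involution that exchanges partners on `X.last`. -/
def swapFun (q : ι) : ι := if q ∈ X.last then X.τ q else q

theorem swapFun_involutive : Function.Involutive X.swapFun := by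
  intro q
  by_cases hq : q ∈ X.last
  · simp [swapFun, hq, X.τ_mem_last q hq, X.involutive q]
  · simp [swapFun, hq]

/-- The involution that exchanges partners on `X.last`, as a permutation. -/
def swap : Equiv.Perm ι := X.swapFun_involutive.toPerm

theorem swap_of_mem {q : ι} (hq : q ∈ X.last) : X.swap q = X.τ q := by
  rw [swap, Function.Involutive.coe_toPerm, swapFun]; simp [hq]

theorem swap_of_notMem {q : ι} (hq : q ∉ X.last) : X.swap q = q := by
  rw [swap, Function.Involutive.coe_toPerm, swapFun]; simp [hq]

/-- The new permutation. -/
def perm : Equiv.Perm ι := X.swap.trans π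

theorem perm_of_mem {q : ι} (hq : q ∈ X.last) : X.perm q = π (X.τ q) := by
  simp [perm, X.swap_of_mem hq]

theorem perm_of_notMem {q : ι} (hq : q ∉ X.last) : X.perm q = π q := by
  simp [perm, X.swap_of_notMem hq]

open Classical in
/-- The new weights with their signs. -/
def weight (q : ι) : ℝ := if q ∈ X.last then Real.sin (X.θ q) * X.W q else X.W q

theorem τ_notMem_last {q : ι} (hq : q ∉ X.last) : X.τ q ∉ X.last := fun h =>
  hq (by simpa [X.involutive q] using X.τ_mem_last _ h)

theorem mem_last_cases {q : ι} (hq : q ∈ X.last) :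
    (X.θ q = Real.pi / 2 ∨ X.θ q = -(Real.pi / 2)) ∧ X.θ (π q) = 0 ∧ |X.W q - c (X.τ q)| ≤ M := by
  rcases X.step q with h | h | h
  · exact absurd hq h.2.1
  · exact absurd hq h.1
  · exact h.2

theorem abs_weight (q : ι) : |X.weight q| = X.W q := by
  unfold weight
  split_ifs with hq
  · rcases (X.mem_last_cases hq).1 with h | h <;> simp [h, abs_of_nonneg (X.W_nonneg q)]
  · exact abs_of_nonneg (X.W_nonneg q)

theorem θ_eq_zero_of_fixed {q : ι} (hq : X.τ q = q) : X.θ q = 0 := by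
  have := X.θ_τ q
  rw [hq] at this
  linarith

variable {E : Type*} [NormedAddCommGroup E] [InnerProductSpace ℂ E] [Fintype ι]
  (e : OrthonormalBasis ι ℂ E)

theorem orthonormal_rotated : Orthonormal ℂ
    (fun q => (Real.cos (X.θ q) : ℂ) • e q + (Real.sin (X.θ q) : ℂ) • e (X.τ q)) := by
  classical
  rw [orthonormal_iff_ite]
  intro q q'
  simp only [inner_add_left, inner_add_right, inner_smul_left, inner_smul_right, e.inner_eq_ite,
    Complex.conj_ofReal, X.involutive.injective.eq_iff]
  have hs : ((Real.cos (X.θ q) : ℂ) * Real.cos (X.θ q) + Real.sin (X.θ q) * Real.sin (X.θ q)) = 1 := by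
    norm_cast
    nlinarith [Real.sin_sq_add_cos_sq (X.θ q)]
  by_cases h1 : q = q'
  · subst h1
    by_cases h2 : X.τ q = q
    · have := X.θ_eq_zero_of_fixed h2
      simp [this]
    · have h3 : ¬ q = X.τ q := fun h => h2 h.symm
      simp only [h2, h3, if_true, if_false, mul_one, mul_zero, add_zero, zero_add]
      linear_combination hs
  · by_cases h2 : X.τ q = q'
    · subst h2
      simp only [X.involutive q, h1, X.θ_τ, Real.cos_neg, Real.sin_neg, if_true, if_false,
        Complex.ofReal_neg, mul_one, mul_zero, add_zero, zero_add]
      ring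
    · have h3 : ¬ q = X.τ q' := fun h => h2 (by rw [h, X.involutive])
      simp [h1, h2, h3]

/-- The rotated basis. -/
def basis : OrthonormalBasis ι ℂ E :=
  (exists_orthonormalBasis e (X.orthonormal_rotated e)).choose

theorem basis_apply (q : ι) : X.basis e q =
    (Real.cos (X.θ q) : ℂ) • e q + (Real.sin (X.θ q) : ℂ) • e (X.τ q) :=
  (exists_orthonormalBasis e (X.orthonormal_rotated e)).choose_spec q

theorem isRealBasis : IsRealBasis e (X.basis e) := by
  classical
  intro x q
  rw [X.basis_apply]
  simp only [map_add, map_smul, e.repr_self, WithLp.ofLp_add, WithLp.ofLp_smul, Pi.add_apply,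
    Pi.smul_apply, smul_eq_mul, PiLp.single_apply, Complex.add_im]
  rw [im_mul_eq_zero (Complex.ofReal_im _) (by split_ifs <;> simp),
    im_mul_eq_zero (Complex.ofReal_im _) (by split_ifs <;> simp), add_zero]

theorem basis_of_θ_eq_zero {q : ι} (hq : X.θ q = 0) : X.basis e q = e q := by
  simp [X.basis_apply, hq]

theorem eq_basis (q : ι) : e q =
    (Real.cos (X.θ q) : ℂ) • X.basis e q - (Real.sin (X.θ q) : ℂ) • X.basis e (X.τ q) := by
  have hs : ((Real.cos (X.θ q) : ℂ) * Real.cos (X.θ q) + Real.sin (X.θ q) * Real.sin (X.θ q)) = 1 := by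
    norm_cast
    nlinarith [Real.sin_sq_add_cos_sq (X.θ q)]
  rw [X.basis_apply, X.basis_apply, X.involutive, X.θ_τ, Real.cos_neg, Real.sin_neg]
  simp only [smul_add, smul_smul, Complex.ofReal_neg]
  generalize (Real.cos (X.θ q) : ℂ) = s at hs ⊢
  generalize (Real.sin (X.θ q) : ℂ) = t at hs ⊢
  match_scalars
  · linear_combination -hs
  · ring

/-- Vectors with the same eigenvalue can be rotated. -/
theorem isWeightedPerm_basis {A : E →L[ℂ] E} {μ : ι → ℂ}
    (hA : IsWeightedPerm e (Equiv.refl ι) μ A) (hμ : ∀ q, μ (X.τ q) = μ q) :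
    IsWeightedPerm (X.basis e) (Equiv.refl ι) μ A := by
  intro q
  have h1 := hA q
  have h2 := hA (X.τ q)
  simp only [Equiv.refl_apply] at h1 h2
  simp only [Equiv.refl_apply, X.basis_apply, map_add, map_smul, h1, h2, hμ, smul_add, smul_smul,
    mul_comm]

open Classical in
/-- The diagonal coefficients of the difference of the two operators. -/
def diffDiag (q : ι) : ℝ := if q ∈ X.last then X.W (X.τ q) - c q else
  Real.cos (X.θ q) * X.W q * Real.cos (X.θ (π q)) +
    Real.sin (X.θ q) * X.W (X.τ q) * Real.sin (X.θ (π q)) - c q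

open Classical in
/-- The off-diagonal coefficients of the difference of the two operators. -/
def diffOff (q : ι) : ℝ := if q ∈ X.last then 0 else
  Real.cos (X.θ q) * X.W q * Real.sin (X.θ (π q)) -
    Real.sin (X.θ q) * X.W (X.τ q) * Real.cos (X.θ (π q))

/-- The difference maps the span of `e q` and `e (τ q)` into that of `e (π q)` and `e (π (τ q))`, so
it splits into blocks of size at most two. On `X.last` the rotated vector is `± e (τ q)`; the sign
cancels against the one in `weight`, and no off-diagonal part remains. -/
theorem diff_apply {S S' : E →L[ℂ] E} (hS : IsWeightedPerm e π (fun q => (c q : ℂ)) S)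
    (hS' : IsWeightedPerm (X.basis e) X.perm (fun q => (X.weight q : ℂ)) S') (q : ι) :
    (S' - S) (e q) = (X.diffDiag q : ℂ) • e (π q) + (X.diffOff q : ℂ) • e (π (X.τ q)) := by
  have key : S' (e q) = (Real.cos (X.θ q) : ℂ) • (X.weight q : ℂ) • X.basis e (X.perm q) -
      (Real.sin (X.θ q) : ℂ) • (X.weight (X.τ q) : ℂ) • X.basis e (X.perm (X.τ q)) := by
    conv_lhs => rw [X.eq_basis e q]
    rw [map_sub, map_smul, map_smul, hS' q, hS' (X.τ q)]
  rw [sub_apply, hS q, key]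
  by_cases hq : q ∈ X.last
  · obtain ⟨h1, h2, -⟩ := X.mem_last_cases hq
    have hτ := X.τ_mem_last q hq
    have hcos : Real.cos (X.θ q) = 0 := by
      rcases h1 with h | h <;> simp [h]
    have hsin : Real.sin (X.θ q) * Real.sin (X.θ q) = 1 := by
      rcases h1 with h | h <;> simp [h]
    rw [X.perm_of_mem hτ, X.involutive, X.basis_of_θ_eq_zero e h2]
    simp only [hcos, weight, hτ, diffDiag, diffOff, hq, if_true, X.θ_τ, Real.sin_neg, smul_smul]
    have hsin' : (Real.sin (X.θ q) : ℂ) * Real.sin (X.θ q) = 1 := by exact_mod_cast hsin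
    push_cast
    rw [← Complex.ofReal_sin]
    generalize (Real.sin (X.θ q) : ℂ) = t at hsin' ⊢
    match_scalars
    · ring
    · linear_combination (X.W (X.τ q) : ℂ) * hsin'
    · simp
  · have hτ := X.τ_notMem_last hq
    rw [X.perm_of_notMem hq, X.perm_of_notMem hτ]
    simp only [weight, hτ, diffDiag, diffOff, hq, if_false]
    have gen : X.τ (π q) = π (X.τ q) →
        (Real.cos (X.θ q) : ℂ) • (X.W q : ℂ) • X.basis e (π q) -
          (Real.sin (X.θ q) : ℂ) • (X.W (X.τ q) : ℂ) • X.basis e (π (X.τ q)) -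
            (c q : ℂ) • e (π q) =
        ((Real.cos (X.θ q) * X.W q * Real.cos (X.θ (π q)) +
            Real.sin (X.θ q) * X.W (X.τ q) * Real.sin (X.θ (π q)) - c q : ℝ) : ℂ) • e (π q) +
          ((Real.cos (X.θ q) * X.W q * Real.sin (X.θ (π q)) -
            Real.sin (X.θ q) * X.W (X.τ q) * Real.cos (X.θ (π q)) : ℝ) : ℂ) • e (π (X.τ q)) := by
      intro hcomm
      rw [X.basis_apply, X.basis_apply, ← hcomm, X.involutive, X.θ_τ, Real.cos_neg, Real.sin_neg]
      push_cast
      module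
    rcases X.step q with ⟨h1, -, h3, -⟩ | ⟨-, h2, -⟩ | ⟨h1, -⟩
    · have h4 := X.θ_eq_zero_of_fixed h1
      simp only [h1, h3, h4, X.basis_of_θ_eq_zero e h3]
      simp only [Real.cos_zero, Real.sin_zero]
      push_cast
      module
    · exact gen h2
    · exact absurd h1 hq

omit [Fintype ι] in
theorem diff_bound (hM : 0 ≤ M) (q : ι) (x y : ℂ) :
    ‖X.diffDiag q * x + X.diffOff (X.τ q) * y‖ ^ 2 +
      ‖X.diffDiag (X.τ q) * y + X.diffOff q * x‖ ^ 2 ≤ M ^ 2 * (‖x‖ ^ 2 + ‖y‖ ^ 2) := by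
  refine norm_sq_add_norm_sq_le_of_real (fun a b => ?_) x y
  have diag : ∀ s t : ℝ, |s| ≤ M → |t| ≤ M → (s * a) ^ 2 + (t * b) ^ 2 ≤ M ^ 2 * (a ^ 2 + b ^ 2) := by
    intro s t hs ht
    rw [mul_pow, mul_pow, mul_add]
    gcongr ?_ * _ + ?_ * _
    · exact sq_le_sq.mpr (by rwa [abs_of_nonneg hM])
    · exact sq_le_sq.mpr (by rwa [abs_of_nonneg hM])
  rcases X.step q with ⟨h1, h2, h3, h5⟩ | ⟨hq, h2, l, h, hl, hW, hW', hc, hc', hb⟩ | ⟨h1, h2, h3, h4⟩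
  · have h4 := X.θ_eq_zero_of_fixed h1
    simp only [h1, diffDiag, diffOff, h2, if_false, h3, h4, Real.cos_zero, Real.sin_zero]
    simpa using diag _ _ h5 h5
  · have hτ := X.τ_notMem_last hq
    simp only [diffDiag, diffOff, hq, hτ, if_false, X.involutive q, ← h2, X.θ_τ, Real.cos_neg,
      Real.sin_neg]
    refine (le_of_eq ?_).trans (rotation_diag_sub_diag_le hl hW hW' hc hc' hb a b)
    ring
  · have h6 := (X.mem_last_cases (X.τ_mem_last q h1)).2.2
    rw [X.involutive] at h6
    simp only [diffDiag, diffOff, h1, X.τ_mem_last q h1, if_true, X.involutive q]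
    simpa using diag _ _ h6 h4

theorem norm_sub_le (hM : 0 ≤ M) {S S' : E →L[ℂ] E}
    (hS : IsWeightedPerm e π (fun q => (c q : ℂ)) S)
    (hS' : IsWeightedPerm (X.basis e) X.perm (fun q => (X.weight q : ℂ)) S') :
    ‖S' - S‖ ≤ M := by
  classical
  refine ContinuousLinearMap.opNorm_le_bound _ hM fun x => ?_
  refine le_of_sq_le_sq ?_ (by positivity)
  have hrepr : ∀ q, e.repr ((S' - S) x) (π q) =
      X.diffDiag q * e.repr x q + X.diffOff (X.τ q) * e.repr x (X.τ q) := by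
    intro q
    conv_lhs => rw [← e.sum_repr x]
    simp only [map_sum, map_smul, X.diff_apply e hS hS', map_add, e.repr_self, smul_add,
      WithLp.ofLp_sum, Finset.sum_apply, WithLp.ofLp_add, WithLp.ofLp_smul, Pi.add_apply,
      Pi.smul_apply, smul_eq_mul, PiLp.single_apply, Finset.sum_add_distrib, π.injective.eq_iff]
    congr 1
    · simp [mul_comm]
    · have : ∀ q', (q = X.τ q') = (q' = X.τ q) := fun q' => by
        rw [eq_iff_iff]
        constructor <;> rintro rfl <;> rw [X.involutive]
      simp [this, mul_comm]
  set f : ι → ℝ := fun q =>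
    ‖X.diffDiag q * e.repr x q + X.diffOff (X.τ q) * e.repr x (X.τ q)‖ ^ 2 with hf
  have hsum : ‖(S' - S) x‖ ^ 2 = ∑ q, f q := by
    rw [← e.repr.norm_map, EuclideanSpace.norm_sq_eq, ← Equiv.sum_comp π]
    exact Finset.sum_congr rfl fun q _ => by rw [hrepr]
  have hx : ‖x‖ ^ 2 = ∑ q, ‖e.repr x q‖ ^ 2 := by
    rw [← e.repr.norm_map, EuclideanSpace.norm_sq_eq]
  have hτsum : ∀ g : ι → ℝ, ∑ q, g (X.τ q) = ∑ q, g q := fun g =>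
    Equiv.sum_comp X.involutive.toPerm g
  -- Summing over all q counts every pair twice, and a fixed point of `τ` is counted twice as well,
  -- so no representatives of the pairs have to be chosen.
  have h2 : ∑ q, (f q + f (X.τ q)) ≤
      ∑ q, M ^ 2 * (‖e.repr x q‖ ^ 2 + ‖e.repr x (X.τ q)‖ ^ 2) := by
    refine Finset.sum_le_sum fun q _ => ?_
    have := X.diff_bound hM q (e.repr x q) (e.repr x (X.τ q))
    simpa only [hf, X.involutive q] using this
  rw [Finset.sum_add_distrib, hτsum f, ← Finset.mul_sum, Finset.sum_add_distrib,
    hτsum (fun q => ‖e.repr x q‖ ^ 2), ← hx, ← hsum] at h2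
  rw [mul_pow]
  linarith

end Exchange

end Exchange

end GradualExchange

end

noncomputable section

namespace GradualExchange

/-! ### Levels of a walk with hysteresis, and matching of their jumps -/

section Hysteresis

/-- The integer `k` such that `k * L` is the last multiple of `L` visited by the walk `v`. -/
def hyst (v : ℕ → ℤ) (L : ℤ) : ℕ → ℤ
  | 0 => 0
  | i + 1 => if v (i + 1) = (hyst v L i + 1) * L then hyst v L i + 1
      else if v (i + 1) = (hyst v L i - 1) * L then hyst v L i - 1 else hyst v L i

/-- A walk on the integers with steps of size at most one that starts near `0`, is nonnegative and
is finally `0`. -/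
structure IsWalk (v : ℕ → ℤ) (n : ℕ) : Prop where
  nonneg : ∀ i, 0 ≤ v i
  zero_le_one : v 0 ≤ 1
  step : ∀ i, |v (i + 1) - v i| ≤ 1
  eq_zero : ∀ i, n ≤ i + 1 → v i = 0

variable {v : ℕ → ℤ} {n N : ℕ}

theorem IsWalk.abs_sub_le (hv : IsWalk v n) (i s : ℕ) : |v (i + s) - v i| ≤ s := by
  induction s with
  | zero => simp
  | succ s ih =>
    have := hv.step (i + s)
    rw [← add_assoc]
    push_cast
    rw [abs_le] at *
    constructor <;> linarith [this.1, this.2, ih.1, ih.2]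

theorem hyst_succ_cases (v : ℕ → ℤ) (L : ℤ) (i : ℕ) :
    hyst v L (i + 1) = hyst v L i ∨
    (hyst v L (i + 1) = hyst v L i + 1 ∧ v (i + 1) = (hyst v L i + 1) * L) ∨
    (hyst v L (i + 1) = hyst v L i - 1 ∧ v (i + 1) = (hyst v L i - 1) * L) := by
  rw [hyst]
  split_ifs with h1 h2
  · exact Or.inr (Or.inl ⟨rfl, h1⟩)
  · exact Or.inr (Or.inr ⟨rfl, h2⟩)
  · exact Or.inl rfl

/-- Steps of size at most one cannot skip a multiple of N + 1, and hitting a neighbouring multiple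
updates the level. -/
theorem IsWalk.abs_sub_hyst_lt (hv : IsWalk v n) (hN : 1 ≤ N) (i : ℕ) :
    |v i - hyst v (N + 1) i * (N + 1)| < N + 1 := by
  have hN' : (1 : ℤ) ≤ N := by exact_mod_cast hN
  induction i with
  | zero =>
    have h1 := hv.nonneg 0
    have h2 := hv.zero_le_one
    simp only [hyst]
    rw [abs_lt]; constructor <;> linarith
  | succ i ih =>
    have hs := hv.step i
    rw [abs_lt] at ih
    rw [abs_le] at hs
    rcases hyst_succ_cases v (N + 1) i with h | ⟨h, h'⟩ | ⟨h, h'⟩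
    · have h1 : v (i + 1) ≠ (hyst v (N + 1) i + 1) * (N + 1) := by
        intro h'
        rw [hyst, if_pos h'] at h
        linarith
      have h2 : v (i + 1) ≠ (hyst v (N + 1) i - 1) * (N + 1) := by
        intro h'
        rw [hyst, if_neg h1, if_pos h'] at h
        linarith
      rw [h, abs_lt]
      rw [add_mul, one_mul] at h1
      rw [sub_mul, one_mul] at h2
      generalize hyst v (N + 1) i * (N + 1 : ℤ) = z at *
      omega
    · rw [h, h', sub_self, abs_zero]; linarith
    · rw [h, h', sub_self, abs_zero]; linarith

theorem IsWalk.hyst_nonneg (hv : IsWalk v n) (hN : 1 ≤ N) (i : ℕ) : 0 ≤ hyst v (N + 1) i := by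
  have h1 := hv.abs_sub_hyst_lt hN i
  have h2 := hv.nonneg i
  rw [abs_lt] at h1
  by_contra h3
  nlinarith

theorem IsWalk.hyst_eq_zero (hv : IsWalk v n) (hN : 1 ≤ N) {i : ℕ} (hi : n ≤ i + 1) :
    hyst v (N + 1) i = 0 := by
  have h1 := hv.abs_sub_hyst_lt hN i
  rw [hv.eq_zero i hi, abs_lt] at h1
  have h2 := hv.hyst_nonneg hN i
  by_contra h3
  have : 1 ≤ hyst v (N + 1) i := by omega
  nlinarith

/-- The times at which the level changes. -/
def IsJump (v : ℕ → ℤ) (N q : ℕ) : Prop := q ≠ 0 ∧ hyst v (N + 1) q ≠ hyst v (N + 1) (q - 1)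

theorem IsJump.cases {q : ℕ} (hq : IsJump v N q) :
    v q = hyst v (N + 1) q * (N + 1) ∧ (hyst v (N + 1) q = hyst v (N + 1) (q - 1) + 1 ∨
      hyst v (N + 1) q = hyst v (N + 1) (q - 1) - 1) := by
  obtain ⟨h0, h1⟩ := hq
  obtain ⟨p, rfl⟩ := Nat.exists_eq_succ_of_ne_zero h0
  simp only [Nat.succ_eq_add_one, Nat.add_sub_cancel] at *
  rcases hyst_succ_cases v (N + 1) p with h | ⟨h, h'⟩ | ⟨h, h'⟩
  · exact absurd h h1
  · exact ⟨by rw [h', h], Or.inl h⟩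
  · exact ⟨by rw [h', h], Or.inr h⟩

theorem IsWalk.jump_lt (hv : IsWalk v n) (hN : 1 ≤ N) {q : ℕ} (hq : IsJump v N q) : q < n := by
  by_contra h
  have h1 := hv.hyst_eq_zero hN (i := q) (by omega)
  have h2 := hv.hyst_eq_zero hN (i := q - 1) (by omega)
  exact hq.2 (by rw [h1, h2])

/-- At the jump the walk is at the new multiple, N + 1 away from the old one. At most N steps
earlier it cannot have been at the old multiple, so the level was not updated then. The walk starts
at 0 or 1, which leaves room for N steps before the jump. -/
theorem IsWalk.before_jump (hv : IsWalk v n) (hN : 1 ≤ N) {q : ℕ} (hq : IsJump v N q) (s : ℕ)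
    (hs : 1 ≤ s) (hsN : s ≤ N) : s ≤ q ∧ hyst v (N + 1) (q - s) = hyst v (N + 1) (q - 1) := by
  have hN' : (1 : ℤ) ≤ N := by exact_mod_cast hN
  obtain ⟨hvq, hK⟩ := hq.cases
  induction s, hs using Nat.le_induction with
  | base => exact ⟨Nat.one_le_iff_ne_zero.mpr hq.1, rfl⟩
  | succ s hs ih =>
    obtain ⟨h1, h2⟩ := ih (by omega)
    have hd := hv.abs_sub_le (q - s) s
    rw [Nat.sub_add_cancel h1, hvq, abs_le] at hd
    have hsN' : (s : ℤ) + 1 ≤ N := by exact_mod_cast hsN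
    have hne : q - s ≠ 0 := by
      intro h0
      rw [h0] at h2 hd
      have h3 := hv.zero_le_one
      have h4 := hv.nonneg 0
      have h5 : hyst v (N + 1) 0 = 0 := rfl
      have h6 := hv.hyst_nonneg hN q
      rcases hK with hK | hK
      · rw [← h2, h5] at hK
        rw [hK] at hd
        linarith [hd.2]
      · rw [← h2, h5] at hK
        linarith
    refine ⟨by omega, ?_⟩
    obtain ⟨p, hp⟩ := Nat.exists_eq_succ_of_ne_zero hne
    have hp' : q - (s + 1) = p := by omega
    rw [hp']
    rw [hp] at h2 hd
    simp only [Nat.succ_eq_add_one] at h2 hd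
    rcases hyst_succ_cases v (N + 1) p with h | ⟨h, h'⟩ | ⟨h, h'⟩
    · rw [← h2, h]
    · exfalso
      rw [h', ← h, h2] at hd
      rcases hK with hK | hK <;> rw [hK] at hd <;> linarith [hd.1, hd.2]
    · exfalso
      rw [h', ← h, h2] at hd
      rcases hK with hK | hK <;> rw [hK] at hd <;> linarith [hd.1, hd.2]

theorem IsWalk.le_jump (hv : IsWalk v n) (hN : 1 ≤ N) {q : ℕ} (hq : IsJump v N q) : N ≤ q :=
  (hv.before_jump hN hq N hN le_rfl).1

/-- Ensures that the old weights lie between the two levels to be exchanged while the rotation is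
going on, for up-jumps and down-jumps alike. -/
theorem IsWalk.level_before_jump (hv : IsWalk v n) (hN : 1 ≤ N) {q : ℕ} (hq : IsJump v N q) (s : ℕ)
    (hs : 1 ≤ s) (hsN : s ≤ N) :
    min (hyst v (N + 1) (q - 1)) (hyst v (N + 1) q) * (N + 1) ≤ v (q - s) ∧
      v (q - s) < (min (hyst v (N + 1) (q - 1)) (hyst v (N + 1) q) + 1) * (N + 1) := by
  obtain ⟨hvq, hK⟩ := hq.cases
  obtain ⟨h1, h2⟩ := hv.before_jump hN hq s hs hsN
  have hd := hv.abs_sub_le (q - s) s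
  have h3 := hv.abs_sub_hyst_lt hN (q - s)
  have hsN' : (s : ℤ) ≤ N := by exact_mod_cast hsN
  rw [Nat.sub_add_cancel h1, hvq, abs_le] at hd
  rw [h2, abs_lt] at h3
  rcases hK with hK | hK <;> rw [hK] at hd ⊢
  · rw [min_eq_left (by linarith)]
    constructor <;> linarith [hd.1, hd.2, h3.1, h3.2]
  · rw [min_eq_right (by linarith)]
    constructor <;> linarith [hd.1, hd.2, h3.1, h3.2]

/-- Hence rotations that belong to different jumps do not overlap. -/
theorem IsWalk.jump_spacing (hv : IsWalk v n) (hN : 1 ≤ N) {q q' : ℕ} (hq : IsJump v N q)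
    (hq' : IsJump v N q') (hlt : q < q') : q + N < q' := by
  by_contra h
  obtain ⟨hvq, -⟩ := hq.cases
  obtain ⟨hvq', hK⟩ := hq'.cases
  have h2 := (hv.before_jump hN hq' (q' - q) (by omega) (by omega)).2
  rw [show q' - (q' - q) = q by omega] at h2
  have hd := hv.abs_sub_le q (q' - q)
  rw [show q + (q' - q) = q' by omega, hvq, hvq', h2, abs_le] at hd
  have : ((q' - q : ℕ) : ℤ) ≤ N := by exact_mod_cast (by omega : q' - q ≤ N)
  rcases hK with hK | hK <;> rw [hK] at hd <;> linarith [hd.1, hd.2]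

/-- The up-jump `q` and the down-jump `q'` are matched like parentheses. -/
def IsMatch (v : ℕ → ℤ) (N q q' : ℕ) : Prop :=
  q ≠ 0 ∧ q < q' ∧ hyst v (N + 1) (q - 1) < hyst v (N + 1) q ∧
    hyst v (N + 1) q' = hyst v (N + 1) (q - 1) ∧
    hyst v (N + 1) (q' - 1) = hyst v (N + 1) q ∧
    ∀ i, q ≤ i → i < q' → hyst v (N + 1) q ≤ hyst v (N + 1) i

theorem IsMatch.unique_right {q q' q'' : ℕ} (h : IsMatch v N q q') (h' : IsMatch v N q q'') :
    q' = q'' := by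
  obtain ⟨-, h1, h2, h3, -, h4⟩ := h
  obtain ⟨-, h1', -, h3', -, h4'⟩ := h'
  rcases lt_trichotomy q' q'' with hlt | heq | hlt
  · have := h4' q' h1.le hlt; omega
  · exact heq
  · have := h4 q'' h1'.le hlt; omega

theorem IsMatch.unique_left {q q' q'' : ℕ} (h : IsMatch v N q q'') (h' : IsMatch v N q' q'') :
    q = q' := by
  obtain ⟨h0, h1, h2, h3, -, h4⟩ := h
  obtain ⟨h0', h1', h2', h3', -, h4'⟩ := h'
  rcases lt_trichotomy q q' with hlt | heq | hlt
  · have := h4 (q' - 1) (by omega) (by omega); omega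
  · exact heq
  · have := h4' (q - 1) (by omega) (by omega); omega

/-- The match is the first return to the lower level, which exists because the level is finally 0.
-/
theorem IsWalk.exists_match_right (hv : IsWalk v n) (hN : 1 ≤ N) {q : ℕ} (hq : q ≠ 0)
    (h : hyst v (N + 1) (q - 1) < hyst v (N + 1) q) : ∃ q', IsMatch v N q q' := by
  classical
  have hex : ∃ q', q < q' ∧ hyst v (N + 1) q' ≤ hyst v (N + 1) (q - 1) :=
    ⟨q + n + 1, by omega, by
      rw [hv.hyst_eq_zero hN (i := q + n + 1) (by omega)]; exact hv.hyst_nonneg hN _⟩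
  have hjq : hyst v (N + 1) q = hyst v (N + 1) (q - 1) + 1 := by
    have := (IsJump.cases ⟨hq, h.ne'⟩).2
    omega
  obtain ⟨h1, h2⟩ := Nat.find_spec hex
  have hmin : ∀ i, q ≤ i → i < Nat.find hex → hyst v (N + 1) q ≤ hyst v (N + 1) i := by
    intro i hi hi'
    rcases hi.eq_or_lt with rfl | hi
    · exact le_rfl
    · have := Nat.find_min hex hi'
      simp only [hi, true_and] at this
      omega
  have h3 := hmin (Nat.find hex - 1) (by omega) (by omega)
  have h4 := (IsJump.cases (v := v) (N := N) (q := Nat.find hex) ⟨by omega, by omega⟩).2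
  exact ⟨Nat.find hex, hq, h1, h, by omega, by omega, hmin⟩

/-- The match comes right after the last earlier time at or below the lower level, which exists
because the level starts at 0. -/
theorem IsWalk.exists_match_left (hv : IsWalk v n) (hN : 1 ≤ N) {q' : ℕ} (hq : q' ≠ 0)
    (h : hyst v (N + 1) q' < hyst v (N + 1) (q' - 1)) : ∃ q, IsMatch v N q q' := by
  classical
  have hjq : hyst v (N + 1) (q' - 1) = hyst v (N + 1) q' + 1 := by
    have := (IsJump.cases ⟨hq, h.ne⟩).2
    omega
  set P : ℕ → Prop := fun i => hyst v (N + 1) i ≤ hyst v (N + 1) q' with hP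
  have h0 : P 0 := hv.hyst_nonneg hN q'
  set p := Nat.findGreatest P (q' - 1) with hp
  have hpP : P p := Nat.findGreatest_spec (Nat.zero_le _) h0
  have hple : p ≤ q' - 1 := Nat.findGreatest_le _
  have hpne : p ≠ q' - 1 := by
    intro heq
    rw [heq] at hpP
    simp only [hP] at hpP
    omega
  have hgt : ∀ i, p < i → i < q' → hyst v (N + 1) q' < hyst v (N + 1) i := by
    intro i h1 h2
    have := Nat.findGreatest_is_greatest h1 (by omega : i ≤ q' - 1)
    simp only [hP] at this
    omega
  have h1 := hgt (p + 1) (by omega) (by omega)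
  simp only [hP] at hpP
  have h2 := (IsJump.cases (v := v) (N := N) (q := p + 1) ⟨by omega, by
    rw [Nat.add_sub_cancel]; omega⟩).2
  rw [Nat.add_sub_cancel] at h2
  refine ⟨p + 1, by omega, by omega, ?_, ?_, ?_, fun i hi hi' => ?_⟩
  · rw [Nat.add_sub_cancel]; omega
  · rw [Nat.add_sub_cancel]; omega
  · omega
  · have := hgt i (by omega) hi'
    omega

theorem IsWalk.exists_partner (hv : IsWalk v n) (hN : 1 ≤ N) :
    ∃ P : ℕ → ℕ, ∀ q, IsJump v N q → IsJump v N (P q) ∧ P (P q) = q ∧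
      hyst v (N + 1) (P q) = hyst v (N + 1) (q - 1) ∧
      hyst v (N + 1) (P q - 1) = hyst v (N + 1) q := by
  classical
  have hex : ∀ q, ∃ q', IsJump v N q → IsMatch v N q q' ∨ IsMatch v N q' q := by
    intro q
    by_cases hq : IsJump v N q
    · rcases lt_or_gt_of_ne hq.2 with h | h
      · obtain ⟨q', h'⟩ := hv.exists_match_left hN hq.1 h
        exact ⟨q', fun _ => Or.inr h'⟩
      · obtain ⟨q', h'⟩ := hv.exists_match_right hN hq.1 h
        exact ⟨q', fun _ => Or.inl h'⟩
    · exact ⟨0, fun h => absurd h hq⟩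
  choose P hP using hex
  refine ⟨P, fun q hq => ?_⟩
  rcases hP q hq with h | h
  · have hj : IsJump v N (P q) := ⟨by have := h.2.1; omega, by
      obtain ⟨-, -, h1, h2, h3, -⟩ := h; omega⟩
    refine ⟨hj, ?_, h.2.2.2.1, h.2.2.2.2.1⟩
    rcases hP _ hj with h' | h'
    · exfalso
      obtain ⟨-, -, h1, h2, h3, -⟩ := h
      obtain ⟨-, -, h1', -⟩ := h'
      omega
    · exact h'.unique_left h
  · have hj : IsJump v N (P q) := ⟨h.1, by
      obtain ⟨-, -, h1, h2, h3, -⟩ := h; omega⟩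
    refine ⟨hj, ?_, h.2.2.2.2.1.symm, h.2.2.2.1.symm⟩
    rcases hP _ hj with h' | h'
    · exact h'.unique_right h
    · exfalso
      obtain ⟨-, -, h1, h2, h3, -⟩ := h
      obtain ⟨-, -, h1', h2', h3', -⟩ := h'
      omega

end Hysteresis

end GradualExchange

end

noncomputable section

namespace GradualExchange

/-! ### Exchanges inside a single chain -/

section Chain

variable {v : ℕ → ℤ} {n N : ℕ}

/-- Before the jump at `q`, the rotation takes place at `q - N, …, q`. -/
def InBlock (v : ℕ → ℤ) (N x q : ℕ) : Prop := IsJump v N q ∧ x ≤ q ∧ q ≤ x + N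

theorem IsWalk.inBlock_unique (hv : IsWalk v n) (hN : 1 ≤ N) {x q q' : ℕ}
    (h : InBlock v N x q) (h' : InBlock v N x q') : q = q' := by
  obtain ⟨h1, h2, h3⟩ := h
  obtain ⟨h1', h2', h3'⟩ := h'
  rcases lt_trichotomy q q' with hlt | heq | hlt
  · have := hv.jump_spacing hN h1 h1' hlt; omega
  · exact heq
  · have := hv.jump_spacing hN h1' h1 hlt; omega

/-- The exchange data of a single chain: every up-jump of the level is exchanged with the
matching down-jump. -/
theorem IsWalk.exists_exchange (hv : IsWalk v n) (hN : 1 ≤ N) {c : ℕ → ℝ} {ℓ : ℤ → ℝ} {M : ℝ}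
    (hℓ : ∀ k, 0 ≤ ℓ k)
    (hnear : ∀ i, |ℓ (hyst v (N + 1) i) - c i| ≤ M)
    (hblock : ∀ q, IsJump v N q → ∀ s, 1 ≤ s → s ≤ N →
      c (q - s) ∈ Set.Icc (ℓ (min (hyst v (N + 1) (q - 1)) (hyst v (N + 1) q)))
        (ℓ (min (hyst v (N + 1) (q - 1)) (hyst v (N + 1) q) + 1)))
    (hcost : ∀ q, IsJump v N q →
      ℓ (min (hyst v (N + 1) (q - 1)) (hyst v (N + 1) q)) ≤
        ℓ (min (hyst v (N + 1) (q - 1)) (hyst v (N + 1) q) + 1) ∧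
      ℓ (min (hyst v (N + 1) (q - 1)) (hyst v (N + 1) q) + 1) -
        ℓ (min (hyst v (N + 1) (q - 1)) (hyst v (N + 1) q)) +
        Real.pi / (2 * N) * ℓ (min (hyst v (N + 1) (q - 1)) (hyst v (N + 1) q) + 1) ≤ M) :
    ∃ X : Exchange (finRotate n) (fun i : Fin n => c i) M, ∀ q, X.W (X.perm q) = X.W q := by
  classical
  obtain ⟨P, hP⟩ := hv.exists_partner hN
  set K : ℕ → ℤ := hyst v (N + 1) with hK
  have hNR : (0 : ℝ) < N := by exact_mod_cast hN
  -- the jump at the end of the block of `x`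
  have hnx : ∃ nx : ℕ → ℕ, ∀ x q, InBlock v N x q → nx x = q := by
    have : ∀ x, ∃ y, ∀ q, InBlock v N x q → y = q := fun x => by
      by_cases h : ∃ q, InBlock v N x q
      · obtain ⟨q, hq⟩ := h
        exact ⟨q, fun q' hq' => hv.inBlock_unique hN hq hq'⟩
      · exact ⟨0, fun q hq => absurd ⟨q, hq⟩ h⟩
    choose nx hnx using this
    exact ⟨nx, hnx⟩
  obtain ⟨nx, hnx⟩ := hnx
  set B : ℕ → Prop := fun x => ∃ q, InBlock v N x q with hB
  set τ : ℕ → ℕ := fun x => if B x then P (nx x) - (nx x - x) else x with hτ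
  -- The angle is 0 at the first place of the block and ±π/2 at the jump. Matched jumps have
  -- opposite directions, hence opposite signs.
  set θ : ℕ → ℝ := fun x => if B x then
    ((K (nx x) - K (nx x - 1) : ℤ) : ℝ) * ((N - (nx x - x : ℕ)) * (Real.pi / (2 * N))) else 0
    with hθ
  set W : ℕ → ℝ := fun x => if IsJump v N x then ℓ (K (P x)) else ℓ (K x) with hW
  have hin : ∀ q s, IsJump v N q → s ≤ N → InBlock v N (q - s) q := fun q s hq hs => by
    have := hv.le_jump hN hq
    exact ⟨hq, by omega, by omega⟩
  have hτ1 : ∀ q s, IsJump v N q → s ≤ N → τ (q - s) = P q - s := fun q s hq hs => by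
    have h := hin q s hq hs
    have := hv.le_jump hN hq
    simp only [hτ]
    rw [if_pos ⟨q, h⟩, hnx _ _ h]
    congr 1; omega
  have hθ1 : ∀ q s, IsJump v N q → s ≤ N → θ (q - s) =
      ((K q - K (q - 1) : ℤ) : ℝ) * ((N - s) * (Real.pi / (2 * N))) := fun q s hq hs => by
    have h := hin q s hq hs
    have := hv.le_jump hN hq
    simp only [hθ]
    rw [if_pos ⟨q, h⟩, hnx _ _ h]
    have h2 : q - (q - s) = s := by omega
    rw [h2]
  have hτ0 : ∀ x, ¬ B x → τ x = x := fun x hx => by simp only [hτ]; rw [if_neg hx]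
  have hθ0 : ∀ x, ¬ B x → θ x = 0 := fun x hx => by simp only [hθ]; rw [if_neg hx]
  have hcases : ∀ x, ¬ B x ∨ ∃ q s, IsJump v N q ∧ s ≤ N ∧ x = q - s ∧ s ≤ q := fun x => by
    by_cases h : B x
    · obtain ⟨q, h1, h2, h3⟩ := h
      exact Or.inr ⟨q, q - x, h1, by omega, by omega, by omega⟩
    · exact Or.inl h
  have hnotjump : ∀ q s, IsJump v N q → 1 ≤ s → s ≤ N → ¬ IsJump v N (q - s) :=
    fun q s hq hs hsN hj => by
      have h1 := hv.le_jump hN hq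
      have := hv.jump_spacing hN hj hq (by omega)
      omega
  have hBjump : ∀ q, IsJump v N q → B q := fun q hq => ⟨q, hq, le_rfl, by omega⟩
  have hθstart : ∀ x, (¬ B x ∨ IsJump v N x) → θ (x + 1) = 0 := by
    intro x hx
    rcases hcases (x + 1) with h | ⟨q, s, hq, hs, hxs, hsq⟩
    · exact hθ0 _ h
    · by_cases hsN : s = N
      · rw [hxs, hθ1 q s hq hs, hsN]; simp
      · exfalso
        have hxe : x = q - (s + 1) := by omega
        rcases hx with h | h
        · exact h ⟨q, hxe ▸ hin q (s + 1) hq (by omega)⟩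
        · exact hnotjump q (s + 1) hq (by omega) (by omega) (hxe ▸ h)
  have hθzero : θ 0 = 0 := by
    rcases hcases 0 with h | ⟨q, s, hq, hs, hxs, hsq⟩
    · exact hθ0 _ h
    · have := hv.le_jump hN hq
      rw [hxs, hθ1 q s hq hs, show s = N by omega]; simp
  -- At a jump, `W` is still the level before the jump, since the path continues behind the partner,
  -- where that level is resumed. Thus `W` lags one place behind `K` everywhere, which makes it
  -- constant along the new permutation.
  have hWsucc : ∀ x, W (x + 1) = ℓ (K x) := by
    intro x
    simp only [hW]
    split_ifs with h
    · rw [(hP _ h).2.2.1, Nat.add_sub_cancel]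
    · have : K (x + 1) = K x := by
        by_contra hne
        exact h ⟨by omega, by rwa [Nat.add_sub_cancel]⟩
      rw [this]
  have hWzero : W 0 = ℓ 0 := by
    simp only [hW]
    rw [if_neg (fun h : IsJump v N 0 => h.1 rfl)]
    rfl
  have hτlt : ∀ x, x < n → τ x < n := by
    intro x hx
    rcases hcases x with h | ⟨q, s, hq, hs, rfl, hsq⟩
    · rwa [hτ0 _ h]
    · rw [hτ1 q s hq hs]
      exact (Nat.sub_le _ _).trans_lt (hv.jump_lt hN (hP q hq).1)
  have hττ : ∀ x, τ (τ x) = x := by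
    intro x
    rcases hcases x with h | ⟨q, s, hq, hs, rfl, hsq⟩
    · rw [hτ0 _ h, hτ0 _ h]
    · rw [hτ1 q s hq hs, hτ1 (P q) s (hP q hq).1 hs, (hP q hq).2.1]
  have hθτ : ∀ x, θ (τ x) = - θ x := by
    intro x
    rcases hcases x with h | ⟨q, s, hq, hs, rfl, hsq⟩
    · rw [hτ0 _ h, hθ0 _ h, neg_zero]
    · rw [hτ1 q s hq hs, hθ1 (P q) s (hP q hq).1 hs, hθ1 q s hq hs, (hP q hq).2.2.1,
        (hP q hq).2.2.2]
      push_cast; ring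
  have hrot : ∀ x : Fin n, (x : ℕ) + 1 < n → ((finRotate n x : Fin n) : ℕ) = (x : ℕ) + 1 :=
    fun x hx => by rw [finRotate_of_lt hx]
  have hrot0 : ∀ x : Fin n, ¬ (x : ℕ) + 1 < n → ((finRotate n x : Fin n) : ℕ) = 0 := by
    intro x hx
    rw [coe_finRotate_eq, show (x : ℕ) + 1 = n by omega, Nat.mod_self]
  have hθrot : ∀ x : Fin n, (¬ B x ∨ IsJump v N x) → θ (finRotate n x : Fin n) = 0 := by
    intro x hx
    by_cases h : (x : ℕ) + 1 < n
    · rw [hrot x h]; exact hθstart x hx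
    · rw [hrot0 x h]; exact hθzero
  have hWrot : ∀ x : Fin n, W (finRotate n x : Fin n) = ℓ (K x) := by
    intro x
    by_cases h : (x : ℕ) + 1 < n
    · rw [hrot x h]; exact hWsucc x
    · rw [hrot0 x h, hWzero, hK, hv.hyst_eq_zero hN (by omega)]
  have hsgn : ∀ q, IsJump v N q → (K q - K (q - 1) = 1 ∨ K q - K (q - 1) = -1) := fun q hq => by
    rcases hq.cases.2 with h | h
    · left; rw [hK]; linarith
    · right; rw [hK]; linarith
  let X : Exchange (finRotate n) (fun i : Fin n => c i) M :=
    { τ := fun x => ⟨τ x, hτlt x x.2⟩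
      θ := fun x => θ x
      last := {x | IsJump v N x}
      W := fun x => W x
      involutive := fun x => Fin.ext (hττ x)
      θ_τ := fun x => hθτ x
      τ_mem_last := fun x hx => by
        have := hτ1 x 0 hx (Nat.zero_le _)
        simp only [Nat.sub_zero] at this
        simp only [Set.mem_ofPred_eq, this]
        exact (hP _ hx).1
      W_nonneg := fun x => by
        simp only [hW]; split_ifs <;> exact hℓ _
      step := by
        intro x
        rcases hcases x with h | ⟨q, s, hq, hs, hx, hsq⟩
        · refine Or.inl ⟨Fin.ext (hτ0 _ h), fun hj => h (hBjump _ hj), hθrot x (Or.inl h), ?_⟩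
          simp only [hW]
          rw [if_neg fun hj => h (hBjump _ hj)]
          exact hnear x
        · rcases Nat.eq_zero_or_pos s with rfl | hs1
          · rw [Nat.sub_zero] at hx
            have hτx := hτ1 q 0 hq hs
            have hθx := hθ1 q 0 hq hs
            rw [Nat.sub_zero, ← hx] at hτx hθx
            refine Or.inr (Or.inr ⟨?_, ?_, hθrot x (Or.inr (hx ▸ hq)), ?_⟩)
            · rw [Set.mem_ofPred_eq, hx]; exact hq
            · simp only [hθx, Nat.cast_zero, sub_zero]
              have : (N : ℝ) * (Real.pi / (2 * N)) = Real.pi / 2 := by field_simp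
              rw [this]
              rcases hsgn q hq with h | h <;> rw [hx, h] <;> simp
            · simp only [hτx, hW]
              rw [if_pos (hx ▸ hq), hx]
              exact hnear (P q)
          · right; left
            have hq' := (hP q hq).1
            have hqn := hv.jump_lt hN hq
            have hqn' := hv.jump_lt hN hq'
            have hqN := hv.le_jump hN hq
            have hqN' := hv.le_jump hN hq'
            have hx1 : (x : ℕ) + 1 = q - (s - 1) := by omega
            have hlt : (x : ℕ) + 1 < n := by omega
            have hτx : τ x = P q - s := by rw [hx]; exact hτ1 q s hq hs
            have hnj : ¬ IsJump v N x := by rw [hx]; exact hnotjump q s hq hs1 hs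
            have hnj' : ¬ IsJump v N (P q - s) := hnotjump _ s hq' hs1 hs
            have hKx : K x = K (q - 1) := by rw [hx]; exact (hv.before_jump hN hq s hs1 hs).2
            have hKx' : K (P q - s) = K q := by
              rw [← (hP q hq).2.2.2]; exact (hv.before_jump hN hq' s hs1 hs).2
            have hmin : min (K (P q - 1)) (K (P q)) = min (K (q - 1)) (K q) := by
              rw [(hP q hq).2.2.1, (hP q hq).2.2.2, min_comm]
            obtain ⟨hmono, hM⟩ := hcost q hq
            have hends : ∀ k, (k = K (q - 1) ∨ k = K q) → ℓ k ∈ Set.Icc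
                (ℓ (min (K (q - 1)) (K q))) (ℓ (min (K (q - 1)) (K q) + 1)) := by
              intro k hk
              have : k = min (K (q - 1)) (K q) ∨ k = min (K (q - 1)) (K q) + 1 := by
                rcases hsgn q hq with h | h <;> omega
              rcases this with h | h <;> rw [h]
              · exact ⟨le_rfl, hmono⟩
              · exact ⟨hmono, le_rfl⟩
            refine ⟨hnj, ?_, ℓ (min (K (q - 1)) (K q)), ℓ (min (K (q - 1)) (K q) + 1), hℓ _,
              ?_, ?_, ?_, ?_, ?_⟩
            · apply Fin.ext
              have h1 : (⟨τ x, hτlt x x.2⟩ : Fin n).1 + 1 < n := by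
                simp only [hτx]; omega
              rw [hrot _ h1]
              simp only [hrot x hlt, hτx, hx1]
              rw [hτ1 q (s - 1) hq (by omega)]
              omega
            · simp only [hW]; rw [if_neg hnj]
              exact hends _ (Or.inl hKx)
            · simp only [hτx, hW]; rw [if_neg hnj']
              exact hends _ (Or.inr hKx')
            · simp only [hx]; exact hblock q hq s hs1 hs
            · simp only [hτx, ← hmin]; exact hblock (P q) hq' s hs1 hs
            · have hdiff : |θ (finRotate n x : Fin n) - θ x| = Real.pi / (2 * N) := by
                rw [hrot x hlt, hx1, hx, hθ1 q s hq hs, hθ1 q (s - 1) hq (by omega),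
                  Nat.cast_sub hs1, Nat.cast_one]
                have hpos : 0 ≤ Real.pi / (2 * N) := by positivity
                rcases hsgn q hq with h | h <;> rw [h]
                · rw [show ((1 : ℤ) : ℝ) * ((N - (s - 1)) * (Real.pi / (2 * N))) -
                    ((1 : ℤ) : ℝ) * ((N - s) * (Real.pi / (2 * N))) = Real.pi / (2 * N) by
                      push_cast; ring]
                  exact abs_of_nonneg hpos
                · rw [show ((-1 : ℤ) : ℝ) * ((N - (s - 1)) * (Real.pi / (2 * N))) -
                    ((-1 : ℤ) : ℝ) * ((N - s) * (Real.pi / (2 * N))) = -(Real.pi / (2 * N)) by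
                      push_cast; ring]
                  rw [abs_neg]; exact abs_of_nonneg hpos
              rw [hdiff]; exact hM }
  refine ⟨X, fun x => ?_⟩
  by_cases hj : IsJump v N x
  · have hx : x ∈ X.last := hj
    rw [X.perm_of_mem hx]
    have h1 : ((X.τ x : Fin n) : ℕ) = P x := by
      have := hτ1 x 0 hj (Nat.zero_le _)
      simpa using this
    have h2 : X.W x = ℓ (K (P x)) := by
      change W x = _
      simp only [hW]; rw [if_pos hj]
    rw [h2, ← h1]
    exact hWrot _
  · have hx : x ∉ X.last := hj
    rw [X.perm_of_notMem hx]
    have h2 : X.W x = ℓ (K x) := by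
      change W x = _
      simp only [hW]; rw [if_neg hj]
    rw [h2]
    exact hWrot _

end Chain

end GradualExchange

end

noncomputable section

namespace GradualExchange

/-! ### The cost of the exchanges inside a chain -/

section ChainConstants

/-- Hölder continuity of the square root: the commutator controls the squares of the weights, but
the distance of operators involves the weights themselves. -/
theorem abs_sqrt_sub_le {a x η : ℝ} (hx : 0 ≤ x) (h : |a - x ^ 2| ≤ η) :
    |√a - x| ≤ √η := by
  have hη : 0 ≤ η := (abs_nonneg _).trans h
  have hs := Real.sqrt_nonneg η
  have hsq := Real.sq_sqrt hη
  rw [abs_le] at h ⊢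
  constructor
  · rcases le_total x √η with h1 | h1
    · linarith [Real.sqrt_nonneg a]
    · have : x - √η ≤ √a := by
        apply Real.le_sqrt_of_sq_le
        nlinarith
      linarith
  · have : √a ≤ √η + x := by
      apply Real.sqrt_le_iff.mpr
      constructor
      · positivity
      · nlinarith [mul_nonneg hs hx]
    linarith

/-- Measured in units of ε, the squared weights form a walk with steps of size at most one after
rounding down. The levels are √(k(N+1)ε). Neighbouring levels differ by at most √((N+1)ε), and each
rotation step adds at most π/(2N) times the upper level. -/
theorem exists_exchange_of_slowly_varying {n N : ℕ} (hN : 1 ≤ N) {c : ℕ → ℝ} {C ε M : ℝ}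
    (hε : 0 < ε) (hc0 : ∀ i, 0 ≤ c i) (hcC : ∀ i, c i ≤ C) (hstart : c 0 ^ 2 ≤ ε)
    (hstep : ∀ i, |c (i + 1) ^ 2 - c i ^ 2| ≤ ε) (hend : ∀ i, n ≤ i + 1 → c i = 0)
    (hM : √((N + 1) * ε) + Real.pi / (2 * N) * C ≤ M) :
    ∃ X : Exchange (finRotate n) (fun i : Fin n => c i) M, ∀ q, X.W (X.perm q) = X.W q := by
  have hNR : (1 : ℝ) ≤ N := by exact_mod_cast hN
  have hη : 0 < (N + 1) * ε := by positivity
  have hpi := Real.pi_pos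
  have hC : 0 ≤ C := (hc0 0).trans (hcC 0)
  have hM1 : √((N + 1) * ε) ≤ M := by
    have : 0 ≤ Real.pi / (2 * N) * C := by positivity
    linarith
  set v : ℕ → ℤ := fun i => ⌊c i ^ 2 / ε⌋ with hvdef
  have hfl : ∀ i, (v i : ℝ) * ε ≤ c i ^ 2 := fun i => by
    have := Int.floor_le (c i ^ 2 / ε)
    rwa [le_div_iff₀ hε] at this
  have hfu : ∀ i, c i ^ 2 < ((v i : ℝ) + 1) * ε := fun i => by
    have := Int.lt_floor_add_one (c i ^ 2 / ε)
    rwa [div_lt_iff₀ hε] at this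
  have hv : IsWalk v n :=
    { nonneg := fun i => Int.floor_nonneg.mpr (by positivity)
      zero_le_one := by
        have h1 := hfl 0
        have h2 : (v 0 : ℝ) < 2 := by
          by_contra h; push Not at h; nlinarith
        have h3 : v 0 < 2 := by exact_mod_cast h2
        omega
      step := fun i => by
        have h := abs_le.mp (hstep i)
        have h1 := hfl i; have h2 := hfu i; have h3 := hfl (i + 1); have h4 := hfu (i + 1)
        have h5 : (v (i + 1) : ℝ) < v i + 2 := by
          by_contra h; push Not at h; nlinarith
        have h6 : (v i : ℝ) < v (i + 1) + 2 := by
          by_contra h; push Not at h; nlinarith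
        have h7 : v (i + 1) < v i + 2 := by exact_mod_cast h5
        have h8 : v i < v (i + 1) + 2 := by exact_mod_cast h6
        rw [abs_le]; omega
      eq_zero := fun i hi => by simp [hvdef, hend i hi] }
  set ℓ : ℤ → ℝ := fun k => √(k * ((N + 1) * ε)) with hℓ
  have hcost : ∀ q, IsJump v N q → ∀ k, k = min (hyst v (N + 1) (q - 1)) (hyst v (N + 1) q) →
      0 ≤ k ∧ ℓ k ≤ ℓ (k + 1) ∧ ℓ (k + 1) - ℓ k ≤ √((N + 1) * ε) := by
    intro q hq k hk
    have hk0 : 0 ≤ k := by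
      rw [hk]; exact le_min (hv.hyst_nonneg hN _) (hv.hyst_nonneg hN _)
    have hk0R : (0 : ℝ) ≤ k := by exact_mod_cast hk0
    refine ⟨hk0, Real.sqrt_le_sqrt (by push_cast; nlinarith), ?_⟩
    have := abs_sqrt_sub_le (a := ((k + 1 : ℤ) : ℝ) * ((N + 1) * ε)) (x := ℓ k)
      (η := (N + 1) * ε) (Real.sqrt_nonneg _) (by
        rw [hℓ, Real.sq_sqrt (by positivity)]
        push_cast
        rw [show ((k : ℝ) + 1) * ((N + 1) * ε) - k * ((N + 1) * ε) = (N + 1) * ε by ring,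
          abs_of_pos hη])
    exact (abs_le.mp this).2
  refine hv.exists_exchange hN (ℓ := ℓ) (fun k => Real.sqrt_nonneg _) (fun i => ?_)
    (fun q hq s hs hsN => ?_) (fun q hq => ?_)
  · refine (abs_sqrt_sub_le (η := (N + 1) * ε) (hc0 i) ?_).trans hM1
    have h := abs_lt.mp (hv.abs_sub_hyst_lt hN i)
    set k := hyst v (N + 1) i
    have h1 : v i + 1 ≤ (k + 1) * (N + 1) := by linarith [h.2]
    have h2 : (k - 1) * (N + 1) ≤ v i := by linarith [h.1]
    have h1' : (v i : ℝ) + 1 ≤ (k + 1) * (N + 1) := by exact_mod_cast h1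
    have h2' : ((k : ℝ) - 1) * (N + 1) ≤ v i := by exact_mod_cast h2
    have h3 := hfl i; have h4 := hfu i
    rw [abs_le]
    constructor <;> nlinarith
  · obtain ⟨h1, h2⟩ := hv.level_before_jump hN hq s hs hsN
    obtain ⟨hk0, -, -⟩ := hcost q hq _ rfl
    set k := min (hyst v (N + 1) (q - 1)) (hyst v (N + 1) q)
    have h1' : (k : ℝ) * (N + 1) ≤ v (q - s) := by exact_mod_cast h1
    have h2' : (v (q - s) : ℝ) + 1 ≤ (k + 1) * (N + 1) := by
      exact_mod_cast (by linarith : v (q - s) + 1 ≤ (k + 1) * (N + 1))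
    have h3 := hfl (q - s); have h4 := hfu (q - s)
    constructor
    · apply Real.sqrt_le_iff.mpr
      exact ⟨hc0 _, by nlinarith⟩
    · apply Real.le_sqrt_of_sq_le
      push_cast
      nlinarith
  · obtain ⟨hk0, hmono, hdiff⟩ := hcost q hq _ rfl
    refine ⟨hmono, ?_⟩
    -- At an up-jump the walk is exactly at the upper multiple, so the weight there is at least the
    -- upper level. A down-jump has the same upper level as its partner.
    have hle : ℓ (min (hyst v (N + 1) (q - 1)) (hyst v (N + 1) q) + 1) ≤ C := by
      obtain ⟨P, hP⟩ := hv.exists_partner hN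
      have key : ∀ q, IsJump v N q → hyst v (N + 1) q = hyst v (N + 1) (q - 1) + 1 →
          ℓ (hyst v (N + 1) q) ≤ C := by
        intro q hq hup
        have h1 := hq.cases.1
        have h3 := hfl q
        have h1' : (v q : ℝ) = hyst v (N + 1) q * (N + 1) := by rw [h1]; push_cast; ring
        refine le_trans (Real.sqrt_le_iff.mpr ⟨hc0 q, ?_⟩) (hcC q)
        rw [h1'] at h3
        linarith
      rcases hq.cases.2 with h | h
      · have := key q hq h
        rwa [min_eq_left (by linarith), ← h]
      · obtain ⟨h1, -, h2, h3⟩ := hP q hq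
        have := key (P q) h1 (by rw [h2, h3, h]; ring)
        rw [min_eq_right (by linarith)]
        rw [h2] at this
        rwa [h, sub_add_cancel]
    have h5 : Real.pi / (2 * N) *
        ℓ (min (hyst v (N + 1) (q - 1)) (hyst v (N + 1) q) + 1) ≤ Real.pi / (2 * N) * C := by
      gcongr
    linarith

/-- With C = p³ and ε = q³, the choice N = ⌈p²/q⌉ balances the two terms. By hypothesis q <
p²/5.3308, so rounding is harmless: the terms are at most 1.2pq and 2pq, well below 5.3308pq. -/
theorem exists_rotation_length {C ε : ℝ} (hC : 0 < C) (hε : 0 < ε)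
    (h : 5.3308 * C ^ (1 - 2 * (1 / 3) : ℝ) * ε ^ (1 / 3 : ℝ) < C) :
    ∃ N : ℕ, 1 ≤ N ∧ √((N + 1) * ε) + Real.pi / (2 * N) * C ≤
      5.3308 * C ^ (1 - 2 * (1 / 3) : ℝ) * ε ^ (1 / 3 : ℝ) := by
  rw [show (1 - 2 * (1 / 3) : ℝ) = 1 / 3 by norm_num] at *
  set p := C ^ (1 / 3 : ℝ) with hp
  set q := ε ^ (1 / 3 : ℝ) with hq
  have hp0 : 0 < p := Real.rpow_pos_of_pos hC _
  have hq0 : 0 < q := Real.rpow_pos_of_pos hε _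
  have hCp : C = p ^ 3 := by
    rw [hp, ← Real.rpow_natCast, ← Real.rpow_mul hC.le]; norm_num
  have hεq : ε = q ^ 3 := by
    rw [hq, ← Real.rpow_natCast, ← Real.rpow_mul hε.le]; norm_num
  clear_value p q
  subst hCp hεq
  have h1 : 5.3308 * q < p ^ 2 := by
    by_contra hcon
    push Not at hcon
    nlinarith
  have hr : 0 < p ^ 2 / q := by positivity
  have hN1 := Nat.le_ceil (p ^ 2 / q)
  have hN2 := Nat.ceil_lt_add_one hr.le
  have hNpos : 0 < ⌈p ^ 2 / q⌉₊ := Nat.ceil_pos.mpr hr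
  refine ⟨⌈p ^ 2 / q⌉₊, hNpos, ?_⟩
  set N : ℝ := (⌈p ^ 2 / q⌉₊ : ℝ)
  have hN0 : 0 < N := Nat.cast_pos.mpr hNpos
  rw [div_le_iff₀ hq0] at hN1
  have hN3 : N * q < p ^ 2 + q := by
    have := mul_lt_mul_of_pos_right hN2 hq0
    rwa [add_mul, div_mul_cancel₀ _ hq0.ne', one_mul] at this
  have a1 : √((N + 1) * q ^ 3) ≤ 1.2 * (p * q) := by
    apply Real.sqrt_le_iff.mpr
    refine ⟨by positivity, ?_⟩
    have : (N + 1) * q ≤ 1.44 * p ^ 2 := by linarith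
    have hq2 : 0 ≤ q ^ 2 := by positivity
    nlinarith [mul_le_mul_of_nonneg_right this hq2]
  have a2 : Real.pi / (2 * N) * p ^ 3 ≤ 2 * (p * q) := by
    rw [div_mul_eq_mul_div, div_le_iff₀ (by positivity)]
    have hpi := Real.pi_lt_four
    have h3 : p ^ 3 ≤ N * q * p := by nlinarith
    have h4 : 0 < p ^ 3 := by positivity
    nlinarith
  have : 0 < p * q := by positivity
  nlinarith

end ChainConstants

/-! ### Exchanges in direct sums of chains -/

section SigmaExchange

variable {p : ℕ} {n : Fin p → ℕ}

/-- Exchange data that only rescale the weights. -/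
def Exchange.zero {ι : Type*} (π : Equiv.Perm ι) {c : ι → ℝ} {M : ℝ} (hc : ∀ q, |c q| ≤ M) :
    Exchange π c M where
  τ q := q
  θ _ := 0
  last := ∅
  W _ := 0
  involutive _ := rfl
  θ_τ _ := neg_zero.symm
  τ_mem_last q hq := hq
  W_nonneg _ := le_rfl
  step q := Or.inl ⟨rfl, fun h => h, rfl, by simpa using hc q⟩

/-- The direct sum of exchange data for cyclic shifts. -/
def Exchange.sigma {c : (Σ j, Fin (n j)) → ℝ} {M : ℝ}
    (X : ∀ j, Exchange (finRotate (n j)) (fun i => c ⟨j, i⟩) M) :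
    Exchange (Equiv.sigmaCongrRight fun j => finRotate (n j)) c M where
  τ q := ⟨q.1, (X q.1).τ q.2⟩
  θ q := (X q.1).θ q.2
  last := {q | q.2 ∈ (X q.1).last}
  W q := (X q.1).W q.2
  involutive q := by
    simp only [(X q.1).involutive q.2]
  θ_τ q := (X q.1).θ_τ q.2
  τ_mem_last q hq := (X q.1).τ_mem_last q.2 hq
  W_nonneg q := (X q.1).W_nonneg q.2
  step q := by
    rcases (X q.1).step q.2 with ⟨h1, h2⟩ | ⟨h1, h2, h3⟩ | h
    · exact Or.inl ⟨by simp only [h1], h2⟩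
    · exact Or.inr (Or.inl ⟨h1, congrArg (Sigma.mk q.1) h2, h3⟩)
    · exact Or.inr (Or.inr h)

theorem Exchange.sigma_perm_fst {c : (Σ j, Fin (n j)) → ℝ} {M : ℝ}
    (X : ∀ j, Exchange (finRotate (n j)) (fun i => c ⟨j, i⟩) M) (q : Σ j, Fin (n j)) :
    (Exchange.sigma X).perm q = ⟨q.1, (X q.1).perm q.2⟩ := by
  by_cases hq : q.2 ∈ (X q.1).last
  · rw [Exchange.perm_of_mem _ (show q ∈ (Exchange.sigma X).last from hq),
      Exchange.perm_of_mem _ hq]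
    rfl
  · rw [Exchange.perm_of_notMem _ (show q ∉ (Exchange.sigma X).last from hq),
      Exchange.perm_of_notMem _ hq]
    rfl

/-- Every direct sum of weighted shifts with slowly varying nonnegative weights can be turned into
a normal one by gradual exchanges inside the chains. -/
theorem exists_normal_exchange {c : (Σ j, Fin (n j)) → ℝ} {C ε : ℝ} (hC0 : 0 ≤ C) (hε0 : 0 ≤ ε)
    (hc0 : ∀ q, 0 ≤ c q) (hcC : ∀ q, c q ≤ C)
    (hlast : ∀ q : Σ j, Fin (n j), (q.2 : ℕ) + 1 = n q.1 → c q = 0)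
    (hstep : ∀ q : Σ j, Fin (n j), |c ⟨q.1, finRotate (n q.1) q.2⟩ ^ 2 - c q ^ 2| ≤ ε) :
    ∃ X : Exchange (Equiv.sigmaCongrRight fun j => finRotate (n j)) c
        (5.3308 * C ^ (1 - 2 * (1 / 3) : ℝ) * ε ^ (1 / 3 : ℝ)),
      (∀ q, (X.τ q).1 = q.1) ∧ (∀ q, (X.perm q).1 = q.1) ∧ ∀ q, X.W (X.perm q) = X.W q := by
  set M := 5.3308 * C ^ (1 - 2 * (1 / 3) : ℝ) * ε ^ (1 / 3 : ℝ) with hM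
  have hM0 : 0 ≤ M := by positivity
  -- If every weight is at most `M`, the zero operator is near enough. Otherwise `M < C`, as needed
  -- for `exists_rotation_length`.
  by_cases htriv : ∀ q, c q ≤ M
  · refine ⟨Exchange.zero _ fun q => by rw [abs_of_nonneg (hc0 q)]; exact htriv q,
      fun q => rfl, fun q => ?_, fun q => rfl⟩
    rw [Exchange.perm_of_notMem _ (Set.notMem_empty q)]
    rfl
  push Not at htriv
  obtain ⟨q₀, hq₀⟩ := htriv
  have hMC : M < C := hq₀.trans_le (hcC q₀)
  -- the weights of the `j`-th chain, extended by zero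
  set d : Fin p → ℕ → ℝ := fun j i => if h : i < n j then c ⟨j, ⟨i, h⟩⟩ else 0 with hd
  have hd1 : ∀ (q : Σ j, Fin (n j)), d q.1 q.2 = c q := fun q => by simp [hd]
  have hdend : ∀ j i, n j ≤ i + 1 → d j i = 0 := by
    intro j i hi
    simp only [hd]
    split_ifs with h
    · exact hlast ⟨j, ⟨i, h⟩⟩ (by simp only; omega)
    · rfl
  have hdstart : ∀ j, d j 0 ^ 2 ≤ ε := by
    intro j
    rcases Nat.eq_zero_or_pos (n j) with h | h
    · rw [hdend j 0 (by omega)]; simpa using hε0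
    · have := hstep ⟨j, ⟨n j - 1, by omega⟩⟩
      rw [hlast ⟨j, ⟨n j - 1, by omega⟩⟩ (by simp only; omega)] at this
      have hr : finRotate (n j) ⟨n j - 1, by omega⟩ = ⟨0, h⟩ := by
        apply Fin.ext
        rw [coe_finRotate_eq]
        simp only
        rw [Nat.sub_add_cancel h, Nat.mod_self]
      simp only [hr] at this
      rw [← hd1 ⟨j, ⟨0, h⟩⟩] at this
      simpa using this
  have hdstep : ∀ j i, |d j (i + 1) ^ 2 - d j i ^ 2| ≤ ε := by
    intro j i
    by_cases h : i + 1 < n j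
    · have := hstep ⟨j, ⟨i, by omega⟩⟩
      rw [finRotate_of_lt (by simpa using h), ← hd1, ← hd1] at this
      exact this
    · rw [hdend j i (by omega), hdend j (i + 1) (by omega)]; simpa using hε0
  -- If ε = 0, the weights would be constant around each chain, hence equal to the last one, which
  -- is 0; but some weight exceeds `M`.
  have hε : 0 < ε := by
    rcases hε0.eq_or_lt with h | h
    · exfalso
      have hzero : ∀ j i, d j i ^ 2 ≤ 0 := by
        intro j i
        induction i with
        | zero => rw [h]; exact hdstart j
        | succ i ih =>
          have := (abs_le.mp (hdstep j i)).2
          linarith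
      have h1 := hzero q₀.1 q₀.2
      rw [hd1] at h1
      have h2 : 0 < c q₀ := hM0.trans_lt hq₀
      nlinarith
    · exact h
  have hC : 0 < C := hM0.trans_lt hMC
  obtain ⟨N, hN, hNM⟩ := exists_rotation_length hC hε hMC
  have hX : ∀ j, ∃ X : Exchange (finRotate (n j)) (fun i => c ⟨j, i⟩) M,
      ∀ q, X.W (X.perm q) = X.W q := by
    intro j
    have hdj : (fun i : Fin (n j) => d j i) = fun i => c ⟨j, i⟩ := by
      funext i; exact hd1 ⟨j, i⟩
    rw [← hdj]
    refine exists_exchange_of_slowly_varying hN hε (fun i => ?_) (fun i => ?_) (hdstart j)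
      (hdstep j) (hdend j) hNM
    · simp only [hd]; split_ifs
      · exact hc0 _
      · exact le_rfl
    · simp only [hd]; split_ifs
      · exact hcC _
      · exact hC0
  choose X hX using hX
  refine ⟨Exchange.sigma X, fun q => rfl, fun q => by rw [Exchange.sigma_perm_fst], fun q => ?_⟩
  rw [Exchange.sigma_perm_fst]
  exact hX q.1 q.2

end SigmaExchange

end GradualExchange

end

noncomputable section

namespace GradualExchange

/-! ### Orthogonal direct sums of operators -/

section DirectSum

variable {m : ℕ} {E : Fin m → Type*} [∀ r, NormedAddCommGroup (E r)]
    [∀ r, InnerProductSpace ℂ (E r)]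

theorem directSum_apply (T : ∀ r, E r →L[ℂ] E r) (x : PiLp 2 E) (r : Fin m) :
    directSum T x r = T r (x r) := rfl

theorem directSum_sub (T T' : ∀ r, E r →L[ℂ] E r) :
    directSum T - directSum T' = directSum (fun r => T r - T' r) := by
  ext x r
  simp [directSum_apply]

theorem directSum_mul (T T' : ∀ r, E r →L[ℂ] E r) :
    directSum T * directSum T' = directSum (fun r => T r * T' r) := by
  ext x r
  simp [directSum_apply]

theorem norm_directSum_le (T : ∀ r, E r →L[ℂ] E r) {M : ℝ} (hM : 0 ≤ M) (h : ∀ r, ‖T r‖ ≤ M) :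
    ‖directSum T‖ ≤ M := by
  refine ContinuousLinearMap.opNorm_le_bound _ hM fun x => ?_
  refine le_of_sq_le_sq ?_ (by positivity)
  rw [mul_pow, PiLp.norm_sq_eq_of_L2, PiLp.norm_sq_eq_of_L2, Finset.mul_sum]
  refine Finset.sum_le_sum fun r _ => ?_
  rw [directSum_apply, ← mul_pow]
  have := (T r).le_opNorm (x r)
  gcongr
  exact this.trans (by gcongr; exact h r)

theorem star_directSum [∀ r, CompleteSpace (E r)] (T : ∀ r, E r →L[ℂ] E r) :
    star (directSum T) = directSum (fun r => star (T r)) := by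
  rw [ContinuousLinearMap.star_eq_adjoint]
  symm
  rw [ContinuousLinearMap.eq_adjoint_iff]
  intro x y
  simp only [PiLp.inner_apply, directSum_apply, ContinuousLinearMap.star_eq_adjoint,
    ContinuousLinearMap.adjoint_inner_left]

theorem isStarNormal_directSum [∀ r, CompleteSpace (E r)] (T : ∀ r, E r →L[ℂ] E r)
    (h : ∀ r, IsStarNormal (T r)) : IsStarNormal (directSum T) := by
  refine ⟨?_⟩
  rw [star_directSum, Commute, SemiconjBy, directSum_mul, directSum_mul]
  congr 1
  funext r
  exact (h r).star_comm_self

theorem directSum_basis {ι : Fin m → Type*} [∀ r, Fintype (ι r)]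
    (e : ∀ r, OrthonormalBasis (ι r) ℂ (E r)) (T : ∀ r, E r →L[ℂ] E r) (q : Σ r, ι r)
    {c : ℂ} {i : ι q.1} (h : T q.1 (e q.1 q.2) = c • e q.1 i) :
    directSum T (Pi.orthonormalBasis e q) = c • Pi.orthonormalBasis e ⟨q.1, i⟩ := by
  rw [Pi.orthonormalBasis_apply, Pi.orthonormalBasis_apply]
  refine PiLp.ext fun r => ?_
  rw [directSum_apply]
  obtain ⟨r', j⟩ := q
  by_cases hr : r = r'
  · subst hr
    simpa using h
  · simp [hr]

end DirectSum

/-! ### Joint diagonalization of commuting operators -/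

section JointDiagonalization

variable {E : Type*} [NormedAddCommGroup E] [InnerProductSpace ℂ E] [FiniteDimensional ℂ E]

/-- The joint eigenspaces are indexed by all families of complex numbers; only finitely many are
nonzero, and those supply the basis. -/
theorem exists_joint_eigenbasis {κ : Type*} [Finite κ] {T : κ → E →ₗ[ℂ] E}
    (hT : ∀ i, (T i).IsSymmetric) (hC : Pairwise (Function.onFun Commute T)) :
    ∃ b : OrthonormalBasis (Fin (Module.finrank ℂ E)) ℂ E,
      ∀ q i, ∃ μ : ℂ, T i (b q) = μ • b q := by
  classical
  set V : (κ → ℂ) → Submodule ℂ E := fun α => ⨅ j, Module.End.eigenspace (T j) (α j) with hVdef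
  have hV := LinearMap.IsSymmetric.directSum_isInternal_of_pairwise_commute hT hC
  have hV' := LinearMap.IsSymmetric.orthogonalFamily_iInf_eigenspaces hT
  have hfin : {α | V α ≠ ⊥}.Finite :=
    WellFoundedGT.finite_ne_bot_of_iSupIndep hV.submodule_iSupIndep
  have : Fintype {α // V α ≠ ⊥} := hfin.fintype
  have hW := DirectSum.isInternal_ne_bot_iff.mpr hV
  have hW' : OrthogonalFamily ℂ (fun α : {α // V α ≠ ⊥} => V α) fun α => (V α).subtypeₗᵢ :=
    hV'.comp Subtype.val_injective
  refine ⟨hW.subordinateOrthonormalBasis rfl hW', fun q i => ?_⟩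
  have hmem := hW.subordinateOrthonormalBasis_subordinate rfl q hW'
  exact ⟨_, Module.End.mem_eigenspace_iff.mp ((Submodule.mem_iInf _).mp hmem i)⟩

/-- Commuting self-adjoint and normal operators can be diagonalized simultaneously, so that the
normal one is a direct sum of one-dimensional bilateral shifts. -/
theorem bilateralShiftSumInEigenbasis_of_commute [CompleteSpace E] {A S : E →L[ℂ] E}
    (hA : IsSelfAdjoint A) (hS : IsStarNormal S) (hAS : Commute A S) :
    BilateralShiftSumInEigenbasis A S := by
  have hAS' : Commute A (star S) := by
    have := hAS.star_star
    rwa [hA.star_eq] at this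
  -- Replace the normal operator by two commuting self-adjoint ones from which it is recovered.
  set R : E →L[ℂ] E := S + star S with hR
  set J : E →L[ℂ] E := Complex.I • (S - star S) with hJ
  have hRs : IsSelfAdjoint R := by
    rw [hR, isSelfAdjoint_iff, star_add, star_star, add_comm]
  have hJs : IsSelfAdjoint J := by
    rw [hJ, isSelfAdjoint_iff, star_smul, star_sub, star_star]
    simp only [RCLike.star_def, Complex.conj_I]
    module
  have hSS : Commute S (star S) := hS.star_comm_self.symm
  have hRJ : Commute R J :=
    ((((Commute.refl S).sub_right hSS).add_left (hSS.symm.sub_right (Commute.refl _)))).smul_right _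
  have hAR : Commute A R := hAS.add_right hAS'
  have hAJ : Commute A J := (hAS.sub_right hAS').smul_right _
  have hlin : ∀ {X Y : E →L[ℂ] E}, Commute X Y → Commute (X : E →ₗ[ℂ] E) (Y : E →ₗ[ℂ] E) :=
    fun {X Y} h => by
      have := congrArg (fun Z : E →L[ℂ] E => (Z : E →ₗ[ℂ] E)) h.eq
      exact this
  let T : Fin 3 → E →ₗ[ℂ] E := ![A, R, J]
  have hT : ∀ i, (T i).IsSymmetric := by
    intro i
    fin_cases i
    · exact hA.isSymmetric
    · exact hRs.isSymmetric
    · exact hJs.isSymmetric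
  have hC : Pairwise (Function.onFun Commute T) := by
    intro i j hij
    fin_cases i <;> fin_cases j <;> first
      | exact absurd rfl hij
      | exact hlin hAR
      | exact hlin hAR.symm
      | exact hlin hAJ
      | exact hlin hAJ.symm
      | exact hlin hRJ
      | exact hlin hRJ.symm
  obtain ⟨b, hb⟩ := exists_joint_eigenbasis hT hC
  set φ : (Σ _ : Fin (Module.finrank ℂ E), Fin 1) ≃ Fin (Module.finrank ℂ E) :=
    Equiv.sigmaUnique _ _ with hφ
  have hSb : ∀ q, ∃ μ : ℂ, S (b q) = μ • b q := by
    intro q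
    obtain ⟨ρ, hρ⟩ := hb q 1
    obtain ⟨κ, hκ⟩ := hb q 2
    have hρ' : R (b q) = ρ • b q := hρ
    have hκ' : J (b q) = κ • b q := hκ
    refine ⟨(ρ - Complex.I * κ) / 2, ?_⟩
    have hSRJ : S = (1 / 2 : ℂ) • (R - Complex.I • J) := by
      rw [hR, hJ, smul_smul, Complex.I_mul_I]
      module
    rw [hSRJ, smul_apply, sub_apply, smul_apply, hρ', hκ']
    module
  choose μ hμ using hSb
  refine ⟨_, fun _ => 1, b.reindex φ.symm, fun x => μ (φ x), fun x => ?_, fun j i => ?_⟩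
  · obtain ⟨ν, hν⟩ := hb (φ x) 0
    refine ⟨ν, ?_⟩
    have hν' : A (b (φ x)) = ν • b (φ x) := hν
    simpa using hν'
  · have hi : finRotate 1 i = i := Subsingleton.elim _ _
    rw [hi]
    simpa using hμ (φ ⟨j, i⟩)

end JointDiagonalization

/-! ### Bound for the exponent, from tent-shaped weights -/

section Tent

/-- Normality gives ‖Xu‖ = ‖X*u‖ = ‖(X - T)*u‖, so T cannot be large at u without X - T being large.
-/
theorem norm_apply_le_of_isStarNormal {E : Type*} [NormedAddCommGroup E] [InnerProductSpace ℂ E]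
    [CompleteSpace E] {X T : E →L[ℂ] E} (hX : IsStarNormal X) {u : E} (hu : (star T) u = 0) :
    ‖T u‖ ≤ 2 * (‖X - T‖ * ‖u‖) := by
  have h4 : ‖X u‖ = ‖(star X) u‖ :=
    (ContinuousLinearMap.isStarNormal_iff_norm_eq_adjoint.mp hX) u
  have h5 := (X - T).le_opNorm u
  have h6 := (star (X - T)).le_opNorm u
  rw [norm_star, star_sub, sub_apply, hu, sub_zero, ← h4] at h6
  rw [sub_apply] at h5
  have h7 := norm_sub_norm_le (T u) (X u)
  rw [norm_sub_rev] at h7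
  linarith

/-- The exponent in `NormalApproximationConstants` cannot exceed `1/2`. -/
theorem NormalApproximationConstants.le_half {γ C : ℝ} (hγ : 0 < γ) (hC : 0 < C)
    (h : NormalApproximationConstants γ C) : γ ≤ 1 / 2 := by
  by_contra hγ2
  push Not at hγ2
  -- a tent shaped sequence of weights with peak `√k`
  have key : ∀ k : ℕ, 1 ≤ k → (1 / 2 : ℝ) ≤ C * (√k) ^ (1 - 2 * γ) := by
    intro k hk
    set n := 2 * k with hn
    set t : Fin n → ℕ := fun i => min (i : ℕ) (n - i) with ht
    set b := EuclideanSpace.basisFun (Fin n) ℂ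
    set w : Fin n → ℂ := fun i => ((√(t i) : ℝ) : ℂ) with hw
    have hwn : ∀ i, ‖w i‖ = √(t i) := fun i => by
      simp only [hw]
      rw [Complex.norm_real, Real.norm_eq_abs, abs_of_nonneg (Real.sqrt_nonneg _)]
    have hwsq : ∀ i, ‖w i‖ ^ 2 = t i := fun i => by
      rw [hwn, Real.sq_sqrt (Nat.cast_nonneg _)]
    set T := weightedPerm b (finRotate n) w with hT
    have hTw : IsWeightedPerm b (finRotate n) w T := isWeightedPerm_weightedPerm _ _ _
    obtain ⟨X, hX, hXT⟩ := h n b w T hTw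
    have hcomm : ‖selfCommutator T‖ ≤ 1 := by
      refine hTw.norm_selfCommutator_le zero_le_one fun q => ?_
      rw [hwsq, hwsq]
      have h1 : ((t (finRotate n q) : ℤ) - t q ≤ 1) ∧ (-1 ≤ (t (finRotate n q) : ℤ) - t q) := by
        have hq := q.2
        simp only [ht, coe_finRotate_eq]
        rcases Nat.lt_or_ge ((q : ℕ) + 1) n with hlt | hge
        · rw [Nat.mod_eq_of_lt hlt]; omega
        · have : (q : ℕ) + 1 = n := by omega
          rw [this, Nat.mod_self]; omega
      rw [abs_le]
      constructor
      · exact_mod_cast h1.2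
      · exact_mod_cast h1.1
    have hnorm : √k ≤ ‖T‖ := by
      have := hTw.norm_weight_le ⟨k, by omega⟩
      rw [hwn] at this
      have ht' : t ⟨k, by omega⟩ = k := by simp only [ht]; omega
      rwa [ht'] at this
    -- The weight into the second basis vector is 0 and the weight out of it is 1, so every normal
    -- operator is at distance at least 1/2.
    have hlow : (1 / 2 : ℝ) ≤ ‖X - T‖ := by
      set q : Fin n := ⟨1, by omega⟩ with hq
      have h1 : ‖T (b q)‖ = 1 := by
        rw [hTw q, norm_smul, hwn, b.norm_eq_one]
        have : t q = 1 := by simp only [ht, hq]; omega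
        simp [this]
      have h2 : (star T) (b q) = 0 := by
        rw [hTw.star q]
        have h3 : (finRotate n).symm q = ⟨0, by omega⟩ := by
          rw [Equiv.symm_apply_eq]
          exact Fin.ext (by rw [coe_finRotate_eq]; simp only [hq]; rw [Nat.mod_eq_of_lt]; omega)
        have : t ⟨0, by omega⟩ = 0 := by simp [ht]
        simp [h3, hw, this]
      have := norm_apply_le_of_isStarNormal hX h2
      rw [h1, b.norm_eq_one] at this
      linarith
    refine hlow.trans (hXT.trans ?_)
    have hk0 : 0 < √(k : ℝ) := Real.sqrt_pos.mpr (by exact_mod_cast hk)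
    have h8 : ‖T‖ ^ (1 - 2 * γ) ≤ (√k) ^ (1 - 2 * γ) :=
      Real.rpow_le_rpow_of_nonpos hk0 hnorm (by linarith)
    have h9 : ‖selfCommutator T‖ ^ γ ≤ 1 := Real.rpow_le_one (norm_nonneg _) hcomm hγ.le
    calc C * ‖T‖ ^ (1 - 2 * γ) * ‖selfCommutator T‖ ^ γ
        ≤ C * (√k) ^ (1 - 2 * γ) * 1 := by gcongr
      _ = _ := mul_one _
  have hlim : Filter.Tendsto (fun k : ℕ => C * (√k) ^ (1 - 2 * γ)) Filter.atTop (nhds (C * 0)) := by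
    refine Filter.Tendsto.const_mul C ?_
    have h1 : Filter.Tendsto (fun k : ℕ => √(k : ℝ)) Filter.atTop Filter.atTop :=
      Real.tendsto_sqrt_atTop.comp tendsto_natCast_atTop_atTop
    have h2 := (tendsto_rpow_neg_atTop (y := 2 * γ - 1) (by linarith)).comp h1
    refine h2.congr fun k => ?_
    simp [Function.comp]
  rw [mul_zero] at hlim
  have := hlim.eventually (gt_mem_nhds (by norm_num : (0 : ℝ) < 1 / 2))
  obtain ⟨k, hk1, hk2⟩ := (this.and (Filter.eventually_ge_atTop 1)).exists
  exact absurd (key k hk2) (not_le.mpr hk1)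

end Tent

/-! ### Normal approximation chain by chain -/

section Chains

variable {E : Type*} [NormedAddCommGroup E] [InnerProductSpace ℂ E] [CompleteSpace E]
variable {p : ℕ} {n : Fin p → ℕ}

/-- Each chain is a bilateral shift whose norm and commutator are bounded by those of the sum. The
diagonal operator is scalar on each chain and so commutes with every choice of blocks. That `γ ≤
1/2` is needed to replace the norm of a chain by `s`. -/
theorem exists_normal_of_constants {b : OrthonormalBasis (Σ j, Fin (n j)) ℂ E}
    {w : (Σ j, Fin (n j)) → ℂ} {S A : E →L[ℂ] E}
    (hS : IsWeightedPerm b (Equiv.sigmaCongrRight fun j => finRotate (n j)) w S)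
    {ν : Fin p → ℂ} (hA : IsWeightedPerm b (Equiv.refl _) (fun q => ν q.1) A)
    {s γ C : ℝ} (hs : ‖S‖ ≤ s) (hγ : 0 < γ) (hC : 0 < C) (h : NormalApproximationConstants γ C) :
    ∃ S'' : E →L[ℂ] E, IsStarNormal S'' ∧ Commute A S'' ∧
      ‖S'' - S‖ ≤ C * s ^ (1 - 2 * γ) * ‖selfCommutator S‖ ^ γ := by
  have hγ2 := h.le_half hγ hC
  have hs0 : 0 ≤ s := (norm_nonneg _).trans hs
  set B := Pi.orthonormalBasis (fun j => EuclideanSpace.basisFun (Fin (n j)) ℂ) with hB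
  set U : E ≃ₗᵢ[ℂ] PiLp 2 (fun j => EuclideanSpace ℂ (Fin (n j))) :=
    b.equiv B (Equiv.refl _) with hU
  have hUb : ∀ q, U (b q) = B q := fun q => by simp [hU]
  have hUB : ∀ q, U.symm (B q) = b q := fun q => by rw [← hUb, U.symm_apply_apply]
  set T : ∀ j, EuclideanSpace ℂ (Fin (n j)) →L[ℂ] EuclideanSpace ℂ (Fin (n j)) := fun j =>
    weightedPerm (EuclideanSpace.basisFun (Fin (n j)) ℂ) (finRotate (n j)) (fun i => w ⟨j, i⟩)
    with hT
  have hTw : ∀ j, IsWeightedPerm (EuclideanSpace.basisFun (Fin (n j)) ℂ) (finRotate (n j))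
      (fun i => w ⟨j, i⟩) (T j) := fun j => isWeightedPerm_weightedPerm _ _ _
  have hX : ∀ j, ∃ X : EuclideanSpace ℂ (Fin (n j)) →L[ℂ] EuclideanSpace ℂ (Fin (n j)),
      IsStarNormal X ∧ ‖X - T j‖ ≤ C * s ^ (1 - 2 * γ) * ‖selfCommutator S‖ ^ γ := by
    intro j
    obtain ⟨X, hX1, hX2⟩ := h (n j) _ _ _ (hTw j)
    refine ⟨X, hX1, hX2.trans ?_⟩
    have h1 : ‖T j‖ ≤ s := (hTw j).norm_le hs0 fun i => (hS.norm_weight_le ⟨j, i⟩).trans hs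
    have h2 : ‖selfCommutator (T j)‖ ≤ ‖selfCommutator S‖ :=
      (hTw j).norm_selfCommutator_le (norm_nonneg _) fun i =>
        hS.abs_sub_le_norm_selfCommutator ⟨j, i⟩
    have h3 : ‖T j‖ ^ (1 - 2 * γ) ≤ s ^ (1 - 2 * γ) :=
      Real.rpow_le_rpow (norm_nonneg _) h1 (by linarith)
    have h4 : ‖selfCommutator (T j)‖ ^ γ ≤ ‖selfCommutator S‖ ^ γ :=
      Real.rpow_le_rpow (norm_nonneg _) h2 hγ.le
    gcongr
  choose X hXn hXd using hX
  set conj := U.symm.conjStarAlgEquiv with hconj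
  have happ : ∀ Z x, conj Z x = U.symm (Z (U x)) := fun Z x => rfl
  have hST : S = conj (directSum T) := by
    refine ext_orthonormalBasis b fun q => ?_
    have := directSum_basis (fun j => EuclideanSpace.basisFun (Fin (n j)) ℂ) T q
      (hTw q.1 q.2)
    rw [happ, hUb, this, map_smul, ← hB, hUB, hS q]
    rfl
  have hAconj : A = conj (directSum fun j =>
      ν j • ContinuousLinearMap.id ℂ (EuclideanSpace ℂ (Fin (n j)))) := by
    refine ext_orthonormalBasis b fun q => ?_
    have := directSum_basis (fun j => EuclideanSpace.basisFun (Fin (n j)) ℂ)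
      (fun j => ν j • ContinuousLinearMap.id ℂ (EuclideanSpace ℂ (Fin (n j)))) q
      (c := ν q.1) (i := q.2) (by simp)
    rw [happ, hUb, this, map_smul, ← hB, hUB, hA q]
    rfl
  have hCpos : 0 ≤ C * s ^ (1 - 2 * γ) * ‖selfCommutator S‖ ^ γ := by positivity
  refine ⟨conj (directSum X), ?_, ?_, ?_⟩
  · have := isStarNormal_directSum X hXn
    exact ⟨by
      have h1 : star (conj (directSum X)) = conj (star (directSum X)) := (conj.map_star' _).symm
      rw [h1]
      exact (this.star_comm_self).map conj⟩
  · rw [hAconj]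
    refine Commute.map ?_ conj
    rw [Commute, SemiconjBy, directSum_mul, directSum_mul]
    congr 1
    funext j
    ext x
    simp
  · rw [hST, ← map_sub, ← hST, directSum_sub]
    refine ContinuousLinearMap.opNorm_le_bound _ hCpos fun x => ?_
    rw [happ, LinearIsometryEquiv.norm_map, ← U.norm_map x]
    exact (ContinuousLinearMap.le_opNorm _ _).trans
      (by gcongr; exact norm_directSum_le _ hCpos hXd)

end Chains

end GradualExchange

end

noncomputable section

namespace GradualExchange

/-! ### Cutting cycles at zero weights -/

section Segments

variable {ι : Type*} [Finite ι]

/-- Cutting the cycles of a permutation behind every element with a given property, and closing up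
the pieces. -/
theorem exists_segment_perm (π : Equiv.Perm ι) (Z : ι → Prop) (hZ : ∀ q, ∃ k : ℕ, Z (π^[k] q)) :
    ∃ ρ : Equiv.Perm ι, (∀ q, ¬ Z q → ρ q = π q) ∧ (∀ q, ∃ k : ℕ, Z (ρ^[k] q)) ∧
      ∀ μ : ι → ℝ, (∀ q, ¬ Z q → μ (π q) = μ q) → ∀ q, μ (ρ q) = μ q := by
  classical
  set nz : ι → ℕ := fun q => Nat.find (hZ q) with hnz
  have hnz1 : ∀ q, Z (π^[nz q] q) := fun q => Nat.find_spec (hZ q)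
  have hnz2 : ∀ q i, i < nz q → ¬ Z (π^[i] q) := fun q i hi => Nat.find_min (hZ q) hi
  -- The witness is the first element of the piece that ends at `q`. That `q` is recovered from it
  -- gives injectivity; that its predecessor satisfies `Z` keeps it apart from the values of `π` off
  -- `Z`.
  have hback : ∀ q, ∃ x, Z q → Z (π.symm x) ∧ π^[nz x] x = q := by
    intro q
    by_cases hq : Z q
    swap
    · exact ⟨q, fun h => absurd h hq⟩
    have hex : ∃ k : ℕ, Z (π.symm^[k + 1] q) := by
      obtain ⟨n, hn, hper⟩ := Function.Injective.mem_periodicPts π.symm.injective q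
      refine ⟨n - 1, ?_⟩
      rw [Nat.sub_add_cancel hn]
      rwa [hper.eq]
    have hinv : Function.LeftInverse π π.symm := π.apply_symm_apply
    set j := Nat.find hex with hj
    have hj1 : Z (π.symm^[j + 1] q) := Nat.find_spec hex
    have hj2 : ∀ i, i < j → ¬ Z (π.symm^[i + 1] q) := fun i hi => Nat.find_min hex hi
    have hfwd : ∀ i, i ≤ j → π^[i] (π.symm^[j] q) = π.symm^[j - i] q := by
      intro i hi
      have : π.symm^[j] q = π.symm^[i] (π.symm^[j - i] q) := by
        rw [← Function.iterate_add_apply, Nat.add_sub_cancel' hi]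
      rw [this]
      exact hinv.iterate i _
    have hnzx : nz (π.symm^[j] q) = j := by
      rw [hnz]
      refine (Nat.find_eq_iff _).mpr ⟨?_, fun i hi => ?_⟩
      · rw [hfwd j le_rfl, Nat.sub_self]; exact hq
      · rw [hfwd i hi.le]
        have := hj2 (j - i - 1) (by omega)
        rwa [show j - i - 1 + 1 = j - i by omega] at this
    refine ⟨π.symm^[j] q, fun _ => ⟨?_, ?_⟩⟩
    · rwa [← Function.iterate_succ_apply' π.symm]
    · rw [hnzx, hfwd j le_rfl, Nat.sub_self]; rfl
  choose back hback using hback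
  set r : ι → ι := fun q => if Z q then back q else π q with hr
  have hr1 : ∀ q, Z q → r q = back q := fun q hq => by simp only [hr]; rw [if_pos hq]
  have hr2 : ∀ q, ¬ Z q → r q = π q := fun q hq => by simp only [hr]; rw [if_neg hq]
  have hinj : Function.Injective r := by
    intro q q' h
    by_cases hq : Z q <;> by_cases hq' : Z q'
    · rw [hr1 q hq, hr1 q' hq'] at h
      rw [← (hback q hq).2, h, (hback q' hq').2]
    · rw [hr1 q hq, hr2 q' hq'] at h
      have := (hback q hq).1
      rw [h, π.symm_apply_apply] at this
      exact absurd this hq'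
    · rw [hr2 q hq, hr1 q' hq'] at h
      have := (hback q' hq').1
      rw [← h, π.symm_apply_apply] at this
      exact absurd this hq
    · rw [hr2 q hq, hr2 q' hq'] at h
      exact π.injective h
  refine ⟨Equiv.ofBijective r (Finite.injective_iff_bijective.mp hinj), hr2, fun q => ?_,
    fun μ hμ q => ?_⟩
  · have hit : ∀ k, k ≤ nz q → r^[k] q = π^[k] q := by
      intro k hk
      induction k with
      | zero => rfl
      | succ k ih =>
        rw [Function.iterate_succ_apply', ih (by omega), hr2 _ (hnz2 q k (by omega)),
          Function.iterate_succ_apply']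
    refine ⟨nz q, ?_⟩
    have : (⇑(Equiv.ofBijective r (Finite.injective_iff_bijective.mp hinj)))^[nz q] q =
        r^[nz q] q := rfl
    rw [this, hit _ le_rfl]
    exact hnz1 q
  · change μ (r q) = μ q
    by_cases hq : Z q
    · rw [hr1 q hq]
      obtain ⟨-, h2⟩ := hback q hq
      have hit : ∀ k, k ≤ nz (back q) → μ (π^[k] (back q)) = μ (back q) := by
        intro k hk
        induction k with
        | zero => rfl
        | succ k ih =>
          rw [Function.iterate_succ_apply', hμ _ (hnz2 _ k (by omega)), ih (by omega)]
      have := hit _ le_rfl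
      rw [h2] at this
      exact this.symm
    · rw [hr2 q hq, hμ q hq]

end Segments

/-! ### From a direct sum of shifts to nearby normal operators -/

section Conclusion

variable {E : Type*} [NormedAddCommGroup E] [InnerProductSpace ℂ E]
variable {ι : Type*} [Fintype ι]

/-- A weighted permutation with sufficiently many zero weights that commutes with a diagonal
operator is a direct sum of weighted shifts with nonnegative weights, such that the diagonal
operator is constant on the chains. -/
theorem IsWeightedPerm.exists_chains {f : OrthonormalBasis ι ℂ E} {π : Equiv.Perm ι} {w μ : ι → ℝ}
    {S A : E →L[ℂ] E} (hS : IsWeightedPerm f π (fun q => (w q : ℂ)) S)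
    (hA : IsWeightedPerm f (Equiv.refl ι) (fun q => (μ q : ℂ)) A)
    (hμ : ∀ q, w q ≠ 0 → μ (π q) = μ q) (h0 : ∀ q, ∃ k : ℕ, w (π^[k] q) = 0) :
    ∃ (p : ℕ) (n : Fin p → ℕ) (b : OrthonormalBasis (Σ j, Fin (n j)) ℂ E)
      (c : (Σ j, Fin (n j)) → ℝ) (ν : Fin p → ℝ), IsRealBasis f b ∧ (∀ q, 0 ≤ c q) ∧
      IsWeightedPerm b (Equiv.sigmaCongrRight fun j => finRotate (n j)) (fun q => (c q : ℂ)) S ∧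
      (∀ q : Σ j, Fin (n j), (q.2 : ℕ) + 1 = n q.1 → c q = 0) ∧
      IsWeightedPerm b (Equiv.refl _) (fun q => (ν q.1 : ℂ)) A := by
  obtain ⟨ρ, hρ1, hρ2, hρ3⟩ := exists_segment_perm π (fun q => w q = 0) h0
  have hSρ : IsWeightedPerm f ρ (fun q => (w q : ℂ)) S := by
    intro q
    by_cases hq : w q = 0
    · rw [hS q]; simp [hq]
    · rw [hρ1 q hq]; exact hS q
  obtain ⟨b', hb', hu, hreal⟩ := hSρ.exists_nonneg (by simpa using hρ2)
  obtain ⟨p, n, φ, hφ, hrot, hlast⟩ := hb'.exists_reindex (fun q => w q = 0) hρ2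
  have hconst : ∀ (j : Fin p) (i : ℕ) (hi : i < n j) (hj : 0 < n j),
      μ (φ ⟨j, ⟨i, hi⟩⟩) = μ (φ ⟨j, ⟨0, hj⟩⟩) := by
    intro j i hi hj
    induction i with
    | zero => rfl
    | succ i ih =>
      rw [← ih (by omega)]
      have := hrot ⟨j, ⟨i, by omega⟩⟩
      simp only at this
      rw [finRotate_of_lt (by simpa using hi)] at this
      rw [this, hρ3 μ hμ]
  refine ⟨p, n, b'.reindex φ.symm, fun q => ‖(w (φ q) : ℂ)‖,
    fun j => if hj : 0 < n j then μ (φ ⟨j, ⟨0, hj⟩⟩) else 0, ?_, fun q => norm_nonneg _, hφ, ?_, ?_⟩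
  · exact (hreal (by simp)).reindex _
  · intro q hq
    simpa using hlast q hq
  · intro q
    obtain ⟨u, hu⟩ := hu (φ q)
    have hq := hA (φ q)
    have hj : 0 < n q.1 := (Nat.zero_le _).trans_lt q.2.2
    have hμq := hconst q.1 q.2 q.2.2 hj
    simp only [dif_pos hj, ← hμq]
    simp only [Equiv.refl_apply] at hq ⊢
    simp only [OrthonormalBasis.reindex_apply, Equiv.symm_symm, hu, map_smul, hq]
    rw [smul_comm]

theorem IsWeightedPerm.isEigenbasis {b : OrthonormalBasis ι ℂ E} {μ : ι → ℂ} {A : E →L[ℂ] E}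
    (hA : IsWeightedPerm b (Equiv.refl ι) μ A) : IsEigenbasis b A := fun q => ⟨μ q, hA q⟩

/-- The consequences of the gradual exchange: normal operators near a direct sum of weighted
shifts. -/
theorem shiftSum_conclusion [CompleteSpace E] {κ : Type*} [Fintype κ] {f : OrthonormalBasis ι ℂ E}
    {B : OrthonormalBasis κ ℂ E} {π : Equiv.Perm ι}
    {w μ : ι → ℝ} {S A : E →L[ℂ] E} {s : ℝ} {R : Prop}
    (hS : IsWeightedPerm f π (fun q => (w q : ℂ)) S)
    (hA : IsWeightedPerm f (Equiv.refl ι) (fun q => (μ q : ℂ)) A)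
    (hμ : ∀ q, w q ≠ 0 → μ (π q) = μ q) (h0 : ∀ q, ∃ k : ℕ, w (π^[k] q) = 0)
    (hs : ‖S‖ ≤ s) (hR : R → IsRealBasis B f) :
    IsSelfAdjoint A ∧ Commute A S ∧ ShiftSumInEigenbasis A S ∧
      (∀ γ C : ℝ, 0 < γ → 0 < C → NormalApproximationConstants γ C →
        ∃ S'' : E →L[ℂ] E, IsStarNormal S'' ∧ Commute A S'' ∧
          BilateralShiftSumInEigenbasis A S'' ∧
          ‖S'' - S‖ ≤ C * s ^ (1 - 2 * γ) * ‖selfCommutator S‖ ^ γ) ∧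
      (∃ S'' : E →L[ℂ] E, IsStarNormal S'' ∧ Commute A S'' ∧
          BilateralShiftSumInEigenbasis A S'' ∧
          ‖S'' - S‖ ≤ 5.3308 * s ^ (1 - 2 * (1 / 3) : ℝ) *
            ‖selfCommutator S‖ ^ (1 / 3 : ℝ)) ∧
      (R → RealShiftSumInEigenbasis B A S ∧
        ∃ S'' : E →L[ℂ] E, IsStarNormal S'' ∧ Commute A S'' ∧ IsRealOperator B S'' ∧
          RealBilateralShiftSumInEigenbasis B A S'' ∧
          ‖S'' - S‖ ≤ 5.3308 * s ^ (1 - 2 * (1 / 3) : ℝ) *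
            ‖selfCommutator S‖ ^ (1 / 3 : ℝ)) := by
  have : FiniteDimensional ℂ E := f.toBasis.finiteDimensional_of_finite
  have hs0 : 0 ≤ s := (norm_nonneg _).trans hs
  obtain ⟨p, n, b, c, ν, hbreal, hc0, hSb, hclast, hAb⟩ := hS.exists_chains hA hμ h0
  have hAsa : IsSelfAdjoint A := hA.isSelfAdjoint
  have hcommS : Commute A S := hS.commute hA fun q hq => by
    have : w q ≠ 0 := by simpa using hq
    rw [hμ q this]
  have hcn : ∀ q, ‖(c q : ℂ)‖ = c q := fun q => by
    rw [Complex.norm_real, Real.norm_eq_abs, abs_of_nonneg (hc0 q)]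
  obtain ⟨X, hXτ, hXperm, hXW⟩ := exists_normal_exchange (C := s) (ε := ‖selfCommutator S‖) hs0
    (norm_nonneg _) hc0 (fun q => by rw [← hcn]; exact (hSb.norm_weight_le q).trans hs) hclast
    (fun q => by
      have := hSb.abs_sub_le_norm_selfCommutator q
      rw [hcn, hcn] at this
      exact this)
  set S'' : E →L[ℂ] E := weightedPerm (X.basis b) X.perm (fun q => (X.weight q : ℂ)) with hS''
  have hSw : IsWeightedPerm (X.basis b) X.perm (fun q => (X.weight q : ℂ)) S'' :=
    isWeightedPerm_weightedPerm _ _ _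
  have hnormal : IsStarNormal S'' := hSw.isStarNormal fun q => by
    simp only [Complex.norm_real, Real.norm_eq_abs, X.abs_weight, hXW]
  have hAX : IsWeightedPerm (X.basis b) (Equiv.refl _) (fun q => (ν q.1 : ℂ)) A :=
    X.isWeightedPerm_basis b hAb fun q => by rw [hXτ]
  have hcommS'' : Commute A S'' := hSw.commute hAX fun q _ => by rw [hXperm]
  have hdist : ‖S'' - S‖ ≤ 5.3308 * s ^ (1 - 2 * (1 / 3) : ℝ) *
      ‖selfCommutator S‖ ^ (1 / 3 : ℝ) := X.norm_sub_le b (by positivity) hSb hSw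
  -- No zero weight is asked for: the new cycles have constant modulus and may be genuinely
  -- bilateral.
  obtain ⟨p', n', φ, hφ, -, -⟩ := hSw.exists_reindex (fun _ => True) fun _ => ⟨0, trivial⟩
  refine ⟨hAsa, hcommS, ⟨p, n, b, _, hAb.isEigenbasis, hSb.isShiftSum fun q hq => by
    simp [hclast q hq]⟩, fun γ C hγ hC h => ?_, ⟨S'', hnormal, hcommS'',
    bilateralShiftSumInEigenbasis_of_commute hAsa hnormal hcommS'', hdist⟩, fun hr => ⟨?_, S'',
    hnormal, hcommS'', ?_, ?_, hdist⟩⟩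
  · obtain ⟨Y, hY1, hY2, hY3⟩ := exists_normal_of_constants hSb (ν := fun j => (ν j : ℂ)) hAb hs hγ hC h
    exact ⟨Y, hY1, hY2, bilateralShiftSumInEigenbasis_of_commute hAsa hY1 hY2, hY3⟩
  · exact ⟨p, n, b, c, (hR hr).trans hbreal, hAb.isEigenbasis, hSb.isShiftSum fun q hq => by
      simp [hclast q hq]⟩
  · exact hSw.isRealOperator (((hR hr).trans hbreal).trans (X.isRealBasis b)) (by simp)
  · refine ⟨p', n', (X.basis b).reindex φ.symm, fun x => X.weight (φ x),
      (((hR hr).trans hbreal).trans (X.isRealBasis b)).reindex _, fun x => ⟨ν (φ x).1, ?_⟩,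
      hφ.isBilateralShiftSum⟩
    simpa using hAX (φ x)

end Conclusion

end GradualExchange

end

noncomputable section

namespace GradualExchange

/-! ### The checkerboard of exchanges in one window -/

section LocalPattern

/-- In the `t`-th block of a window with `M` rows, the rows `j` and `j + 1` are exchanged. -/
def IsLower (M j t : ℤ) : Prop := 0 ≤ j ∧ j + 1 ≤ t ∧ (t + j) % 2 = 1 ∧ t + j ≤ 2 * M - 3

/-- Row `j` is cut behind the `s`-th place of the `t`-th block. -/
def IsCut (M N j t s : ℤ) : Prop :=
  j = 0 ∧ ((t = 0 ∧ s = N) ∨ (2 ≤ t ∧ t % 2 = 0 ∧ s = 0 ∧ t ≤ 2 * M - 2))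

/-- The path in row `j` at the `s`-th place of the `t`-th block enters the window from the left. -/
def IsLeftPart (M j t s : ℤ) : Prop :=
  t ≤ j ∨ ((t + j) % 2 = 0 ∧ t + j ≤ 2 * M - 2 ∧ ¬ (j = 0 ∧ 1 ≤ s))

/-- With the next three lemmas: being on the left is preserved along every path that is not cut, be
it inside a block, from block to block in an idle row, or across an exchange in either direction. A
left path either still waits (t ≤ j) or has an even sum t + j, which stays constant while it moves
to row 0. -/
theorem isLeftPart_inside {M N j t s : ℤ} (hs : 0 ≤ s) (hj : 0 ≤ j)
    (hc : ¬ IsCut M N j t s) : IsLeftPart M j t (s + 1) ↔ IsLeftPart M j t s := by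
  unfold IsLeftPart IsCut at *
  omega

theorem isLeftPart_idle {M N j t : ℤ} (hN : 1 ≤ N) (hj : 0 ≤ j) (hjM : j < M)
    (hc : ¬ IsCut M N j t N) (h1 : ¬ IsLower M j t) (h2 : ¬ IsLower M (j - 1) t) :
    IsLeftPart M j (t + 1) 0 ↔ IsLeftPart M j t N := by
  unfold IsLeftPart IsCut IsLower at *
  omega

theorem isLeftPart_lower {M N j t : ℤ} (h1 : IsLower M j t) :
    IsLeftPart M (j + 1) (t + 1) 0 ↔ IsLeftPart M j t N := by
  unfold IsLeftPart IsLower at *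
  omega

theorem isLeftPart_upper {M N j t : ℤ} (hN : 1 ≤ N) (h2 : IsLower M (j - 1) t) :
    IsLeftPart M (j - 1) (t + 1) 0 ↔ IsLeftPart M j t N := by
  unfold IsLeftPart IsLower at *
  omega

end LocalPattern

/-! ### Windows of indices and their blocks -/

section Windows

variable {m K : ℕ} {lo hi : Fin m → ℤ}

/-- Windows `[first κ, last κ]` of indices. The rows from `base κ` on contain the window `κ`. -/
structure WindowData (K : ℕ) (lo hi : Fin m → ℤ) where
  /-- the window of an index -/
  win : ℤ → Fin K
  /-- the first index of a window -/
  first : Fin K → ℤ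
  /-- the last index of a window -/
  last : Fin K → ℤ
  /-- the number of steps of a rotation -/
  N : Fin K → ℤ
  /-- the first row that contains the window -/
  base : Fin K → Fin m
  mem : ∀ r i, lo r ≤ i → i ≤ hi r → first (win i) ≤ i ∧ i ≤ last (win i)
  win_eq : ∀ κ i, first κ ≤ i → i ≤ last κ → win i = κ
  succ : ∀ r i, lo r ≤ i → i + 1 ≤ hi r → win (i + 1) ≠ win i → (win (i + 1) : ℕ) = win i + 1
  base_le : ∀ κ r, base κ ≤ r ↔ lo r ≤ first κ ∧ last κ ≤ hi r
  N_pos : ∀ κ, 1 ≤ N κ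
  card : ∀ κ, max 3 ((2 * ((m : ℤ) - (base κ : ℕ)) - 3) * (N κ + 1) + 4) ≤ last κ - first κ + 1

namespace WindowData

variable (D : WindowData K lo hi)

/-- the number of rows that contain the window -/
def M (κ : Fin K) : ℤ := (m : ℤ) - (D.base κ : ℕ)

/-- the number of the block that contains an index -/
def t (i : ℤ) : ℤ := (i - D.first (D.win i) + D.N (D.win i) - 1) / (D.N (D.win i) + 1)

/-- the place of an index in its block -/
def s (i : ℤ) : ℤ := (i - D.first (D.win i) + D.N (D.win i) - 1) % (D.N (D.win i) + 1)

theorem s_bounds (i : ℤ) : 0 ≤ D.s i ∧ D.s i ≤ D.N (D.win i) := by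
  have := D.N_pos (D.win i)
  refine ⟨Int.emod_nonneg _ (by omega), ?_⟩
  have := Int.emod_lt_of_pos (i - D.first (D.win i) + D.N (D.win i) - 1)
    (show 0 < D.N (D.win i) + 1 by omega)
  exact Int.lt_add_one_iff.mp this

theorem t_mul_add_s (i : ℤ) : D.t i * (D.N (D.win i) + 1) + D.s i =
    i - D.first (D.win i) + D.N (D.win i) - 1 := by
  rw [mul_comm]
  exact Int.mul_ediv_add_emod _ _

theorem t_s_unique {i t s : ℤ} (hs : 0 ≤ s) (hsN : s ≤ D.N (D.win i))
    (h : t * (D.N (D.win i) + 1) + s = i - D.first (D.win i) + D.N (D.win i) - 1) :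
    D.t i = t ∧ D.s i = s := by
  have := D.N_pos (D.win i)
  refine (Int.ediv_emod_unique (by omega)).mpr ⟨by rw [← h]; ring, hs, by omega⟩

theorem step {i : ℤ} (h : D.win (i + 1) = D.win i) :
    (D.s i < D.N (D.win i) ∧ D.t (i + 1) = D.t i ∧ D.s (i + 1) = D.s i + 1) ∨
    (D.s i = D.N (D.win i) ∧ D.t (i + 1) = D.t i + 1 ∧ D.s (i + 1) = 0) := by
  have h1 := D.s_bounds i
  have h2 := D.t_mul_add_s i
  have h3 := D.N_pos (D.win i)
  rcases h1.2.lt_or_eq with h4 | h4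
  · refine Or.inl ⟨h4, D.t_s_unique (by omega) (by rw [h]; omega) ?_⟩
    rw [h]; linarith
  · refine Or.inr ⟨h4, D.t_s_unique le_rfl (by rw [h]; omega) ?_⟩
    rw [h]; rw [h4] at h2; linarith

/-- The offset N - 1 leaves two indices in block 0, so that row 0 can be cut behind the second one
while the first place of a window stays uncut. -/
theorem at_first {i : ℤ} (h : i = D.first (D.win i)) :
    D.t i = 0 ∧ D.s i = D.N (D.win i) - 1 := by
  have h3 := D.N_pos (D.win i)
  exact D.t_s_unique (by omega) (by omega) (by rw [← h]; ring)

theorem M_pos (κ : Fin K) : 1 ≤ D.M κ := by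
  have := (D.base κ).2
  unfold M; omega

/-- Uses the size of the window: two indices of block 0, then 2M - 3 full blocks, the index of the
last cut, and one more. For M = 1 the bound 3 takes over. -/
theorem at_last {i : ℤ} (h : i = D.last (D.win i)) :
    2 * D.M (D.win i) - 2 ≤ D.t i ∧ (D.t i = 2 * D.M (D.win i) - 2 → 1 ≤ D.s i) ∧ 1 ≤ D.t i := by
  have h1 := D.s_bounds i
  have h2 := D.t_mul_add_s i
  have h3 := D.N_pos (D.win i)
  have h4 := D.card (D.win i)
  rw [← h] at h4
  change max 3 ((2 * D.M (D.win i) - 3) * (D.N (D.win i) + 1) + 4) ≤ _ at h4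
  have h5 := (le_max_left _ _).trans h4
  have h6 := (le_max_right _ _).trans h4
  generalize D.M (D.win i) = M at *
  generalize D.N (D.win i) = N at *
  generalize D.t i = t at *
  generalize D.s i = s at *
  refine ⟨?_, fun ht => ?_, ?_⟩
  · by_contra hcon
    have : t ≤ 2 * M - 3 := by omega
    nlinarith
  · rw [ht] at h2
    nlinarith
  · by_contra hcon
    have : t ≤ 0 := by omega
    nlinarith

variable {D}

theorem lt_last_of_isLower {i j : ℤ} {r : Fin m} (h1 : lo r ≤ i) (h2 : i ≤ hi r)
    (h : IsLower (D.M (D.win i)) j (D.t i)) : i < D.last (D.win i) := by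
  refine lt_of_le_of_ne (D.mem r i h1 h2).2 fun heq => ?_
  have := D.at_last heq
  unfold IsLower at h
  omega

theorem win_succ_of_lt_last {i : ℤ} {r : Fin m} (h1 : lo r ≤ i) (h2 : i ≤ hi r)
    (h : i < D.last (D.win i)) : D.win (i + 1) = D.win i :=
  D.win_eq _ _ (by have := (D.mem r i h1 h2).1; omega) (by omega)

theorem boundary {i : ℤ} {r : Fin m} (h1 : lo r ≤ i) (h2 : i + 1 ≤ hi r)
    (h : D.win (i + 1) ≠ D.win i) :
    i = D.last (D.win i) ∧ i + 1 = D.first (D.win (i + 1)) := by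
  have h3 := D.mem r i h1 (by omega)
  have h4 := D.mem r (i + 1) (by omega) h2
  constructor
  · by_contra hne
    exact h (win_succ_of_lt_last h1 (by omega) (lt_of_le_of_ne h3.2 hne))
  · by_contra hne
    exact h (D.win_eq _ i (by omega) (by omega)).symm

end WindowData

end Windows

/-! ### Cyclic shift of a row -/

section Rows

/-- The cyclic successor in an interval of integers. -/
def rowRotate (l u : ℤ) : Equiv.Perm (Set.Icc l u) where
  toFun i := if h : (i : ℤ) + 1 ≤ u then ⟨i + 1, by have := i.2.1; omega, h⟩
    else ⟨l, le_rfl, i.2.1.trans i.2.2⟩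
  invFun i := if h : l ≤ (i : ℤ) - 1 then ⟨i - 1, h, by have := i.2.2; omega⟩
    else ⟨u, i.2.1.trans i.2.2, le_rfl⟩
  left_inv := by
    rintro ⟨i, h1, h2⟩
    by_cases h : i + 1 ≤ u
    · simp [h, h1]
    · have : i = u := by omega
      subst this
      simp
  right_inv := by
    rintro ⟨i, h1, h2⟩
    by_cases h : l ≤ i - 1
    · simp [h, h2]
    · have : i = l := by omega
      subst this
      simp

theorem coe_rowRotate {l u : ℤ} (i : Set.Icc l u) :
    (rowRotate l u i : ℤ) = if (i : ℤ) + 1 ≤ u then (i : ℤ) + 1 else l := by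
  simp only [rowRotate, Equiv.coe_fn_mk]
  split_ifs <;> rfl

end Rows

end GradualExchange

end

noncomputable section

namespace GradualExchange

/-! ### Places in the table and their partners -/

section Positions

variable {m K : ℕ} {lo hi : Fin m → ℤ}

/-- The places of the rows. -/
abbrev Pos (lo hi : Fin m → ℤ) := Σ r : Fin m, Set.Icc (lo r) (hi r)

theorem Pos.ext_iff' {q q' : Pos lo hi} : q = q' ↔ (q.1 : ℕ) = q'.1 ∧ (q.2 : ℤ) = q'.2 := by
  constructor
  · rintro rfl; exact ⟨rfl, rfl⟩
  · rintro ⟨h1, h2⟩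
    obtain ⟨r, i, hi⟩ := q
    obtain ⟨r', i', hi'⟩ := q'
    have : r = r' := Fin.ext h1
    subst this
    simp only at h2
    subst h2
    rfl

/-- The cyclic shift in every row. -/
def rot (lo hi : Fin m → ℤ) : Equiv.Perm (Pos lo hi) :=
  Equiv.sigmaCongrRight fun r => rowRotate (lo r) (hi r)

theorem rot_fst (q : Pos lo hi) : (rot lo hi q).1 = q.1 := rfl

theorem rot_snd (q : Pos lo hi) : ((rot lo hi q).2 : ℤ) =
    if (q.2 : ℤ) + 1 ≤ hi q.1 then (q.2 : ℤ) + 1 else lo q.1 := coe_rowRotate q.2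

namespace WindowData

variable (D : WindowData K lo hi) (q : Pos lo hi)

/-- The number of the row, counted from the first row that contains the window. -/
def row : ℤ := ((q.1 : ℕ) : ℤ) - (D.base (D.win q.2) : ℕ)

/-- Places that are rotated with the next row. -/
def Lower : Prop := IsLower (D.M (D.win q.2)) (D.row q) (D.t q.2)

/-- Places that are rotated with the previous row. -/
def Upper : Prop := IsLower (D.M (D.win q.2)) (D.row q - 1) (D.t q.2)

/-- Places behind which the row is cut. -/
def Cut : Prop := IsCut (D.M (D.win q.2)) (D.N (D.win q.2)) (D.row q) (D.t q.2) (D.s q.2)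

/-- Places that are connected to the left end of the window. -/
def Left : Prop := (0 ≤ D.row q ∧ IsLeftPart (D.M (D.win q.2)) (D.row q) (D.t q.2) (D.s q.2)) ∨
  (D.row q < 0 ∧ lo q.1 ≤ D.first (D.win q.2))

variable {D q}

theorem not_lower_and_upper (h1 : D.Lower q) (h2 : D.Upper q) : False := by
  unfold Lower Upper IsLower at *
  omega

theorem not_cut_of_lower (h1 : D.Lower q) : ¬ D.Cut q := by
  unfold Lower Cut IsLower IsCut at *
  omega

theorem not_cut_of_upper (h1 : D.Upper q) : ¬ D.Cut q := by
  unfold Upper Cut IsLower IsCut at *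
  omega

theorem row_nonneg_iff : 0 ≤ D.row q ↔
    lo q.1 ≤ D.first (D.win q.2) ∧ D.last (D.win q.2) ≤ hi q.1 := by
  rw [← D.base_le, Fin.le_def]
  unfold row
  omega

theorem row_lt : D.row q < D.M (D.win q.2) := by
  have := q.1.2
  unfold row M
  omega

theorem row_nonneg_of_active (h : D.Lower q ∨ D.Upper q) : 0 ≤ D.row q := by
  unfold Lower Upper IsLower at h
  omega

theorem lt_last_of_active (h : D.Lower q ∨ D.Upper q) : (q.2 : ℤ) < D.last (D.win q.2) := by
  rcases h with h | h <;> exact lt_last_of_isLower q.2.2.1 q.2.2.2 h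

theorem lt_hi_of_active (h : D.Lower q ∨ D.Upper q) : (q.2 : ℤ) + 1 ≤ hi q.1 := by
  have h1 := lt_last_of_active h
  have h2 := (row_nonneg_iff.mp (row_nonneg_of_active h)).2
  omega

/-- The next row contains the index because the intervals are nested; the previous row contains it
because it is not before the base row and therefore contains the whole window. -/
theorem exists_partner (hlo : Antitone lo) (hhi : Monotone hi) (q : Pos lo hi) :
    ∃ q' : Pos lo hi, (q'.2 : ℤ) = q.2 ∧ (D.Lower q → D.row q' = D.row q + 1) ∧
      (D.Upper q → D.row q' = D.row q - 1) ∧ (¬ D.Lower q → ¬ D.Upper q → q' = q) := by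
  by_cases h1 : D.Lower q
  · have hm : (q.1 : ℕ) + 1 < m := by
      unfold Lower IsLower row M at h1
      omega
    have hle : q.1 ≤ ⟨(q.1 : ℕ) + 1, hm⟩ := Fin.le_def.mpr (Nat.le_succ _)
    refine ⟨⟨⟨(q.1 : ℕ) + 1, hm⟩, ⟨q.2, (hlo hle).trans q.2.2.1, q.2.2.2.trans (hhi hle)⟩⟩, rfl,
      fun _ => ?_, fun h2 => (not_lower_and_upper h1 h2).elim, fun h => absurd h1 h⟩
    simp only [row]; push_cast; ring
  · by_cases h2 : D.Upper q
    · have hb : (D.base (D.win q.2) : ℕ) + 1 ≤ q.1 := by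
        unfold Upper IsLower row at h2
        omega
      set r : Fin m := ⟨(q.1 : ℕ) - 1, by have := q.1.2; omega⟩ with hr
      have hbr : D.base (D.win q.2) ≤ r := Fin.le_def.mpr (by simp only [hr]; omega)
      obtain ⟨h3, h4⟩ := (D.base_le _ _).mp hbr
      have h5 := D.mem q.1 q.2 q.2.2.1 q.2.2.2
      refine ⟨⟨r, ⟨q.2, h3.trans h5.1, h5.2.trans h4⟩⟩, rfl, fun h => absurd h h1, fun _ => ?_,
        fun _ h => absurd h2 h⟩
      simp only [row, hr]
      omega
    · exact ⟨q, rfl, fun h => absurd h h1, fun h => absurd h h2, fun _ _ => rfl⟩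

/-- The place that a place is rotated with. -/
def partner (D : WindowData K lo hi) (hlo : Antitone lo) (hhi : Monotone hi) (q : Pos lo hi) :
    Pos lo hi := (exists_partner (D := D) hlo hhi q).choose

variable (hlo : Antitone lo) (hhi : Monotone hi)

theorem partner_snd : ((D.partner hlo hhi q).2 : ℤ) = q.2 :=
  (exists_partner (D := D) hlo hhi q).choose_spec.1

theorem row_partner_of_lower (h : D.Lower q) : D.row (D.partner hlo hhi q) = D.row q + 1 :=
  (exists_partner (D := D) hlo hhi q).choose_spec.2.1 h

theorem row_partner_of_upper (h : D.Upper q) : D.row (D.partner hlo hhi q) = D.row q - 1 :=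
  (exists_partner (D := D) hlo hhi q).choose_spec.2.2.1 h

theorem partner_of_idle (h : ¬ (D.Lower q ∨ D.Upper q)) : D.partner hlo hhi q = q :=
  (exists_partner (D := D) hlo hhi q).choose_spec.2.2.2 (fun h' => h (Or.inl h'))
    (fun h' => h (Or.inr h'))

theorem eq_of_row_eq {q' : Pos lo hi} (h1 : D.row q = D.row q') (h2 : (q.2 : ℤ) = q'.2) :
    q = q' := by
  refine Pos.ext_iff'.mpr ⟨?_, h2⟩
  unfold row at h1
  rw [h2] at h1
  omega

theorem upper_partner (h : D.Lower q) : D.Upper (D.partner hlo hhi q) := by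
  have h1 := row_partner_of_lower hlo hhi h
  unfold Upper
  rw [h1, partner_snd, add_sub_cancel_right]
  exact h

theorem lower_partner (h : D.Upper q) : D.Lower (D.partner hlo hhi q) := by
  have h1 := row_partner_of_upper hlo hhi h
  unfold Lower
  rw [h1, partner_snd]
  exact h

theorem active_partner (h : D.Lower q ∨ D.Upper q) :
    D.Lower (D.partner hlo hhi q) ∨ D.Upper (D.partner hlo hhi q) :=
  h.elim (fun h => Or.inr (upper_partner hlo hhi h)) (fun h => Or.inl (lower_partner hlo hhi h))

theorem partner_involutive : Function.Involutive (D.partner hlo hhi) := by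
  intro q
  by_cases h : D.Lower q ∨ D.Upper q
  · apply eq_of_row_eq (D := D) _ (by rw [partner_snd, partner_snd])
    rcases h with h | h
    · rw [row_partner_of_upper hlo hhi (upper_partner hlo hhi h), row_partner_of_lower hlo hhi h]
      ring
    · rw [row_partner_of_lower hlo hhi (lower_partner hlo hhi h), row_partner_of_upper hlo hhi h]
      ring
  · rw [partner_of_idle hlo hhi h, partner_of_idle hlo hhi h]

theorem not_active_at_first (h : (q.2 : ℤ) = D.first (D.win q.2)) :
    ¬ (D.Lower q ∨ D.Upper q) := by
  have h1 := (D.at_first h).1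
  unfold Lower Upper IsLower
  omega

theorem not_cut_at_first (h : (q.2 : ℤ) = D.first (D.win q.2)) : ¬ D.Cut q := by
  have h1 := D.at_first h
  unfold Cut IsCut
  omega

theorem left_at_first (h : (q.2 : ℤ) = D.first (D.win q.2)) : D.Left q := by
  have h1 := D.at_first h
  have h2 := q.2.2.1
  unfold Left IsLeftPart
  rw [← h]
  omega

theorem not_cut_at_last (h : (q.2 : ℤ) = D.last (D.win q.2)) : ¬ D.Cut q := by
  have h1 := D.at_last h
  unfold Cut IsCut
  omega

/-- Together with `left_at_first`, this says that no uncut path crosses a window. -/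
theorem not_left_at_last (h : (q.2 : ℤ) = D.last (D.win q.2)) : ¬ D.Left q := by
  have h1 := D.at_last h
  have hq := q.2.2.2
  have h2 := row_lt (D := D) (q := q)
  have h3 := row_nonneg_iff (D := D) (q := q)
  rw [← h] at h3
  have h4 := D.M_pos (D.win q.2)
  unfold Left IsLeftPart
  omega

/-- The cases for the cyclic successor of a place: it lies in the same window and in the same
block, in the same window at the beginning of the next block, at the beginning of the next window,
or at the beginning of the row. -/
theorem rot_cases (D : WindowData K lo hi) (q : Pos lo hi) :
    ((q.2 : ℤ) + 1 ≤ hi q.1 ∧ ((rot lo hi q).2 : ℤ) = q.2 + 1 ∧ D.win (q.2 + 1) = D.win q.2 ∧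
      D.row (rot lo hi q) = D.row q ∧ ((D.s q.2 < D.N (D.win q.2) ∧
        D.t (q.2 + 1) = D.t q.2 ∧ D.s (q.2 + 1) = D.s q.2 + 1) ∨
      (D.s q.2 = D.N (D.win q.2) ∧ D.t (q.2 + 1) = D.t q.2 + 1 ∧ D.s (q.2 + 1) = 0))) ∨
    ((q.2 : ℤ) + 1 ≤ hi q.1 ∧ ((rot lo hi q).2 : ℤ) = q.2 + 1 ∧
      (D.win (q.2 + 1) : ℕ) = D.win q.2 + 1 ∧ (q.2 : ℤ) = D.last (D.win q.2) ∧
      (q.2 : ℤ) + 1 = D.first (D.win (q.2 + 1))) ∨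
    (hi q.1 ≤ q.2 ∧ ((rot lo hi q).2 : ℤ) = lo q.1) := by
  have hr := rot_snd q
  by_cases h : (q.2 : ℤ) + 1 ≤ hi q.1
  · rw [if_pos h] at hr
    by_cases hw : D.win (q.2 + 1) = D.win q.2
    · refine Or.inl ⟨h, hr, hw, ?_, D.step hw⟩
      unfold row
      rw [hr, hw, rot_fst]
    · obtain ⟨h1, h2⟩ := boundary q.2.2.1 h hw
      exact Or.inr (Or.inl ⟨h, hr, D.succ q.1 q.2 q.2.2.1 h hw, h1, h2⟩)
  · rw [if_neg h] at hr
    exact Or.inr (Or.inr ⟨by omega, hr⟩)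

/-- A place whose successor is rotated by a nonzero angle is rotated with the same row. -/
theorem rot_active (h : D.Lower (rot lo hi q) ∨ D.Upper (rot lo hi q)) :
    D.s (rot lo hi q).2 = 0 ∨ (D.s q.2 < D.N (D.win q.2) ∧ D.win (q.2 + 1) = D.win q.2 ∧
      ((rot lo hi q).2 : ℤ) = q.2 + 1 ∧ D.s (q.2 + 1) = D.s q.2 + 1 ∧
      (D.Lower q ↔ D.Lower (rot lo hi q)) ∧ (D.Upper q ↔ D.Upper (rot lo hi q))) := by
  rcases rot_cases D q with ⟨h1, h2, h3, h4, ⟨h5, h6, h7⟩ | ⟨h5, h6, h7⟩⟩ | ⟨h1, h2, h3, h4, h5⟩ |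
    ⟨h1, h2⟩
  · right
    refine ⟨h5, h3, h2, h7, ?_, ?_⟩
    · unfold Lower; rw [h2, h3, h4, h6]
    · unfold Upper; rw [h2, h3, h4, h6]
  · left; rw [h2, h7]
  · exact absurd h (not_active_at_first (by rw [h2]; exact h5))
  · exfalso
    have h3 := row_nonneg_of_active h
    have h4 : lo q.1 ≤ D.first (D.win (rot lo hi q).2) := (row_nonneg_iff.mp h3).1
    have h5 := (D.mem _ _ (rot lo hi q).2.2.1 (rot lo hi q).2.2.2).1
    exact not_active_at_first (by omega) h

theorem rot_of_active (h : D.Lower q ∨ D.Upper q) :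
    D.win (q.2 + 1) = D.win q.2 ∧ ((rot lo hi q).2 : ℤ) = q.2 + 1 ∧
      D.row (rot lo hi q) = D.row q ∧ ((D.s q.2 < D.N (D.win q.2) ∧
        D.t (q.2 + 1) = D.t q.2 ∧ D.s (q.2 + 1) = D.s q.2 + 1) ∨
      (D.s q.2 = D.N (D.win q.2) ∧ D.t (q.2 + 1) = D.t q.2 + 1 ∧ D.s (q.2 + 1) = 0)) := by
  have hl := lt_last_of_active h
  have hh := lt_hi_of_active h
  have hw := win_succ_of_lt_last q.2.2.1 q.2.2.2 hl
  rcases rot_cases D q with ⟨h1, h2, h3, h4, h5⟩ | ⟨h1, h2, h3, h4, h5⟩ | ⟨h1, h2⟩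
  · exact ⟨h3, h2, h4, h5⟩
  · omega
  · omega

theorem active_rot (h : D.Lower q ∨ D.Upper q) (hs : D.s q.2 < D.N (D.win q.2)) :
    (D.Lower (rot lo hi q) ↔ D.Lower q) ∧ (D.Upper (rot lo hi q) ↔ D.Upper q) ∧
      D.s (rot lo hi q).2 = D.s q.2 + 1 ∧
      D.partner hlo hhi (rot lo hi q) = rot lo hi (D.partner hlo hhi q) := by
  obtain ⟨h1, h2, h3, h4⟩ := rot_of_active h
  obtain ⟨-, h5, h6⟩ : D.s q.2 < D.N (D.win q.2) ∧ D.t (q.2 + 1) = D.t q.2 ∧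
      D.s (q.2 + 1) = D.s q.2 + 1 := by
    rcases h4 with h4 | h4
    · exact h4
    · omega
  have hL : D.Lower (rot lo hi q) ↔ D.Lower q := by unfold Lower; rw [h2, h3, h1, h5]
  have hU : D.Upper (rot lo hi q) ↔ D.Upper q := by unfold Upper; rw [h2, h3, h1, h5]
  refine ⟨hL, hU, by rw [h2, h6], ?_⟩
  obtain ⟨-, h2', h3', -⟩ := rot_of_active (active_partner hlo hhi h)
  refine eq_of_row_eq (D := D) ?_ (by rw [partner_snd, h2, h2', partner_snd])
  rw [h3']
  rcases h with h | h
  · rw [row_partner_of_lower hlo hhi h, row_partner_of_lower hlo hhi (hL.mpr h), h3]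
  · rw [row_partner_of_upper hlo hhi h, row_partner_of_upper hlo hhi (hU.mpr h), h3]

end WindowData

end Positions

end GradualExchange

end

noncomputable section

namespace GradualExchange

/-! ### The exchanges in all windows: weights, commutator, paths -/

section ExchangeOfWindows

variable {m K : ℕ} {lo hi : Fin m → ℤ}

/-- Bounds for nonnegative weights of the rows: in the first row that contains a window, and for
the difference of two neighbouring rows that contain a window. -/
structure WeightBounds (D : WindowData K lo hi) (c : Pos lo hi → ℝ) (M Q κ : ℝ) : Prop where
  nonneg : ∀ q, 0 ≤ c q
  eq_zero : ∀ q, hi q.1 ≤ q.2 → c q = 0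
  base : ∀ q, D.row q = 0 → c q ≤ M ∧ c q ^ 2 ≤ Q
  next : ∀ q q', (q.2 : ℤ) = q'.2 → 0 ≤ D.row q → D.row q' = D.row q + 1 → (q.2 : ℤ) + 1 ≤ hi q.1 →
    |c q' - c q| + Real.pi / (2 * D.N (D.win q.2)) * max (c q) (c q') ≤ M ∧
    κ + 1 / D.N (D.win q.2) * |c q' ^ 2 - c q ^ 2| ≤ Q
  rot : ∀ q, |c (rot lo hi q) ^ 2 - c q ^ 2| ≤ κ
  le : κ ≤ Q
  M_nonneg : 0 ≤ M
  Q_nonneg : 0 ≤ Q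

namespace WindowData

variable (D : WindowData K lo hi) (hlo : Antitone lo) (hhi : Monotone hi) (c : Pos lo hi → ℝ)
  (q : Pos lo hi)

/-- The fraction of the rotation that has been carried out. -/
def ratio : ℝ := D.s q.2 / D.N (D.win q.2)

open Classical in
/-- The weights after the exchange. -/
def newWeight : ℝ := if D.Lower q ∨ D.Upper q then
    √((1 - D.ratio q) * c q ^ 2 + D.ratio q * c (D.partner hlo hhi q) ^ 2)
  else if D.Cut q then 0 else c q

open Classical in
/-- The angles of rotation. -/
def angle : ℝ := if D.Lower q then D.ratio q * (Real.pi / 2)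
  else if D.Upper q then -(D.ratio q * (Real.pi / 2)) else 0

/-- The places where paths are exchanged. -/
def lastPlaces : Set (Pos lo hi) := {q | (D.Lower q ∨ D.Upper q) ∧ D.s q.2 = D.N (D.win q.2)}

variable {D q}

theorem N_cast_pos (κ : Fin K) : (0 : ℝ) < D.N κ := by
  have := D.N_pos κ
  exact_mod_cast (by omega : 0 < D.N κ)

theorem ratio_nonneg : 0 ≤ D.ratio q :=
  div_nonneg (by exact_mod_cast (D.s_bounds q.2).1) (N_cast_pos _).le

theorem ratio_le_one : D.ratio q ≤ 1 :=
  (div_le_one (N_cast_pos _)).mpr (by exact_mod_cast (D.s_bounds q.2).2)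

theorem ratio_partner : D.ratio (D.partner hlo hhi q) = D.ratio q := by
  unfold ratio
  rw [partner_snd]

theorem ratio_of_s_eq_zero (h : D.s q.2 = 0) : D.ratio q = 0 := by simp [ratio, h]

theorem ratio_of_s_eq_N (h : D.s q.2 = D.N (D.win q.2)) : D.ratio q = 1 := by
  rw [ratio, h, div_self (N_cast_pos _).ne']

theorem angle_of_ratio_eq_zero (h : D.ratio q = 0) : D.angle q = 0 := by
  unfold angle
  simp [h]

theorem angle_of_lower (h : D.Lower q) : D.angle q = D.ratio q * (Real.pi / 2) := by
  simp [angle, h]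

theorem angle_of_upper (h : D.Upper q) : D.angle q = -(D.ratio q * (Real.pi / 2)) := by
  have : ¬ D.Lower q := fun h' => not_lower_and_upper h' h
  simp [angle, h, this]

theorem angle_of_idle (h : ¬ (D.Lower q ∨ D.Upper q)) : D.angle q = 0 := by
  rw [not_or] at h
  simp [angle, h]

theorem angle_partner : D.angle (D.partner hlo hhi q) = -D.angle q := by
  by_cases h : D.Lower q ∨ D.Upper q
  · rcases h with h | h
    · rw [angle_of_lower h, angle_of_upper (upper_partner hlo hhi h), ratio_partner]
    · rw [angle_of_upper h, angle_of_lower (lower_partner hlo hhi h), ratio_partner, neg_neg]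
  · rw [partner_of_idle hlo hhi h, angle_of_idle h, neg_zero]

theorem partner_mem_lastPlaces (h : q ∈ D.lastPlaces) :
    D.partner hlo hhi q ∈ D.lastPlaces :=
  ⟨active_partner hlo hhi h.1, by rw [partner_snd]; exact h.2⟩

/-- Except while a rotation is going on, the next angle is zero. -/
theorem ratio_rot_eq_zero (h : (D.Lower q ∨ D.Upper q) → D.s q.2 = D.N (D.win q.2))
    (h' : D.Lower (rot lo hi q) ∨ D.Upper (rot lo hi q)) : D.ratio (rot lo hi q) = 0 := by
  rcases rot_active h' with h1 | ⟨h1, -, -, -, h2, h3⟩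
  · exact ratio_of_s_eq_zero h1
  · rw [← h2, ← h3] at h'
    have := h h'
    omega

theorem angle_rot_eq_zero (h : (D.Lower q ∨ D.Upper q) → D.s q.2 = D.N (D.win q.2)) :
    D.angle (rot lo hi q) = 0 := by
  by_cases h' : D.Lower (rot lo hi q) ∨ D.Upper (rot lo hi q)
  · exact angle_of_ratio_eq_zero (ratio_rot_eq_zero h h')
  · exact angle_of_idle h'

variable {hlo hhi c}

theorem newWeight_nonneg (hc : ∀ q, 0 ≤ c q) : 0 ≤ D.newWeight hlo hhi c q := by
  unfold newWeight
  split_ifs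
  · exact Real.sqrt_nonneg _
  · exact le_rfl
  · exact hc q

/-- The squares, not the weights, are interpolated linearly, so that a step of the rotation adds at
most 1/N of the difference of the squares to the commutator. -/
theorem newWeight_sq (h : D.Lower q ∨ D.Upper q) : D.newWeight hlo hhi c q ^ 2 =
    (1 - D.ratio q) * c q ^ 2 + D.ratio q * c (D.partner hlo hhi q) ^ 2 := by
  rw [newWeight, if_pos h, Real.sq_sqrt]
  have h1 := ratio_nonneg (D := D) (q := q)
  have h2 := sub_nonneg.mpr (ratio_le_one (D := D) (q := q))
  positivity

theorem newWeight_of_cut (h : D.Cut q) : D.newWeight hlo hhi c q = 0 := by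
  have : ¬ (D.Lower q ∨ D.Upper q) := fun h' =>
    h'.elim (fun h' => not_cut_of_lower h' h) (fun h' => not_cut_of_upper h' h)
  simp [newWeight, h, this]

theorem newWeight_of_notCut (hc : ∀ q, 0 ≤ c q) (h : ¬ D.Cut q)
    (h' : (D.Lower q ∨ D.Upper q) → D.ratio q = 0) : D.newWeight hlo hhi c q = c q := by
  unfold newWeight
  split_ifs with h1
  · simp [h' h1, Real.sqrt_sq (hc q)]
  · rfl

theorem newWeight_of_mem_lastPlaces (hc : ∀ q, 0 ≤ c q) (h : q ∈ D.lastPlaces) :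
    D.newWeight hlo hhi c q = c (D.partner hlo hhi q) := by
  rw [newWeight, if_pos h.1, ratio_of_s_eq_N h.2]
  simp [Real.sqrt_sq (hc _)]

theorem newWeight_mem_Icc (hc : ∀ q, 0 ≤ c q) (h : D.Lower q ∨ D.Upper q) :
    D.newWeight hlo hhi c q ∈ Set.Icc (min (c q) (c (D.partner hlo hhi q)))
      (max (c q) (c (D.partner hlo hhi q))) := by
  have h0 := newWeight_sq (hlo := hlo) (hhi := hhi) (c := c) h
  have h1 := ratio_nonneg (D := D) (q := q)
  have h2 := sub_nonneg.mpr (ratio_le_one (D := D) (q := q))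
  have hx := hc q
  have hy := hc (D.partner hlo hhi q)
  have hw := newWeight_nonneg (D := D) (hlo := hlo) (hhi := hhi) (q := q) hc
  generalize D.newWeight hlo hhi c q = w at *
  generalize c (D.partner hlo hhi q) = y at *
  generalize c q = x at *
  have hm : 0 ≤ min x y := le_min hx hy
  constructor
  · refine le_of_sq_le_sq ?_ hw
    rw [h0]
    calc min x y ^ 2 = (1 - D.ratio q) * min x y ^ 2 + D.ratio q * min x y ^ 2 := by ring
      _ ≤ _ := by gcongr <;> simp
  · refine le_of_sq_le_sq ?_ (hx.trans (le_max_left _ _))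
    rw [h0]
    calc (1 - D.ratio q) * x ^ 2 + D.ratio q * y ^ 2
        ≤ (1 - D.ratio q) * max x y ^ 2 + D.ratio q * max x y ^ 2 := by gcongr <;> simp
      _ = _ := by ring

theorem newWeight_le_max (hc : ∀ q, 0 ≤ c q) :
    D.newWeight hlo hhi c q ≤ max (c q) (c (D.partner hlo hhi q)) := by
  by_cases h : D.Lower q ∨ D.Upper q
  · exact (newWeight_mem_Icc hc h).2
  · rw [newWeight, if_neg h]
    split_ifs
    · exact (hc q).trans (le_max_left _ _)
    · exact le_max_left _ _

end WindowData

namespace WeightBounds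

open WindowData

variable {D : WindowData K lo hi} {c : Pos lo hi → ℝ} {M Q κ : ℝ} (B : WeightBounds D c M Q κ)
  (hlo : Antitone lo) (hhi : Monotone hi)
include B

theorem partner_bounds {q : Pos lo hi} (h : D.Lower q ∨ D.Upper q) :
    |c (D.partner hlo hhi q) - c q| +
      Real.pi / (2 * D.N (D.win q.2)) * max (c q) (c (D.partner hlo hhi q)) ≤ M ∧
    κ + 1 / D.N (D.win q.2) * |c (D.partner hlo hhi q) ^ 2 - c q ^ 2| ≤ Q := by
  rcases h with h | h
  · exact B.next q _ (partner_snd hlo hhi).symm (row_nonneg_of_active (Or.inl h))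
      (row_partner_of_lower hlo hhi h) (lt_hi_of_active (Or.inl h))
  · have h' := lower_partner hlo hhi h
    have h1 := B.next (D.partner hlo hhi q) q (partner_snd hlo hhi)
      (row_nonneg_of_active (Or.inl h')) (by rw [row_partner_of_upper hlo hhi h]; ring)
      (lt_hi_of_active (Or.inl h'))
    rwa [partner_snd, max_comm, abs_sub_comm, abs_sub_comm (c q ^ 2)] at h1

/-- During a rotation, l and h are the minimum and maximum of the two weights, and the angle changes
by π/(2N). An idle place changes only if it is cut; cuts lie in the base row, whose weights are
bounded by `M`. -/
theorem exchange_step (q : Pos lo hi) :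
    (D.partner hlo hhi q = q ∧ q ∉ D.lastPlaces ∧ D.angle (GradualExchange.rot lo hi q) = 0 ∧
      |D.newWeight hlo hhi c q - c q| ≤ M) ∨
    (q ∉ D.lastPlaces ∧ D.partner hlo hhi (GradualExchange.rot lo hi q) =
      GradualExchange.rot lo hi (D.partner hlo hhi q) ∧ ∃ l h : ℝ, 0 ≤ l ∧
      D.newWeight hlo hhi c q ∈ Set.Icc l h ∧
      D.newWeight hlo hhi c (D.partner hlo hhi q) ∈ Set.Icc l h ∧ c q ∈ Set.Icc l h ∧
      c (D.partner hlo hhi q) ∈ Set.Icc l h ∧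
      h - l + |D.angle (GradualExchange.rot lo hi q) - D.angle q| * h ≤ M) ∨
    (q ∈ D.lastPlaces ∧ (D.angle q = Real.pi / 2 ∨ D.angle q = -(Real.pi / 2)) ∧
      D.angle (GradualExchange.rot lo hi q) = 0 ∧
      |D.newWeight hlo hhi c q - c (D.partner hlo hhi q)| ≤ M) := by
  by_cases hq : D.Lower q ∨ D.Upper q
  · rcases (D.s_bounds q.2).2.lt_or_eq with hs | hs
    · right; left
      obtain ⟨h1, h2, h3, h4⟩ := active_rot (hlo := hlo) (hhi := hhi) hq hs
      have h5 := (rot_of_active hq).1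
      have h6 := (rot_of_active hq).2.1
      refine ⟨fun h => hs.ne h.2, h4, min (c q) (c (D.partner hlo hhi q)),
        max (c q) (c (D.partner hlo hhi q)), le_min (B.nonneg _) (B.nonneg _),
        newWeight_mem_Icc B.nonneg hq, ?_, ⟨min_le_left _ _, le_max_left _ _⟩,
        ⟨min_le_right _ _, le_max_right _ _⟩, ?_⟩
      · have := newWeight_mem_Icc (hlo := hlo) (hhi := hhi) B.nonneg (active_partner hlo hhi hq)
        rwa [partner_involutive, min_comm, max_comm] at this
      · refine le_trans (le_of_eq ?_) (B.partner_bounds hlo hhi hq).1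
        rw [max_sub_min_eq_abs]
        have hN := N_cast_pos (D := D) (D.win q.2)
        have hr : D.ratio (GradualExchange.rot lo hi q) - D.ratio q = 1 / D.N (D.win q.2) := by
          unfold ratio
          rw [h3, h6, h5]
          push_cast; ring
        have ha : |D.angle (GradualExchange.rot lo hi q) - D.angle q| =
            Real.pi / (2 * D.N (D.win q.2)) := by
          have h7 : Real.pi / (2 * D.N (D.win q.2)) =
              (D.ratio (GradualExchange.rot lo hi q) - D.ratio q) * (Real.pi / 2) := by
            rw [hr]; field_simp
          rcases hq with hq | hq
          · rw [angle_of_lower hq, angle_of_lower (h1.mpr hq), ← sub_mul, ← h7,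
              abs_of_pos (by positivity)]
          · rw [angle_of_upper hq, angle_of_upper (h2.mpr hq), neg_sub_neg, ← abs_neg, neg_sub,
              ← sub_mul, ← h7, abs_of_pos (by positivity)]
        rw [ha]
    · right; right
      refine ⟨⟨hq, hs⟩, ?_, angle_rot_eq_zero fun _ => hs, ?_⟩
      · rcases hq with hq | hq
        · left; rw [angle_of_lower hq, ratio_of_s_eq_N hs, one_mul]
        · right; rw [angle_of_upper hq, ratio_of_s_eq_N hs, one_mul]
      · rw [newWeight_of_mem_lastPlaces B.nonneg ⟨hq, hs⟩, sub_self, abs_zero]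
        exact B.M_nonneg
  · refine Or.inl ⟨partner_of_idle hlo hhi hq, fun h => hq h.1,
      angle_rot_eq_zero fun h => absurd h hq, ?_⟩
    by_cases hcut : D.Cut q
    · rw [newWeight_of_cut hcut, zero_sub, abs_neg, abs_of_nonneg (B.nonneg q)]
      exact (B.base q hcut.1).1
    · rw [newWeight_of_notCut B.nonneg hcut fun h => absurd h hq, sub_self, abs_zero]
      exact B.M_nonneg

/-- The gradual exchanges in all windows. -/
def exchange : Exchange (GradualExchange.rot lo hi) c M where
  τ := D.partner hlo hhi
  θ := D.angle
  last := D.lastPlaces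
  W := D.newWeight hlo hhi c
  involutive := partner_involutive hlo hhi
  θ_τ _ := angle_partner hlo hhi
  τ_mem_last _ h := partner_mem_lastPlaces hlo hhi h
  W_nonneg _ := newWeight_nonneg B.nonneg
  step := B.exchange_step hlo hhi

theorem perm_of_mem_lastPlaces {q : Pos lo hi} (h : q ∈ D.lastPlaces) :
    (B.exchange hlo hhi).perm q = GradualExchange.rot lo hi (D.partner hlo hhi q) :=
  (B.exchange hlo hhi).perm_of_mem h

theorem perm_of_notMem_lastPlaces {q : Pos lo hi} (h : q ∉ D.lastPlaces) :
    (B.exchange hlo hhi).perm q = GradualExchange.rot lo hi q :=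
  (B.exchange hlo hhi).perm_of_notMem h

theorem exchange_W (q : Pos lo hi) : (B.exchange hlo hhi).W q = D.newWeight hlo hhi c q := rfl

/-- `v` is the new weight of the place that is followed by `rot p`: this is `p` itself if it is
idle, and its partner after a completed rotation. Next to a cut, one weight is 0 and the other
belongs to the base row of the same window, because the first and last places of a window are never
cut. Elsewhere both weights are old weights of one row. -/
theorem abs_newWeight_rot_sub_le {p : Pos lo hi} {v : ℝ}
    (h : (D.Lower p ∨ D.Upper p) → D.s p.2 = D.N (D.win p.2))
    (hv : D.Cut p → v = 0) (hv' : ¬ D.Cut p → v = c p) :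
    |D.newWeight hlo hhi c (GradualExchange.rot lo hi p) ^ 2 - v ^ 2| ≤ Q := by
  have hp := D.mem p.1 p.2 p.2.2.1 p.2.2.2
  by_cases h1 : D.Cut p <;> by_cases h2 : D.Cut (GradualExchange.rot lo hi p)
  · rw [hv h1, newWeight_of_cut h2]
    simpa using B.Q_nonneg
  · rw [hv h1, newWeight_of_notCut B.nonneg h2 (ratio_rot_eq_zero h)]
    have hrow : D.row (GradualExchange.rot lo hi p) = 0 := by
      have h3 := (row_nonneg_iff.mp h1.1.ge).2
      rcases rot_cases D p with ⟨-, -, -, h4, -⟩ | ⟨-, -, -, h4, -⟩ | ⟨h4, -⟩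
      · exact h4.trans h1.1
      · exact absurd h1 (not_cut_at_last h4)
      · exact absurd h1 (not_cut_at_last (by omega))
    rw [zero_pow two_ne_zero, sub_zero, abs_of_nonneg (sq_nonneg _)]
    exact (B.base _ hrow).2
  · rw [hv' h1, newWeight_of_cut h2]
    have hrow : D.row p = 0 := by
      rcases rot_cases D p with ⟨-, -, -, h4, -⟩ | ⟨-, h3, -, -, h4⟩ | ⟨-, h4⟩
      · exact h4.symm.trans h2.1
      · exact absurd h2 (not_cut_at_first (by rw [h3]; exact h4))
      · have h5 : lo p.1 ≤ D.first (D.win (GradualExchange.rot lo hi p).2) :=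
          (row_nonneg_iff.mp h2.1.ge).1
        have h6 := (D.mem _ _ (GradualExchange.rot lo hi p).2.2.1
          (GradualExchange.rot lo hi p).2.2.2).1
        exact absurd h2 (not_cut_at_first (by omega))
    rw [zero_pow two_ne_zero, zero_sub, abs_neg, abs_of_nonneg (sq_nonneg _)]
    exact (B.base _ hrow).2
  · rw [hv' h1, newWeight_of_notCut B.nonneg h2 (ratio_rot_eq_zero h)]
    exact (B.rot p).trans B.le

/-- The increment of the squares is a convex combination of the increments along the two rows, each
at most κ, plus 1/N of the difference between the rows. -/
theorem abs_newWeight_rot_sub_le_of_active {q : Pos lo hi} (hq : D.Lower q ∨ D.Upper q)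
    (hs : D.s q.2 < D.N (D.win q.2)) :
    |D.newWeight hlo hhi c (GradualExchange.rot lo hi q) ^ 2 - D.newWeight hlo hhi c q ^ 2|
      ≤ Q := by
  obtain ⟨h1, h2, h3, h4⟩ := active_rot (hlo := hlo) (hhi := hhi) hq hs
  have h5 := (rot_of_active hq).1
  have h6 := (rot_of_active hq).2.1
  have hN := N_cast_pos (D := D) (D.win q.2)
  have hq' : D.Lower (GradualExchange.rot lo hi q) ∨ D.Upper (GradualExchange.rot lo hi q) := by
    rwa [h1, h2]
  have hr : D.ratio (GradualExchange.rot lo hi q) = D.ratio q + 1 / D.N (D.win q.2) := by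
    unfold ratio
    rw [h3, h6, h5]
    push_cast; ring
  have h7 := ratio_nonneg (D := D) (q := GradualExchange.rot lo hi q)
  have h8 := sub_nonneg.mpr (ratio_le_one (D := D) (q := GradualExchange.rot lo hi q))
  refine le_trans ?_ (B.partner_bounds hlo hhi hq).2
  rw [newWeight_sq hq, newWeight_sq hq', h4]
  have h9 := B.rot q
  have h10 := B.rot (D.partner hlo hhi q)
  have hid : (1 - D.ratio (GradualExchange.rot lo hi q)) * c (GradualExchange.rot lo hi q) ^ 2 +
      D.ratio (GradualExchange.rot lo hi q) *
        c (GradualExchange.rot lo hi (D.partner hlo hhi q)) ^ 2 -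
      ((1 - D.ratio q) * c q ^ 2 + D.ratio q * c (D.partner hlo hhi q) ^ 2) =
      ((1 - D.ratio (GradualExchange.rot lo hi q)) *
        (c (GradualExchange.rot lo hi q) ^ 2 - c q ^ 2) +
      D.ratio (GradualExchange.rot lo hi q) *
        (c (GradualExchange.rot lo hi (D.partner hlo hhi q)) ^ 2 -
          c (D.partner hlo hhi q) ^ 2)) +
      1 / D.N (D.win q.2) * (c (D.partner hlo hhi q) ^ 2 - c q ^ 2) := by
    rw [hr]; ring
  rw [hid]
  refine (abs_add_le _ _).trans (add_le_add ((abs_add_le _ _).trans ?_) ?_)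
  · rw [abs_mul, abs_mul, abs_of_nonneg h7, abs_of_nonneg h8]
    calc _ ≤ (1 - D.ratio (GradualExchange.rot lo hi q)) * κ +
          D.ratio (GradualExchange.rot lo hi q) * κ := by gcongr
      _ = κ := by ring
  · rw [abs_mul, abs_of_pos (by positivity)]

theorem abs_W_perm_sub_le (q : Pos lo hi) :
    |(B.exchange hlo hhi).W ((B.exchange hlo hhi).perm q) ^ 2 - (B.exchange hlo hhi).W q ^ 2|
      ≤ Q := by
  rw [exchange_W, exchange_W]
  by_cases hq : D.Lower q ∨ D.Upper q
  · rcases (D.s_bounds q.2).2.lt_or_eq with hs | hs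
    · rw [perm_of_notMem_lastPlaces B hlo hhi fun h => hs.ne h.2]
      exact B.abs_newWeight_rot_sub_le_of_active hlo hhi hq hs
    · have hp : D.partner hlo hhi q ∈ D.lastPlaces := partner_mem_lastPlaces hlo hhi ⟨hq, hs⟩
      rw [perm_of_mem_lastPlaces B hlo hhi ⟨hq, hs⟩]
      refine B.abs_newWeight_rot_sub_le hlo hhi (fun _ => hp.2) (fun hcut => ?_) fun _ =>
        newWeight_of_mem_lastPlaces B.nonneg ⟨hq, hs⟩
      exact (hp.1.elim (fun h => not_cut_of_lower h hcut) (fun h => not_cut_of_upper h hcut)).elim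
  · rw [perm_of_notMem_lastPlaces B hlo hhi fun h => hq h.1]
    exact B.abs_newWeight_rot_sub_le hlo hhi (fun h => absurd h hq) (fun h => newWeight_of_cut h)
      (fun h => newWeight_of_notCut B.nonneg h fun h => absurd h hq)

theorem of_W_ne_zero {q : Pos lo hi} (h : (B.exchange hlo hhi).W q ≠ 0) :
    ¬ D.Cut q ∧ (q.2 : ℤ) + 1 ≤ hi q.1 := by
  rw [exchange_W] at h
  refine ⟨fun h' => h (newWeight_of_cut h'), ?_⟩
  by_cases hq : D.Lower q ∨ D.Upper q
  · exact lt_hi_of_active hq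
  · by_contra hcon
    have h0 := B.eq_zero q (by omega)
    refine h ?_
    rw [newWeight, if_neg hq, h0, ite_self]

theorem perm_snd {q : Pos lo hi} (h : (B.exchange hlo hhi).W q ≠ 0) :
    (((B.exchange hlo hhi).perm q).2 : ℤ) = q.2 + 1 := by
  by_cases hq : q ∈ D.lastPlaces
  · rw [perm_of_mem_lastPlaces B hlo hhi hq,
      (rot_of_active (partner_mem_lastPlaces hlo hhi hq).1).2.1, partner_snd]
  · rw [perm_of_notMem_lastPlaces B hlo hhi hq, rot_snd, if_pos (B.of_W_ne_zero hlo hhi h).2]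

/-- A path leaves a window only from its right side and enters the next one on the left side. The
right end point of a window is the left end point of the next, so the new eigenvalue does not change
along the path. -/
theorem left_perm {q : Pos lo hi} (h : (B.exchange hlo hhi).W q ≠ 0) :
    (D.win (q.2 + 1) = D.win q.2 ∧ (D.Left ((B.exchange hlo hhi).perm q) ↔ D.Left q)) ∨
    ((D.win (q.2 + 1) : ℕ) = D.win q.2 + 1 ∧ ¬ D.Left q ∧
      D.Left ((B.exchange hlo hhi).perm q)) := by
  have hN := D.N_pos (D.win q.2)
  have hs0 := (D.s_bounds q.2).1
  by_cases hq : q ∈ D.lastPlaces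
  · left
    have hp := partner_mem_lastPlaces hlo hhi hq
    obtain ⟨h1, h2, h3, h4⟩ := rot_of_active hp.1
    have h4 := h4.resolve_left fun h4 => h4.1.ne hp.2
    rw [perm_of_mem_lastPlaces B hlo hhi hq]
    have h5 : D.row q < 0 ↔ False := by simpa using row_nonneg_of_active hq.1
    have h6 : D.row (D.partner hlo hhi q) < 0 ↔ False := by simpa using row_nonneg_of_active hp.1
    unfold Left
    rw [h3, h2, h5, h6]
    rw [partner_snd] at h1 h4 ⊢
    refine ⟨h1, ?_⟩
    simp only [row_nonneg_of_active hq.1, row_nonneg_of_active hp.1, true_and, false_and, or_false]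
    rw [h1, h4.2.1, h4.2.2, hq.2]
    rcases hq.1 with hL | hU
    · rw [row_partner_of_lower hlo hhi hL]
      exact isLeftPart_lower hL
    · rw [row_partner_of_upper hlo hhi hU]
      exact isLeftPart_upper hN hU
  · rw [perm_of_notMem_lastPlaces B hlo hhi hq]
    obtain ⟨hcut, hhi'⟩ := B.of_W_ne_zero hlo hhi h
    rcases rot_cases D q with ⟨-, h2, h3, h4, h5⟩ | ⟨h1, h2, h3, h4, h5⟩ | ⟨h1, -⟩
    · refine Or.inl ⟨h3, ?_⟩
      unfold Left
      rw [h4, h2, h3, rot_fst]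
      refine or_congr (and_congr_right fun h0 => ?_) Iff.rfl
      rcases h5 with ⟨h5, h6, h7⟩ | ⟨h5, h6, h7⟩
      · rw [h6, h7]
        exact isLeftPart_inside hs0 h0 hcut
      · rw [h6, h7, h5]
        have hidle : ¬ (D.Lower q ∨ D.Upper q) := fun h => hq ⟨h, h5⟩
        rw [not_or] at hidle
        have hcut' := hcut
        unfold Cut at hcut'
        rw [h5] at hcut'
        exact isLeftPart_idle hN h0 row_lt hcut' hidle.1 hidle.2
    · refine Or.inr ⟨h3, not_left_at_last h4, left_at_first (by rw [h2]; exact h5)⟩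
    · omega

end WeightBounds

end ExchangeOfWindows

end GradualExchange

end

noncomputable section

namespace GradualExchange

/-! ### From windows of eigenvalues to windows of indices -/

section WindowsOfEigenvalues

variable {m K : ℕ} {a : Fin (K + 1) → ℝ}

theorem window_subset_Icc (k : Fin K) : window a k ⊆ Set.Icc (a k.castSucc) (a k.succ) := by
  unfold window
  split_ifs
  · exact subset_rfl
  · exact Set.Ico_subset_Icc_self

theorem ordConnected_window (k : Fin K) : (window a k).OrdConnected := by
  unfold window
  split_ifs
  · exact Set.ordConnected_Icc
  · exact Set.ordConnected_Ico

theorem diam_window (ha : StrictMono a) (k : Fin K) :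
    Metric.diam (window a k) = a k.succ - a k.castSucc := by
  have h : a k.castSucc ≤ a k.succ := (ha (Fin.castSucc_lt_succ)).le
  unfold window
  split_ifs
  · exact Real.diam_Icc h
  · exact Real.diam_Ico h

theorem lt_of_mem_window (ha : StrictMono a) {k k' : Fin K} (hk : k < k') {x y : ℝ}
    (hx : x ∈ window a k) (hy : y ∈ window a k') : x < y := by
  have hk' : ¬ (k : ℕ) + 1 = K := by
    have := k'.2
    have := Fin.lt_def.mp hk
    omega
  rw [window, if_neg hk'] at hx
  refine (hx.2.trans_le (ha.monotone ?_)).trans_le (window_subset_Icc k' hy).1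
  exact Fin.le_def.mpr (by simpa using Fin.lt_def.mp hk)

theorem eq_of_mem_window (ha : StrictMono a) {k k' : Fin K} {x : ℝ}
    (hx : x ∈ window a k) (hx' : x ∈ window a k') : k = k' := by
  rcases lt_trichotomy k k' with h | h | h
  · exact absurd (lt_of_mem_window ha h hx hx') (lt_irrefl _)
  · exact h
  · exact absurd (lt_of_mem_window ha h hx' hx) (lt_irrefl _)

variable {lo hi : Fin m → ℤ} {eig : ℤ → ℝ}

/-- The indices of the eigenvalues in a window form an interval. -/
theorem exists_index_interval {l u : ℤ} (heig : StrictMonoOn eig (Set.Icc l u)) {I : Set ℝ}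
    (hI : I.OrdConnected) (hne : (eig '' Set.Icc l u ∩ I).ncard ≠ 0) :
    ∃ p : ℤ × ℤ, p.1 ≤ p.2 ∧ (∀ i, (l ≤ i ∧ i ≤ u) ∧ eig i ∈ I ↔ p.1 ≤ i ∧ i ≤ p.2) ∧
      ((eig '' Set.Icc l u ∩ I).ncard : ℤ) = p.2 - p.1 + 1 := by
  classical
  set J : Finset ℤ := (Finset.Icc l u).filter (fun i => eig i ∈ I) with hJ
  have hmem : ∀ i, i ∈ J ↔ (l ≤ i ∧ i ≤ u) ∧ eig i ∈ I := fun i => by simp [hJ]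
  have himage : eig '' Set.Icc l u ∩ I = eig '' (J : Set ℤ) := by
    ext x
    constructor
    · rintro ⟨⟨i, hi, rfl⟩, hx⟩
      exact ⟨i, (hmem i).mpr ⟨hi, hx⟩, rfl⟩
    · rintro ⟨i, hi, rfl⟩
      have := (hmem i).mp hi
      exact ⟨⟨i, this.1, rfl⟩, this.2⟩
  have hinj : Set.InjOn eig (J : Set ℤ) :=
    heig.injOn.mono fun i hi => ((hmem i).mp hi).1
  have hcard : (eig '' Set.Icc l u ∩ I).ncard = J.card := by
    rw [himage, hinj.ncard_image, Set.ncard_coe_finset]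
  have hJne : J.Nonempty := by
    rw [← Finset.card_ne_zero, ← hcard]
    exact hne
  have hicc : ∀ i, i ∈ J ↔ J.min' hJne ≤ i ∧ i ≤ J.max' hJne := by
    intro i
    constructor
    · intro hi
      exact ⟨J.min'_le _ hi, J.le_max' _ hi⟩
    · rintro ⟨h1, h2⟩
      have h3 := (hmem _).mp (J.min'_mem hJne)
      have h4 := (hmem _).mp (J.max'_mem hJne)
      have h5 : l ≤ i ∧ i ≤ u := ⟨h3.1.1.trans h1, h2.trans h4.1.2⟩
      exact (hmem i).mpr ⟨h5, hI.out h3.2 h4.2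
        ⟨heig.monotoneOn h3.1 h5 h1, heig.monotoneOn h5 h4.1 h2⟩⟩
  have hle : J.min' hJne ≤ J.max' hJne := J.min'_le _ (J.max'_mem hJne)
  refine ⟨(J.min' hJne, J.max' hJne), hle, fun i => (hmem i).symm.trans (hicc i), ?_⟩
  have hJ' : J = Finset.Icc (J.min' hJne) (J.max' hJne) := by
    ext i
    rw [hicc i, Finset.mem_Icc]
  have : (J.card : ℤ) = J.max' hJne - J.min' hJne + 1 := by
    conv_lhs => rw [hJ', Int.card_Icc]
    omega
  rw [hcard, this]

/-- Monotonicity of the eigenvalues turns windows into index intervals. The rows are nested, so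
those containing a given window are exactly the rows from the least one on. -/
theorem exists_windowData (hlo : Antitone lo) (hhi : Monotone hi) {top : Fin m}
    (htop : ∀ r, r ≤ top) (heig : StrictMonoOn eig (Set.Icc (lo top) (hi top)))
    (hK : 0 < K) (ha : StrictMono a)
    (hcover : eig '' Set.Icc (lo top) (hi top) ⊆ ⋃ k, window a k) {r₀ : Fin K → Fin m}
    (hr₀ : ∀ k, IsLeast {r | eig '' Set.Icc (lo top) (hi top) ∩ window a k ⊆
      eig '' Set.Icc (lo r) (hi r)} (r₀ k)) {N : Fin K → ℕ} (hN : ∀ k, 1 ≤ N k)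
    (hcard : ∀ k, max 3 ((2 * ((m : ℤ) - (r₀ k : ℕ)) - 3) * ((N k : ℤ) + 1) + 4) ≤
      ((eig '' Set.Icc (lo top) (hi top) ∩ window a k).ncard : ℤ)) :
    ∃ D : WindowData K lo hi, D.base = r₀ ∧ (∀ k, D.N k = N k) ∧
      ∀ r i, lo r ≤ i → i ≤ hi r → eig i ∈ window a (D.win i) := by
  classical
  have hJ := fun k => exists_index_interval heig (ordConnected_window (a := a) k) (by
    have h := (le_max_left _ _).trans (hcard k)
    omega)
  choose p hp1 hp2 hp3 using hJ
  have hwin : ∀ i, ∃ k : Fin K, lo top ≤ i ∧ i ≤ hi top → eig i ∈ window a k := by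
    intro i
    by_cases h : lo top ≤ i ∧ i ≤ hi top
    · obtain ⟨k, hk⟩ := Set.mem_iUnion.mp (hcover ⟨i, h, rfl⟩)
      exact ⟨k, fun _ => hk⟩
    · exact ⟨⟨0, hK⟩, fun h' => absurd h' h⟩
  choose win hwin using hwin
  have hrow : ∀ r i, lo r ≤ i → i ≤ hi r → lo top ≤ i ∧ i ≤ hi top := fun r i h1 h2 =>
    ⟨(hlo (htop r)).trans h1, h2.trans (hhi (htop r))⟩
  have hsub : ∀ k r, eig '' Set.Icc (lo top) (hi top) ∩ window a k ⊆ eig '' Set.Icc (lo r) (hi r) ↔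
      lo r ≤ (p k).1 ∧ (p k).2 ≤ hi r := by
    intro k r
    have hmem : ∀ i, (p k).1 ≤ i → i ≤ (p k).2 →
        eig '' Set.Icc (lo top) (hi top) ∩ window a k ⊆ eig '' Set.Icc (lo r) (hi r) →
        lo r ≤ i ∧ i ≤ hi r := by
      intro i h1 h2 hs
      have h3 := (hp2 k i).mpr ⟨h1, h2⟩
      obtain ⟨j, hj, hji⟩ := hs ⟨⟨i, h3.1, rfl⟩, h3.2⟩
      rwa [← heig.injOn (hrow r j hj.1 hj.2) h3.1 hji]
    constructor
    · intro hs
      exact ⟨(hmem _ le_rfl (hp1 k) hs).1, (hmem _ (hp1 k) le_rfl hs).2⟩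
    · rintro ⟨h1, h2⟩ x ⟨⟨i, hi, rfl⟩, hx⟩
      have h3 := (hp2 k i).mp ⟨hi, hx⟩
      exact ⟨i, ⟨h1.trans h3.1, h3.2.trans h2⟩, rfl⟩
  refine ⟨{ win := win, first := fun k => (p k).1, last := fun k => (p k).2, N := fun k => N k,
            base := r₀, mem := ?_, win_eq := ?_, succ := ?_, base_le := ?_, N_pos := ?_,
            card := ?_ }, rfl, fun _ => rfl, fun r i h1 h2 => hwin i (hrow r i h1 h2)⟩
  · intro r i h1 h2
    exact (hp2 _ i).mp ⟨hrow r i h1 h2, hwin i (hrow r i h1 h2)⟩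
  · intro κ i h1 h2
    have h3 := (hp2 κ i).mpr ⟨h1, h2⟩
    exact eq_of_mem_window ha (hwin i h3.1) h3.2
  · intro r i h1 h2 hne
    have h3 := hrow r i h1 (by omega)
    have h4 := hrow r (i + 1) (by omega) h2
    have h5 : eig i < eig (i + 1) := heig h3 h4 (by omega)
    have h6 : win i < win (i + 1) := by
      refine lt_of_le_of_ne (not_lt.mp fun h => ?_) (Ne.symm hne)
      exact lt_asymm h5 (lt_of_mem_window ha h (hwin _ h4) (hwin _ h3))
    -- No window is empty, by the cardinality hypothesis; a skipped window would contain an index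
    -- strictly between i and i + 1.
    by_contra hcon
    have h7 := Fin.lt_def.mp h6
    set κ : Fin K := ⟨win i + 1, by have := (win (i + 1)).2; omega⟩ with hκ
    have h8 := (hp2 κ (p κ).1).mpr ⟨le_rfl, hp1 κ⟩
    have h9 : eig i < eig (p κ).1 :=
      lt_of_mem_window ha (Fin.lt_def.mpr (Nat.lt_succ_self _)) (hwin _ h3) h8.2
    have h10 : eig (p κ).1 < eig (i + 1) :=
      lt_of_mem_window ha (Fin.lt_def.mpr (by simp only [hκ]; omega)) h8.2 (hwin _ h4)
    have h11 := (heig.lt_iff_lt h3 h8.1).mp h9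
    have h12 := (heig.lt_iff_lt h8.1 h4).mp h10
    omega
  · intro κ r
    rw [← hsub κ r]
    constructor
    · intro h
      have := (hsub κ _).mp (hr₀ κ).1
      exact (hsub κ r).mpr ⟨(hlo h).trans this.1, this.2.trans (hhi h)⟩
    · intro h
      exact (hr₀ κ).2 h
  · intro κ
    exact_mod_cast hN κ
  · intro κ
    exact (hcard κ).trans (hp3 κ).le

/-- A nonzero weight raises the index by one, and the indices are bounded. -/
theorem exists_iterate_eq_zero {R : Type*} [Zero R] {π : Pos lo hi → Pos lo hi} {w : Pos lo hi → R}
    (h : ∀ q, w q ≠ 0 → ((π q).2 : ℤ) = q.2 + 1) (q : Pos lo hi) : ∃ k : ℕ, w (π^[k] q) = 0 := by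
  by_contra hcon
  push Not at hcon
  have h1 : ∀ k : ℕ, ((π^[k] q).2 : ℤ) = q.2 + k := by
    intro k
    induction k with
    | zero => simp
    | succ k ih =>
      rw [Function.iterate_succ_apply', h _ (hcon k), ih]
      push_cast; ring
  obtain ⟨b, hb⟩ := (Set.finite_range fun q : Pos lo hi => (q.2 : ℤ)).bddAbove
  have h2 := hb ⟨π^[(b - q.2 + 1).toNat] q, rfl⟩
  have h3 := hb ⟨q, rfl⟩
  simp only at h2 h3
  rw [h1] at h2
  omega

end WindowsOfEigenvalues

/-! ### The given operators as weighted permutations, and their spectra -/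

section Spectra

variable {m : ℕ} {E : Fin m → Type*} [∀ r, NormedAddCommGroup (E r)]
  [∀ r, InnerProductSpace ℂ (E r)] {lo hi : Fin m → ℤ} {eig : ℤ → ℝ}
  {e : ∀ r, OrthonormalBasis (Set.Icc (lo r) (hi r)) ℂ (E r)} {T : ∀ r, E r →L[ℂ] E r}

theorem isWeightedPerm_directSum_of_isDiag (h : ∀ r, IsDiag (e r) eig (T r)) :
    IsWeightedPerm (Pi.orthonormalBasis e) (Equiv.refl (Pos lo hi)) (fun q => (eig q.2 : ℂ))
      (directSum T) :=
  fun q => directSum_basis e T q (h q.1 q.2)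

theorem realSpectrum_of_isDiag (r : Fin m) (h : IsDiag (e r) eig (T r)) :
    realSpectrum (T r) = eig '' Set.Icc (lo r) (hi r) := by
  have h' : IsWeightedPerm (e r) (Equiv.refl _) (fun i => (eig i : ℂ)) (T r) := h
  ext x
  rw [realSpectrum, Set.mem_ofPred_eq, h'.spectrum_eq]
  simp

theorem realSpectrum_directSum_of_isDiag (hlo : Antitone lo) (hhi : Monotone hi) {top : Fin m}
    (htop : ∀ r, r ≤ top) (h : ∀ r, IsDiag (e r) eig (T r)) :
    realSpectrum (directSum T) = eig '' Set.Icc (lo top) (hi top) := by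
  ext x
  rw [realSpectrum, Set.mem_ofPred_eq, (isWeightedPerm_directSum_of_isDiag h).spectrum_eq]
  constructor
  · rintro ⟨q, hq⟩
    exact ⟨q.2, ⟨(hlo (htop _)).trans q.2.2.1, q.2.2.2.trans (hhi (htop _))⟩, Complex.ofReal_injective hq⟩
  · rintro ⟨i, hi, rfl⟩
    exact ⟨⟨top, i, hi⟩, rfl⟩

theorem isWeightedPerm_directSum_of_isWeightedShift {c : Fin m → ℤ → ℂ}
    (h : ∀ r, IsWeightedShift (e r) (c r) (T r)) :
    IsWeightedPerm (Pi.orthonormalBasis e) (rot lo hi)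
      (fun q => if (q.2 : ℤ) + 1 ≤ hi q.1 then c q.1 q.2 else 0) (directSum T) := by
  intro q
  refine directSum_basis e T q (i := rowRotate _ _ q.2) ?_
  beta_reduce
  rw [h q.1 q.2]
  split_ifs with hq
  · have : rowRotate (lo q.1) (hi q.1) q.2 =
        ⟨(q.2 : ℤ) + 1, le_trans q.2.2.1 (le_of_lt (lt_add_one _)), hq⟩ :=
      Subtype.ext (by rw [coe_rowRotate, if_pos hq])
    rw [this]
  · rw [zero_smul]

end Spectra

/-! ### The constants of a window as upper bounds -/

section Constants

variable {m : ℕ} {lo hi : Fin m → ℤ} {eig : ℤ → ℝ} {c : Fin m → ℤ → ℂ} {R : Set (Fin m)}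
  {I : Set ℝ} {N : ℕ}

theorem bddAbove_pairs (f : Fin m → Fin m → ℤ → ℝ) :
    BddAbove {x : ℝ | ∃ r s : Fin m, r ∈ R ∧ (s : ℕ) = (r : ℕ) + 1 ∧
      ∃ i : ℤ, lo r ≤ i ∧ i < hi r ∧ eig i ∈ I ∧ x = f r s i} := by
  refine Set.Finite.bddAbove (Set.Finite.subset (Set.finite_iUnion fun r : Fin m =>
    Set.finite_iUnion fun s : Fin m => (Set.finite_Icc (lo r) (hi r)).image (f r s)) ?_)
  rintro x ⟨r, s, -, -, i, h1, h2, -, rfl⟩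
  exact Set.mem_iUnion.mpr ⟨r, Set.mem_iUnion.mpr ⟨s, i, ⟨h1, h2.le⟩, rfl⟩⟩

theorem le_constG {r s : Fin m} (hr : r ∈ R) (hs : (s : ℕ) = (r : ℕ) + 1) {i : ℤ} (h1 : lo r ≤ i)
    (h2 : i < hi r) (h3 : eig i ∈ I) :
    |‖c s i‖ - ‖c r i‖| + Real.pi / (2 * N) * max ‖c r i‖ ‖c s i‖ ≤ constG lo hi eig c R I N :=
  le_csSup (bddAbove_pairs fun r s i =>
    |‖c s i‖ - ‖c r i‖| + Real.pi / (2 * N) * max ‖c r i‖ ‖c s i‖)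
    ⟨r, s, hr, hs, i, h1, h2, h3, rfl⟩

theorem le_constT {r s : Fin m} (hr : r ∈ R) (hs : (s : ℕ) = (r : ℕ) + 1) {i : ℤ} (h1 : lo r ≤ i)
    (h2 : i < hi r) (h3 : eig i ∈ I) :
    1 / N * |‖c s i‖ ^ 2 - ‖c r i‖ ^ 2| ≤ constT lo hi eig c R I N :=
  mul_le_mul_of_nonneg_left (le_csSup (bddAbove_pairs fun r s i => |‖c s i‖ ^ 2 - ‖c r i‖ ^ 2|)
    ⟨r, s, hr, hs, i, h1, h2, h3, rfl⟩) (by positivity)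

theorem constT_nonneg : 0 ≤ constT lo hi eig c R I N := by
  refine mul_nonneg (by positivity) (Real.sSup_nonneg ?_)
  rintro x ⟨r, s, -, -, i, -, -, -, rfl⟩
  exact abs_nonneg _

theorem le_constD {r : Fin m} {i : ℤ} (h1 : lo r ≤ i) (h2 : i < hi r) (h3 : eig i ∈ I) :
    ‖c r i‖ ≤ constD lo hi eig c r I := by
  refine le_csSup (Set.Finite.bddAbove
    (((Set.finite_Icc (lo r) (hi r)).image fun i => ‖c r i‖).subset ?_)) ⟨i, h1, h2, h3, rfl⟩
  rintro x ⟨i, h1, h2, -, rfl⟩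
  exact ⟨i, ⟨h1, h2.le⟩, rfl⟩

theorem constD_nonneg {r : Fin m} : 0 ≤ constD lo hi eig c r I := by
  refine Real.sSup_nonneg ?_
  rintro x ⟨i, -, -, -, rfl⟩
  exact norm_nonneg _

end Constants

end GradualExchange

end

noncomputable section

namespace GradualExchange

/-! ### New eigenvalues and the bounds for the given weights -/

section Conclusion

variable {m K : ℕ} {lo hi : Fin m → ℤ} {a : Fin (K + 1) → ℝ}

open Classical in
/-- The new eigenvalues: a path that enters a window from the left gets the left end point of the
window as its eigenvalue, and any other path gets the right end point. -/
def WindowData.newEig (D : WindowData K lo hi) (a : Fin (K + 1) → ℝ) (q : Pos lo hi) : ℝ :=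
  if D.Left q then a (D.win q.2).castSucc else a (D.win q.2).succ

theorem WindowData.abs_newEig_sub_le (D : WindowData K lo hi) (ha : StrictMono a) {x : ℝ}
    {q : Pos lo hi} (hx : x ∈ window a (D.win q.2)) :
    |D.newEig a q - x| ≤ ⨆ k, Metric.diam (window a k) := by
  refine le_trans ?_ (le_ciSup (Set.finite_range fun k => Metric.diam (window a k)).bddAbove
    (D.win q.2))
  rw [diam_window ha, abs_le]
  have h := window_subset_Icc _ hx
  have h1 := h.1
  have h2 := h.2
  unfold WindowData.newEig
  split_ifs <;> constructor <;> linarith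

theorem WeightBounds.newEig_perm {D : WindowData K lo hi} {c : Pos lo hi → ℝ} {M Q κ : ℝ}
    (B : WeightBounds D c M Q κ) (hlo : Antitone lo) (hhi : Monotone hi) {q : Pos lo hi}
    (h : (B.exchange hlo hhi).W q ≠ 0) :
    D.newEig a ((B.exchange hlo hhi).perm q) = D.newEig a q := by
  have h1 := B.perm_snd hlo hhi h
  unfold WindowData.newEig
  rw [h1]
  rcases B.left_perm hlo hhi h with ⟨h2, h3⟩ | ⟨h2, h3, h4⟩
  · rw [h2]
    by_cases hl : D.Left q
    · rw [if_pos (h3.mpr hl), if_pos hl]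
    · rw [if_neg fun h => hl (h3.mp h), if_neg hl]
  · rw [if_neg h3, if_pos h4]
    exact congrArg a (Fin.ext (by simpa using h2))

/-- The weight at the right end of a row is 0 and not `c`, so the bound for the base row is checked
there separately; for neighbouring rows, nestedness makes both weights genuine ones. -/
theorem weightBounds {eig : ℤ → ℝ} {c : Fin m → ℤ → ℂ} (hhi : Monotone hi)
    (D : WindowData K lo hi)
    (hwin : ∀ r i, lo r ≤ i → i ≤ hi r → eig i ∈ window a (D.win i)) (hK : 0 < K)
    {R : Fin K → Set (Fin m)} (hR : ∀ k r, D.base k ≤ r → r ∈ R k) {N : Fin K → ℕ}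
    (hN : ∀ k, D.N k = N k) {G C T : Fin K → ℝ}
    (hG : ∀ k, G k = constG lo hi eig c (R k) (window a k) (N k))
    (hC : ∀ k, C k = constD lo hi eig c (D.base k) (window a k))
    (hT : ∀ k, T k = constT lo hi eig c (R k) (window a k) (N k)) {κ : ℝ} (hκ : 0 ≤ κ)
    {w : Pos lo hi → ℂ} (hw : ∀ q, w q = if (q.2 : ℤ) + 1 ≤ hi q.1 then c q.1 q.2 else 0)
    (hrot : ∀ q, |‖w (rot lo hi q)‖ ^ 2 - ‖w q‖ ^ 2| ≤ κ) :
    WeightBounds D (fun q => ‖w q‖) (⨆ k, max (G k) (C k))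
      (⨆ k, max (κ + T k) (C k ^ 2)) κ := by
  have hM := fun k => le_ciSup (Set.finite_range fun k => max (G k) (C k)).bddAbove k
  have hQ := fun k => le_ciSup (Set.finite_range fun k => max (κ + T k) (C k ^ 2)).bddAbove k
  have hC0 : ∀ k, 0 ≤ C k := fun k => by rw [hC]; exact constD_nonneg
  have hT0 : ∀ k, 0 ≤ T k := fun k => by rw [hT]; exact constT_nonneg
  have hle : κ ≤ ⨆ k, max (κ + T k) (C k ^ 2) :=
    (le_add_of_nonneg_right (hT0 _)).trans ((le_max_left _ _).trans (hQ ⟨0, hK⟩))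
  refine ⟨fun q => norm_nonneg _, fun q hq => ?_, fun q hq => ?_, fun q q' h1 h2 h3 h4 => ?_, hrot,
    hle, (hC0 _).trans ((le_max_right _ _).trans (hM ⟨0, hK⟩)), hκ.trans hle⟩
  · rw [hw, if_neg (by omega), norm_zero]
  · have h1 : ‖w q‖ ≤ C (D.win q.2) := by
      rw [hw]
      split_ifs with h2
      · have h3 : q.1 = D.base (D.win q.2) := Fin.ext (by unfold WindowData.row at hq; omega)
        rw [hC, ← h3]
        exact le_constD q.2.2.1 (by omega) (hwin _ _ q.2.2.1 q.2.2.2)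
      · rw [norm_zero]; exact hC0 _
    refine ⟨h1.trans ((le_max_right _ _).trans (hM _)), ?_⟩
    exact le_trans (by gcongr) ((le_max_right _ _).trans (hQ (D.win q.2)))
  · have h5 : D.base (D.win q.2) ≤ q.1 := Fin.le_def.mpr (by unfold WindowData.row at h2; omega)
    have h6 : (q'.1 : ℕ) = (q.1 : ℕ) + 1 := by
      unfold WindowData.row at h3
      rw [← h1] at h3
      omega
    have h7 : hi q.1 ≤ hi q'.1 := hhi (Fin.le_def.mpr (by omega))
    have h8 := hwin _ _ q.2.2.1 q.2.2.2
    have hq' : w q' = c q'.1 q.2 := by rw [hw, if_pos (by omega), h1]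
    have hq : w q = c q.1 q.2 := by rw [hw, if_pos h4]
    rw [hq, hq', hN, Int.cast_natCast]
    constructor
    · refine le_trans ?_ ((le_max_left _ _).trans (hM (D.win q.2)))
      rw [hG]
      exact le_constG (hR _ _ h5) h6 q.2.2.1 (by omega) h8
    · refine le_trans ?_ ((le_max_left _ _).trans (hQ (D.win q.2)))
      rw [hT]
      exact add_le_add le_rfl (le_constT (hR _ _ h5) h6 q.2.2.1 (by omega) h8)

end Conclusion

end GradualExchange

end

/-! ### The theorem -/

theorem mainTheorem4 {m : ℕ} {E : Fin m → Type*} [∀ r, NormedAddCommGroup (E r)]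
    [∀ r, InnerProductSpace ℂ (E r)] [∀ r, CompleteSpace (E r)]
    -- the nested index intervals `[lo r, hi r]`, the eigenvalues, the weights, the given bases
    (lo hi : Fin m → ℤ) (hne : ∀ r, lo r ≤ hi r) (hlo : Antitone lo) (hhi : Monotone hi)
    (eig : ℤ → ℝ) (heig : ∀ r, StrictMonoOn eig (Set.Icc (lo r) (hi r)))
    (c : Fin m → ℤ → ℂ)
    (e : ∀ r, OrthonormalBasis (Set.Icc (lo r) (hi r)) ℂ (E r))
    -- the blocks and their direct sums
    (Ar Sr : ∀ r, E r →L[ℂ] E r)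
    (hAr : ∀ r, GradualExchange.IsDiag (e r) eig (Ar r))
    (hSr : ∀ r, GradualExchange.IsWeightedShift (e r) (c r) (Sr r))
    (A S : PiLp 2 E →L[ℂ] PiLp 2 E)
    (hA : A = GradualExchange.directSum Ar) (hS : S = GradualExchange.directSum Sr)
    -- the windows
    (K : ℕ) (hK : 0 < K) (a : Fin (K + 1) → ℝ) (ha : StrictMono a)
    (hcover : GradualExchange.realSpectrum A ⊆ ⋃ k, GradualExchange.window a k)
    -- the first row `r₀ k` that contains the spectrum in the `k`-th window
    (r₀ : Fin K → Fin m)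
    (hr₀ : ∀ k, IsLeast (GradualExchange.rows Ar (GradualExchange.window a k)) (r₀ k))
    -- rows are numbered from `0`, so the number of rows from `r₀ k` on is `m - r₀ k`
    (N : Fin K → ℕ) (hN : ∀ k, 1 ≤ N k)
    (hcard : ∀ k, max 3 ((2 * ((m : ℤ) - (r₀ k : ℕ)) - 3) * ((N k : ℤ) + 1) + 4) ≤
      ((GradualExchange.realSpectrum A ∩ GradualExchange.window a k).ncard : ℤ))
    -- the constants attached to the windows
    (G D T : Fin K → ℝ)
    (hG : ∀ k, G k = GradualExchange.constG lo hi eig c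
      (GradualExchange.rows Ar (GradualExchange.window a k)) (GradualExchange.window a k) (N k))
    (hD : ∀ k, D k = GradualExchange.constD lo hi eig c (r₀ k) (GradualExchange.window a k))
    (hT : ∀ k, T k = GradualExchange.constT lo hi eig c
      (GradualExchange.rows Ar (GradualExchange.window a k)) (GradualExchange.window a k) (N k)) :
    ∃ A' S' : PiLp 2 E →L[ℂ] PiLp 2 E,
      IsSelfAdjoint A' ∧ Commute A' S' ∧
      GradualExchange.ShiftSumInEigenbasis A' S' ∧
      ‖A' - A‖ ≤ ⨆ k, Metric.diam (GradualExchange.window a k) ∧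
      ‖S' - S‖ ≤ ⨆ k, max (G k) (D k) ∧
      ‖GradualExchange.selfCommutator S'‖ ≤
        ⨆ k, max (‖GradualExchange.selfCommutator S‖ + T k) (D k ^ 2) ∧
      -- a nearby normal operator, for all admissible constants
      (∀ γ C : ℝ, 0 < γ → 0 < C → GradualExchange.NormalApproximationConstants γ C →
        ∃ S'' : PiLp 2 E →L[ℂ] PiLp 2 E,
          IsStarNormal S'' ∧ Commute A' S'' ∧
          GradualExchange.BilateralShiftSumInEigenbasis A' S'' ∧
          ‖S'' - S'‖ ≤
            C * ‖S‖ ^ (1 - 2 * γ) * ‖GradualExchange.selfCommutator S'‖ ^ γ) ∧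
      -- and, unconditionally, with exponent `1/3` and constant `5.3308`
      (∃ S'' : PiLp 2 E →L[ℂ] PiLp 2 E,
          IsStarNormal S'' ∧ Commute A' S'' ∧
          GradualExchange.BilateralShiftSumInEigenbasis A' S'' ∧
          ‖S'' - S'‖ ≤ 5.3308 * ‖S‖ ^ (1 - 2 * (1 / 3) : ℝ) *
            ‖GradualExchange.selfCommutator S'‖ ^ (1 / 3 : ℝ)) ∧
      -- the real case
      ((∀ r i, lo r ≤ i → i < hi r → (c r i).im = 0) →
        GradualExchange.RealShiftSumInEigenbasis (Pi.orthonormalBasis e) A' S' ∧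
        ∃ S'' : PiLp 2 E →L[ℂ] PiLp 2 E,
          IsStarNormal S'' ∧ Commute A' S'' ∧
          GradualExchange.IsRealOperator (Pi.orthonormalBasis e) S'' ∧
          GradualExchange.RealBilateralShiftSumInEigenbasis (Pi.orthonormalBasis e) A' S'' ∧
          ‖S'' - S'‖ ≤ 5.3308 * ‖S‖ ^ (1 - 2 * (1 / 3) : ℝ) *
            ‖GradualExchange.selfCommutator S'‖ ^ (1 / 3 : ℝ)) := by
  classical
  have hm : 0 < m := (Nat.zero_le _).trans_lt (r₀ ⟨0, hK⟩).2
  -- By nestedness the last row already carries the whole spectrum of `A`.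
  set top : Fin m := ⟨m - 1, by omega⟩ with htop_def
  have htop : ∀ r, r ≤ top := fun r => Fin.le_def.mpr (by simp only [htop_def]; omega)
  have hspec : GradualExchange.realSpectrum A = eig '' Set.Icc (lo top) (hi top) := by
    rw [hA]
    exact GradualExchange.realSpectrum_directSum_of_isDiag hlo hhi htop hAr
  have hrows : ∀ k, GradualExchange.rows Ar (GradualExchange.window a k) =
      {r | eig '' Set.Icc (lo top) (hi top) ∩ GradualExchange.window a k ⊆
        eig '' Set.Icc (lo r) (hi r)} := fun k => by
    ext r
    rw [GradualExchange.rows, Set.mem_ofPred_eq, ← hA, hspec,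
      GradualExchange.realSpectrum_of_isDiag r (hAr r), Set.mem_ofPred_eq]
  obtain ⟨W, hbase, hWN, hwin⟩ := GradualExchange.exists_windowData hlo hhi htop (heig top) hK ha
    (hspec ▸ hcover) (fun k => hrows k ▸ hr₀ k) hN (fun k => hspec ▸ hcard k)
  subst hbase
  have hR : ∀ k r, W.base k ≤ r → r ∈ GradualExchange.rows Ar (GradualExchange.window a k) := by
    rintro k r hr x hx
    obtain ⟨h1, h2⟩ := (W.base_le k r).mp hr
    obtain ⟨h3, h4⟩ := (W.base_le k _).mp le_rfl
    have h5 := (hr₀ k).1 hx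
    rw [GradualExchange.realSpectrum_of_isDiag _ (hAr _)] at h5 ⊢
    obtain ⟨i, hi', rfl⟩ := h5
    have h6 := W.mem _ i hi'.1 hi'.2
    have h7 : W.win i = k :=
      GradualExchange.eq_of_mem_window ha (hwin _ i hi'.1 hi'.2) hx.2
    rw [h7] at h6
    exact ⟨i, ⟨h1.trans h6.1, h6.2.trans h2⟩, rfl⟩
  have hSw := GradualExchange.isWeightedPerm_directSum_of_isWeightedShift hSr
  have hAd := GradualExchange.isWeightedPerm_directSum_of_isDiag hAr
  rw [← hS] at hSw
  rw [← hA] at hAd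
  set w : GradualExchange.Pos lo hi → ℂ :=
    fun q => if (q.2 : ℤ) + 1 ≤ hi q.1 then c q.1 q.2 else 0 with hw
  -- Remove the phases of the weights. The basis vectors are only rescaled, so `A` stays diagonal.
  obtain ⟨e', hS', hee', hreal⟩ := hSw.exists_nonneg (GradualExchange.exists_iterate_eq_zero
    fun q hq => by
      rw [GradualExchange.rot_snd, if_pos]
      by_contra hcon
      exact hq (if_neg hcon))
  have hA' : GradualExchange.IsWeightedPerm e' (Equiv.refl _)
      (fun q : GradualExchange.Pos lo hi => (eig q.2 : ℂ)) A := fun q => by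
    obtain ⟨u, hu⟩ := hee' q
    rw [Equiv.refl_apply, hu, map_smul, hAd q, Equiv.refl_apply, smul_comm]
  have B := GradualExchange.weightBounds hhi W hwin hK hR hWN hG hD hT
    (norm_nonneg (GradualExchange.selfCommutator S)) (w := w) (fun q => rfl)
    hSw.abs_sub_le_norm_selfCommutator
  set X := B.exchange hlo hhi with hX
  set f := X.basis e' with hf
  -- Partners have the same index and hence the same eigenvalue, so `A` is still diagonal in the
  -- rotated basis and can be compared with `A'` entry by entry.
  have hAf : GradualExchange.IsWeightedPerm f (Equiv.refl _)
      (fun q : GradualExchange.Pos lo hi => (eig q.2 : ℂ)) A :=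
    X.isWeightedPerm_basis e' hA' fun q => by
      rw [show ((X.τ q).2 : ℤ) = q.2 from GradualExchange.WindowData.partner_snd hlo hhi]
  have hSn := GradualExchange.isWeightedPerm_weightedPerm f X.perm fun q => (X.weight q : ℂ)
  have hAn := GradualExchange.isWeightedPerm_weightedPerm f (Equiv.refl _)
    fun q => (W.newEig a q : ℂ)
  set S' := GradualExchange.weightedPerm f X.perm fun q => (X.weight q : ℂ)
  set A' := GradualExchange.weightedPerm f (Equiv.refl _) fun q => (W.newEig a q : ℂ)
  have hnorm : ∀ q, ‖(X.weight q : ℂ)‖ = X.W q := fun q => by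
    rw [Complex.norm_real, Real.norm_eq_abs, X.abs_weight]
  have hweight : ∀ q, X.weight q ≠ 0 → X.W q ≠ 0 := fun q hq => by
    rw [← X.abs_weight]
    exact abs_ne_zero.mpr hq
  -- This allows `‖S‖` instead of `‖S'‖` in the bounds for the normal operators.
  have hSS : ‖S'‖ ≤ ‖S‖ := hSn.norm_le (norm_nonneg _) fun q => by
    rw [hnorm]
    exact (GradualExchange.WindowData.newWeight_le_max B.nonneg).trans
      (max_le (hSw.norm_weight_le _) (hSw.norm_weight_le _))
  obtain ⟨h1, h2, h3, h4, h5, h6⟩ := GradualExchange.shiftSum_conclusion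
    (B := Pi.orthonormalBasis e) (R := ∀ r i, lo r ≤ i → i < hi r → (c r i).im = 0) hSn hAn
    (fun q hq => B.newEig_perm hlo hhi (hweight q hq))
    (GradualExchange.exists_iterate_eq_zero fun q hq => B.perm_snd hlo hhi (hweight q hq)) hSS
    (fun hc => by
      refine GradualExchange.IsRealBasis.trans (hreal fun q => ?_) (X.isRealBasis e')
      simp only [hw]
      split_ifs with hq
      · exact hc _ _ q.2.2.1 (by omega)
      · rfl)
  refine ⟨A', S', h1, h2, h3, ?_, ?_, ?_, h4, h5, h6⟩
  · refine (hAn.sub hAf).norm_le (Real.iSup_nonneg fun k => Metric.diam_nonneg) fun q => ?_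
    rw [Pi.sub_apply, ← Complex.ofReal_sub, Complex.norm_real]
    exact W.abs_newEig_sub_le ha (hwin _ _ q.2.2.1 q.2.2.2)
  · exact X.norm_sub_le e' B.M_nonneg hS' hSn
  · refine hSn.norm_selfCommutator_le B.Q_nonneg fun q => ?_
    rw [hnorm, hnorm]
    exact B.abs_W_perm_sub_le hlo hhi q
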